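/- Let $n, k$ be integers with $1 \le k \le n$ and let $L = (l_1, \dots, l_n)$ be closed line segments in $\mathbb{R}^2$, all parallel to one common direction (segments may have length zero). A \emph{placement} is a choice of points $P = (p_1, \dots, p_n)$ with $p_i \in l_i$ for every $i$. For a placement $P$, consider the strictly convex polygons with at most $k$ vertices whose vertices are distinct points of $P$, so that the vertices lie on distinct segments; a single point and a segment between two distinct points are allowed as degenerate polygons of area $0$. The MaxMaxArea problem asks for a placement $P$ such that the largest area of such a polygon is as large as possible among all placements; an \emph{optimal solution} is such a placement together with a polygon attaining this largest area. Then there is an optimal solution in which every $p_i$, hence every vertex of the polygon, is an endpoint of its segment. Moreover, there are a single program for the real RAM (unit-cost arithmetic and comparisons on real numbers, unit-cost addition, subtraction and comparison of natural numbers, indirect addressing, no rounding) and a constant $C$ such that for all such $n$, $k$ and $L$, given $n$, $k$ and the coordinates of the endpoints of the segments, the program halts after at most $C\,k\,n^3$ steps and outputs an optimal solution of this kind: an endpoint of each segment, the vertices of the polygon in counterclockwise order, and its area. In other words, the MaxMaxArea problem for convex polygons with at most $k$ vertices can be solved in $O(kn^3)$ time. -/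

import Mathlib

open MeasureTheory

noncomputable section

namespace Imprecise

/-! ### Imprecise points, polygons, and the optimization problem -/

/-- Points of the plane; `volume` on `ℝ × ℝ` is two-dimensional Lebesgue measure. -/
abbrev Pt : Type := ℝ × ℝ

/-- A closed line segment, given by its two endpoints (which may coincide). -/
structure Seg where
  a : Pt
  b : Pt

/-- The set of points of a segment. -/
def Seg.carrier (s : Seg) : Set Pt := segment ℝ s.a s.b

/-- The two endpoints of a segment: `false` is the first one, `true` the second one. -/
def Seg.endpoint (s : Seg) (e : Bool) : Pt := if e then s.b else s.a

/-- All segments of the family are parallel to one common direction. -/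
def AllParallel {n : ℕ} (L : Fin n → Seg) : Prop :=
  ∃ d : Pt, d ≠ 0 ∧ ∀ i, ∃ t : ℝ, (L i).b - (L i).a = t • d

/-- A placement: one point `P i` chosen on every segment `L i`. -/
def IsPlacement {n : ℕ} (L : Fin n → Seg) (P : Fin n → Pt) : Prop :=
  ∀ i, P i ∈ (L i).carrier

/-- The placement that picks from every segment the endpoint named by `e`. -/
def endpointPlacement {n : ℕ} (L : Fin n → Seg) (e : Fin n → Bool) : Fin n → Pt :=
  fun i => (L i).endpoint (e i)

/-- Twice the signed area of the triangle `p q r`; positive iff `p, q, r` turn counterclockwise. -/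
def cross (p q r : Pt) : ℝ :=
  (q.1 - p.1) * (r.2 - p.2) - (q.2 - p.2) * (r.1 - p.1)

/-- `v 0, …, v (m-1)` are the vertices, in counterclockwise order, of a (strictly) convex polygon.
A single point and two distinct points count as degenerate polygons, with one and two vertices. -/
def IsConvexPolygon {m : ℕ} (v : Fin m → Pt) : Prop :=
  0 < m ∧ Function.Injective v ∧ ∀ i j l : Fin m, i < j → j < l → 0 < cross (v i) (v j) (v l)

/-- The area of the convex polygon with vertices `v`. -/
def area {m : ℕ} (v : Fin m → Pt) : ℝ :=
  (volume (convexHull ℝ (Set.range v))).toReal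

/-- The areas of the convex polygons with at most `k` vertices whose corners belong to `P`.
The points `P (σ j)` are distinct by `IsConvexPolygon`, so `σ` is injective, that is,
the vertices are chosen from distinct segments. -/
def polygonAreas {n : ℕ} (k : ℕ) (P : Fin n → Pt) : Set ℝ :=
  {A | ∃ m, m ≤ k ∧ ∃ σ : Fin m → Fin n, IsConvexPolygon (P ∘ σ) ∧ A = area (P ∘ σ)}

/-- `P` together with the polygon `P (σ 0), …, P (σ (m-1))` is an optimal solution: the polygon is
a largest convex polygon with at most `k` vertices and corners in `P`, and no placement has a
larger largest such polygon. -/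
def IsOptimalSolution {n : ℕ} (L : Fin n → Seg) (k : ℕ) (P : Fin n → Pt)
    {m : ℕ} (σ : Fin m → Fin n) : Prop :=
  IsPlacement L P ∧ m ≤ k ∧ IsConvexPolygon (P ∘ σ) ∧
    IsGreatest (polygonAreas k P) (area (P ∘ σ)) ∧
    ∀ P' : Fin n → Pt, IsPlacement L P' →
      ∀ A', IsGreatest (polygonAreas k P') A' → A' ≤ area (P ∘ σ)

end Imprecise

namespace RealRAM

/-! ### The real RAM

A random access machine with a memory of natural-number cells and a memory of real cells, both
indirectly addressable. Unit cost operations are: reading or writing a cell, `+`, `-` on natural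
numbers, `+`, `-`, `*`, `/` on reals, comparisons, logical connectives and branches. Reals cannot
be rounded or converted to natural numbers. -/

/-- A memory state. -/
structure State where
  nat : ℕ → ℕ
  real : ℕ → ℝ

/-- Natural-number expressions; subtraction is truncated. -/
inductive NatExpr
  | const (c : ℕ)
  | load (addr : NatExpr)
  | add (x y : NatExpr)
  | sub (x y : NatExpr)

def NatExpr.eval (s : State) : NatExpr → ℕ
  | .const c => c
  | .load x => s.nat (x.eval s)
  | .add x y => x.eval s + y.eval s
  | .sub x y => x.eval s - y.eval s

/-- Number of unit cost operations for evaluating the expression. -/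
def NatExpr.cost : NatExpr → ℕ
  | .const _ => 1
  | .load x => x.cost + 1
  | .add x y => x.cost + y.cost + 1
  | .sub x y => x.cost + y.cost + 1

/-- Real expressions; division by zero returns zero. -/
inductive RealExpr
  | const (c : ℚ)
  | load (addr : NatExpr)
  | add (x y : RealExpr)
  | sub (x y : RealExpr)
  | mul (x y : RealExpr)
  | div (x y : RealExpr)

def RealExpr.eval (s : State) : RealExpr → ℝ
  | .const c => (c : ℝ)
  | .load x => s.real (x.eval s)
  | .add x y => x.eval s + y.eval s
  | .sub x y => x.eval s - y.eval s
  | .mul x y => x.eval s * y.eval s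
  | .div x y => x.eval s / y.eval s

def RealExpr.cost : RealExpr → ℕ
  | .const _ => 1
  | .load x => x.cost + 1
  | .add x y => x.cost + y.cost + 1
  | .sub x y => x.cost + y.cost + 1
  | .mul x y => x.cost + y.cost + 1
  | .div x y => x.cost + y.cost + 1

/-- Branching conditions. -/
inductive Cond
  | natLe (x y : NatExpr)
  | natEq (x y : NatExpr)
  | realLe (x y : RealExpr)
  | neg (c : Cond)
  | conj (c d : Cond)

def Cond.holds (s : State) : Cond → Prop
  | .natLe x y => x.eval s ≤ y.eval s
  | .natEq x y => x.eval s = y.eval s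
  | .realLe x y => x.eval s ≤ y.eval s
  | .neg c => ¬ c.holds s
  | .conj c d => c.holds s ∧ d.holds s

def Cond.cost : Cond → ℕ
  | .natLe x y => x.cost + y.cost + 1
  | .natEq x y => x.cost + y.cost + 1
  | .realLe x y => x.cost + y.cost + 1
  | .neg c => c.cost + 1
  | .conj c d => c.cost + d.cost + 1

/-- Programs. -/
inductive Prog
  | skip
  | setNat (addr x : NatExpr)
  | setReal (addr : NatExpr) (x : RealExpr)
  | seq (p q : Prog)
  | branch (c : Cond) (p q : Prog)
  | loop (c : Cond) (p : Prog)

/-- `Runs p s s' t`: started in state `s`, the program `p` halts in state `s'` after exactly `t`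
unit cost operations. -/
inductive Runs : Prog → State → State → ℕ → Prop
  | skip (s : State) : Runs .skip s s 1
  | setNat (addr x : NatExpr) (s : State) :
      Runs (.setNat addr x) s
        { s with nat := Function.update s.nat (addr.eval s) (x.eval s) }
        (addr.cost + x.cost + 1)
  | setReal (addr : NatExpr) (x : RealExpr) (s : State) :
      Runs (.setReal addr x) s
        { s with real := Function.update s.real (addr.eval s) (x.eval s) }
        (addr.cost + x.cost + 1)
  | seq {p q : Prog} {s s' s'' : State} {t t' : ℕ} :
      Runs p s s' t → Runs q s' s'' t' → Runs (.seq p q) s s'' (t + t')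
  | branchTrue {c : Cond} {p : Prog} (q : Prog) {s s' : State} {t : ℕ} :
      c.holds s → Runs p s s' t → Runs (.branch c p q) s s' (c.cost + 1 + t)
  | branchFalse {c : Cond} (p : Prog) {q : Prog} {s s' : State} {t : ℕ} :
      ¬ c.holds s → Runs q s s' t → Runs (.branch c p q) s s' (c.cost + 1 + t)
  | loopTrue {c : Cond} {p : Prog} {s s' s'' : State} {t t' : ℕ} :
      c.holds s → Runs p s s' t → Runs (.loop c p) s' s'' t' →
        Runs (.loop c p) s s'' (c.cost + 1 + t + t')
  | loopFalse {c : Cond} (p : Prog) {s : State} :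
      ¬ c.holds s → Runs (.loop c p) s s (c.cost + 1)

end RealRAM

namespace Imprecise

/-- The `r`-th of the four coordinates of a segment. -/
def Seg.coord (s : Seg) (r : ℕ) : ℝ :=
  if r = 0 then s.a.1 else if r = 1 then s.a.2 else if r = 2 then s.b.1 else s.b.2

/-- The input state: natural cells `0` and `1` hold `n` and `k`, real cells `4 i, …, 4 i + 3` hold
the coordinates of the endpoints of segment `i`, and all other cells hold zero. -/
def inputState {n : ℕ} (L : Fin n → Seg) (k : ℕ) : RealRAM.State where
  nat := fun c => if c = 0 then n else if c = 1 then k else 0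
  real := fun c => if h : c / 4 < n then (L ⟨c / 4, h⟩).coord (c % 4) else 0

/-- The state `s` contains, as output, the choice `e` of an endpoint on each of the `n` segments,
the segments `σ 0, …, σ (m-1)` of the polygon's vertices, and the real number `A`: natural cell `0`
holds `m`, cells `1, …, n` hold `e` (as `0` or `1`), cells `n + 1, …, n + m` hold `σ`, and real
cell `0` holds `A`. -/
def IsOutput {n : ℕ} (s : RealRAM.State) (e : Fin n → Bool) {m : ℕ} (σ : Fin m → Fin n)
    (A : ℝ) : Prop :=
  s.nat 0 = m ∧ (∀ i : Fin n, s.nat (1 + i) = (e i).toNat) ∧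
    (∀ j : Fin m, s.nat (1 + n + j) = σ j) ∧ s.real 0 = A

end Imprecise

end

/-! Let `d` be a direction of the segments. The function `det2 d` is constant on each segment, so it
sorts the segments; breaking ties by index gives every segment its own key. Along a convex polygon
traversed counterclockwise and cut at the vertex of largest key, the keys first decrease and then
increase. Lists with this property, the `Valley`s, form a relaxation of the problem: convexity is
dropped and the area becomes the signed sum `shoelace`.

The relaxation is an upper bound. By `shoelace_cons` the sum is affine in each single vertex, so the
vertices of a polygon on any placement can be moved one after another to endpoints without
decreasing it. Convexity may be lost, but the keys do not change, so the result is still a valley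
(`exists_valley_of_polygon`).

The bound is attained. Take a best valley of at most `k` endpoints such that every shorter valley is
strictly worse. Deleting an entry leaves a valley, hence loses value; the loss is the signed
triangle of the entry and its two neighbours, so all cyclically consecutive triples turn left. For
keys that go down once and up once, this local convexity implies convexity (`cross_pos_of_unimodal`,
`Valley.convexList`). For convex lists `shoelace` is twice the area of the hull
(`ConvexList.volume_convexHull`). If no valley has positive value, a single point is optimal.

Best valleys are found by dynamic programming. The largest key sits at an end of the list
(`Valley.le_ends`), and removing that end leaves a valley. A new end must be compared only with the
two present ends to exceed every key of the list, so the two endpoints of one segment are never both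
used. There are about `k` layers of `(2n)^2` pairs of ends, each entry a maximum over `2n`
candidates, which gives `O(k n^3)`. The chosen entry strictly exceeds all earlier layers, which
supplies the minimality of length needed above. The existence of an optimal solution at endpoints is
read off from the run of the program. -/

namespace Imprecise

/-! ### Volume of triangles -/

/-- The triangle with vertices `(0, 0)`, `(1, 0)`, `(0, 1)`. -/
def unitTriangle : Set Pt := {z | 0 ≤ z.1 ∧ 0 ≤ z.2 ∧ z.1 + z.2 ≤ 1}

theorem measurableSet_unitTriangle : MeasurableSet unitTriangle := by
  have h : IsClosed unitTriangle := by
    refine IsClosed.inter (s₁ := {z : Pt | 0 ≤ z.1}) ?_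
      (IsClosed.inter (s₁ := {z : Pt | 0 ≤ z.2}) (s₂ := {z : Pt | z.1 + z.2 ≤ 1}) ?_ ?_)
    · exact isClosed_le continuous_const continuous_fst
    · exact isClosed_le continuous_const continuous_snd
    · exact isClosed_le (continuous_fst.add continuous_snd) continuous_const
  exact h.measurableSet

theorem volume_unitTriangle : volume unitTriangle = ENNReal.ofReal (1 / 2) := by
  rw [Measure.volume_eq_prod, Measure.prod_apply measurableSet_unitTriangle]
  have hs : ∀ x : ℝ, volume (Prod.mk x ⁻¹' unitTriangle) =
      (Set.Icc (0 : ℝ) 1).indicator (fun x => ENNReal.ofReal (1 - x)) x := by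
    intro x
    by_cases hx : x ∈ Set.Icc (0 : ℝ) 1
    · rw [Set.indicator_of_mem hx]
      have : Prod.mk x ⁻¹' unitTriangle = Set.Icc 0 (1 - x) := by
        ext y
        simp only [unitTriangle, Set.mem_preimage, Set.mem_ofPred_eq, Set.mem_Icc] at hx ⊢
        constructor
        · rintro ⟨_, h, h'⟩; exact ⟨h, by linarith⟩
        · rintro ⟨h, h'⟩; exact ⟨hx.1, h, by linarith⟩
      rw [this, Real.volume_Icc, sub_zero]
    · rw [Set.indicator_of_notMem hx]
      have : Prod.mk x ⁻¹' unitTriangle = ∅ := by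
        ext y
        simp only [unitTriangle, Set.mem_preimage, Set.mem_ofPred_eq, Set.mem_empty_iff_false,
          iff_false]
        rintro ⟨h1, h2, h3⟩
        exact hx ⟨h1, by linarith⟩
      rw [this, measure_empty]
  simp_rw [hs]
  rw [lintegral_indicator measurableSet_Icc, ← ofReal_integral_eq_lintegral_ofReal]
  · congr 1
    rw [integral_Icc_eq_integral_Ioc, ← intervalIntegral.integral_of_le zero_le_one]
    rw [intervalIntegral.integral_sub (by simp) (by simp)]
    simp
    norm_num
  · exact (by fun_prop : Continuous fun x : ℝ => 1 - x).integrableOn_Icc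
  · filter_upwards [ae_restrict_mem measurableSet_Icc] with x hx
    simpa using hx.2

theorem mem_convexHull_triangle {p q r z : Pt} : z ∈ convexHull ℝ {p, q, r} ↔
    ∃ a b c : ℝ, 0 ≤ a ∧ 0 ≤ b ∧ 0 ≤ c ∧ a + b + c = 1 ∧ a • p + b • q + c • r = z := by
  rw [convexHull_insert (by simp), convexHull_pair, mem_convexJoin]
  constructor
  · rintro ⟨_, rfl, y, ⟨b, c, hb, hc, hbc, rfl⟩, s, t, hs, ht, hst, rfl⟩
    refine ⟨s, t * b, t * c, hs, by positivity, by positivity, ?_, ?_⟩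
    · rw [add_assoc, ← mul_add, hbc, mul_one, hst]
    · simp only [smul_add, smul_smul, add_assoc]
  · rintro ⟨a, b, c, ha, hb, hc, h1, rfl⟩
    refine ⟨p, rfl, ?_⟩
    rcases eq_or_lt_of_le (add_nonneg hb hc) with h | h
    · obtain rfl : b = 0 := by linarith
      obtain rfl : c = 0 := by linarith
      obtain rfl : a = 1 := by linarith
      exact ⟨q, left_mem_segment ℝ q r, by simpa using left_mem_segment ℝ p q⟩
    · refine ⟨(b / (b + c)) • q + (c / (b + c)) • r,
        ⟨b / (b + c), c / (b + c), by positivity, by positivity, by field_simp, rfl⟩,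
        a, b + c, ha, h.le, by linarith, ?_⟩
      rw [smul_add, smul_smul, smul_smul, mul_div_cancel₀ _ h.ne', mul_div_cancel₀ _ h.ne',
        add_assoc]

/-- The triangle is a translate of the image of `unitTriangle` under the linear map with columns `q
- p` and `r - p`, whose determinant is `cross p q r`. -/
theorem volume_triangle (p q r : Pt) :
    volume (convexHull ℝ {p, q, r}) = ENNReal.ofReal (|cross p q r| / 2) := by
  let A : Pt →ₗ[ℝ] Pt := Matrix.toLin (Module.Basis.finTwoProd ℝ) (Module.Basis.finTwoProd ℝ)
    !![q.1 - p.1, r.1 - p.1; q.2 - p.2, r.2 - p.2]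
  have hA : ∀ x : Pt, A x = ((q.1 - p.1) * x.1 + (r.1 - p.1) * x.2,
      (q.2 - p.2) * x.1 + (r.2 - p.2) * x.2) := by
    intro x
    simp [A, Matrix.toLin_finTwoProd_apply]
  have hdet : LinearMap.det A = cross p q r := by
    simp only [A, LinearMap.det_toLin, Matrix.det_fin_two_of, cross]
    ring
  have himg : convexHull ℝ {p, q, r} = (fun z => p + z) '' (A '' unitTriangle) := by
    ext z
    rw [mem_convexHull_triangle]
    simp only [Set.mem_image, exists_exists_and_eq_and, hA, unitTriangle, Set.mem_ofPred_eq]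
    constructor
    · rintro ⟨a, b, c, ha, hb, hc, h1, rfl⟩
      refine ⟨(b, c), ⟨hb, hc, by simp; linarith⟩, ?_⟩
      have : a = 1 - b - c := by linarith
      subst this
      ext <;> simp <;> ring
    · rintro ⟨⟨b, c⟩, ⟨hb, hc, h⟩, rfl⟩
      simp only at hb hc h
      refine ⟨1 - b - c, b, c, by linarith, hb, hc, by ring, ?_⟩
      ext <;> simp <;> ring
  rw [himg, Set.image_add_left, measure_preimage_add, Measure.addHaar_image_linearMap, hdet,
    volume_unitTriangle, ← ENNReal.ofReal_mul (abs_nonneg _)]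
  congr 1
  ring

theorem volume_segment (p q : Pt) : volume (segment ℝ p q) = 0 := by
  have h := volume_triangle p q q
  rw [Set.pair_eq_singleton, convexHull_pair] at h
  have h0 : cross p q q = 0 := by simp only [cross]; ring
  rw [h, h0]
  simp

/-! ### Cutting off an ear of a convex hull -/

theorem cross_combo (p q x y : Pt) {a b : ℝ} (h : a + b = 1) :
    cross p q (a • x + b • y) = a * cross p q x + b * cross p q y := by
  obtain rfl : a = 1 - b := by linarith
  simp [cross]
  ring

theorem cross_rotate (p q r : Pt) : cross q r p = cross p q r := by
  simp only [cross]; ring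

theorem convex_halfPlane (p q : Pt) : Convex ℝ {z | 0 ≤ cross p q z} := by
  intro x hx y hy a b ha hb hab
  simp only [Set.mem_ofPred_eq] at hx hy ⊢
  rw [cross_combo p q x y hab]
  positivity

/-- The barycentric coordinates of `z` are the ratios of the three subtriangles at `z` to the whole
triangle. -/
theorem mem_convexHull_triangle_of_cross {p q r z : Pt} (h : 0 < cross p q r)
    (h1 : 0 ≤ cross p q z) (h2 : 0 ≤ cross q r z) (h3 : 0 ≤ cross r p z) :
    z ∈ convexHull ℝ {p, q, r} := by
  rw [mem_convexHull_triangle]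
  refine ⟨cross q r z / cross p q r, cross r p z / cross p q r, cross p q z / cross p q r,
    by positivity, by positivity, by positivity, ?_, ?_⟩
  · rw [← add_div, ← add_div, div_eq_one_iff_eq h.ne']
    simp only [cross]; ring
  · ext
    · simp only [Prod.fst_add, Prod.smul_fst, smul_eq_mul]
      field_simp
      simp only [cross]; ring
    · simp only [Prod.snd_add, Prod.smul_snd, smul_eq_mul]
      field_simp
      simp only [cross]; ring

/-- `S` lies in the cone at `w` spanned by `u` and `l`, beyond the line through `u` and `l`. So the
new hull is the old one together with the triangle `w u l`, and the two pieces meet only in the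
segment from `u` to `l`. -/
theorem volume_convexHull_insert_ear {w u l : Pt} {S : Set Pt} (hu : u ∈ S) (hl : l ∈ S)
    (h : 0 < cross w u l) (h1 : ∀ q ∈ S, 0 ≤ cross w u q)
    (h2 : ∀ q ∈ S, 0 ≤ cross l w q) (h3 : ∀ q ∈ S, 0 ≤ cross l u q) :
    volume (convexHull ℝ (insert w S)) =
      volume (convexHull ℝ S) + ENNReal.ofReal (cross w u l / 2) := by
  have hsub : convexHull ℝ S ⊆ {z | 0 ≤ cross l u z} := convexHull_min h3 (convex_halfPlane _ _)
  have hsub1 : convexHull ℝ S ⊆ {z | 0 ≤ cross w u z} := convexHull_min h1 (convex_halfPlane _ _)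
  have hsub2 : convexHull ℝ S ⊆ {z | 0 ≤ cross l w z} := convexHull_min h2 (convex_halfPlane _ _)
  have hseg : segment ℝ u l ⊆ convexHull ℝ S :=
    (convex_convexHull ℝ S).segment_subset (subset_convexHull ℝ S hu) (subset_convexHull ℝ S hl)
  have hunion : convexHull ℝ (insert w S) = convexHull ℝ S ∪ convexHull ℝ {w, u, l} := by
    apply subset_antisymm
    · rw [convexHull_insert ⟨u, hu⟩]
      intro z hz
      obtain ⟨w', hw', q, hq, a, b, ha, hb, hab, rfl⟩ := mem_convexJoin.1 hz
      rw [Set.mem_singleton_iff] at hw'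
      subst w'
      have hq1 : 0 ≤ cross w u q := hsub1 hq
      have hq2 : 0 ≤ cross l w q := hsub2 hq
      have hq3 : 0 ≤ cross l u q := hsub hq
      have e1 : cross w u (a • w + b • q) = b * cross w u q := by
        rw [cross_combo _ _ _ _ hab]; simp [cross]
      have e2 : cross l w (a • w + b • q) = b * cross l w q := by
        rw [cross_combo _ _ _ _ hab]
        have : cross l w w = 0 := by simp only [cross]; ring
        rw [this]; ring
      have e3 : cross u l (a • w + b • q) = a * cross w u l - b * cross l u q := by
        rw [cross_combo _ _ _ _ hab]; simp only [cross]; ring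
      -- A point between `w` and `q` is either on the side of `w` of the line `u l`, hence in the
      -- ear, or between the crossing point of that line and `q`, hence in the old hull.
      by_cases hz : 0 ≤ cross u l (a • w + b • q)
      · right
        exact mem_convexHull_triangle_of_cross h (by rw [e1]; positivity) hz
          (by rw [e2]; positivity)
      · left
        rw [e3] at hz
        have hc : 0 < cross l u q := by
          by_contra hc
          have : cross l u q = 0 := by linarith
          rw [this] at hz
          apply hz; rw [mul_zero, sub_zero]; positivity
        -- the point where the segment from `q` to `w` crosses the line through `u` and `l`
        set D := cross w u l + cross l u q with hD
        have hDpos : 0 < D := by positivity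
        set c := (cross l u q / D) • w + (cross w u l / D) • q with hcdef
        have hsum : cross l u q / D + cross w u l / D = 1 := by
          rw [← add_div, add_comm, div_self hDpos.ne']
        have hcseg : c ∈ convexHull ℝ S := by
          have hc0 : cross u l c = 0 := by
            rw [hcdef, cross_combo _ _ _ _ hsum]
            have : cross u l w = cross w u l := by simp only [cross]; ring
            have h' : cross u l q = - cross l u q := by simp only [cross]; ring
            rw [this, h']; ring
          have hc1 : 0 ≤ cross w u c := by
            rw [hcdef, cross_combo _ _ _ _ hsum]
            have : cross w u w = 0 := by simp only [cross]; ring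
            rw [this]; positivity
          have hc2 : 0 ≤ cross l w c := by
            rw [hcdef, cross_combo _ _ _ _ hsum]
            have : cross l w w = 0 := by simp only [cross]; ring
            rw [this]; positivity
          apply hseg
          refine ⟨cross l w c / cross w u l, cross w u c / cross w u l, by positivity,
            by positivity, ?_, ?_⟩
          · rw [← add_div, div_eq_one_iff_eq h.ne']
            have : cross w u l = cross w u c + cross u l c + cross l w c := by
              simp only [cross]; ring
            rw [this, hc0]; ring
          · have key : cross w u l • c = cross u l c • w + cross l w c • u + cross w u c • l := by
              ext <;> simp [cross] <;> ring
            rw [hc0, zero_smul, zero_add] at key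
            rw [div_eq_inv_mul, div_eq_inv_mul, mul_smul, mul_smul, ← smul_add, ← key, smul_smul,
              inv_mul_cancel₀ h.ne', one_smul]
        -- The point `c` has weight `cross l u q / D` on `w`, so weight `a` on `w` requires the
        -- coefficient `a * D / cross l u q` of `c`; it is at most one because the point is not on
        -- the side of `w`.
        have hmem : a • w + b • q ∈ segment ℝ c q := by
          have haD : a * D ≤ cross l u q := by
            obtain rfl : b = 1 - a := by linarith
            rw [hD]; nlinarith
          refine ⟨a * D / cross l u q, 1 - a * D / cross l u q, by positivity, ?_, by ring, ?_⟩
          · rw [sub_nonneg, div_le_one hc]; exact haD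
          · obtain rfl : b = 1 - a := by linarith
            have hcD : c = (cross l u q / D) • w + (1 - cross l u q / D) • q := by
              rw [hcdef, ← hsum]; simp
            rw [hcD]
            ext <;> simp <;> field_simp <;> ring
        exact (convex_convexHull ℝ S).segment_subset hcseg hq hmem
    · apply Set.union_subset
      · exact convexHull_mono (Set.subset_insert _ _)
      · apply convexHull_mono
        rintro x (rfl | rfl | rfl)
        · exact Set.mem_insert _ _
        · exact Set.mem_insert_of_mem _ hu
        · exact Set.mem_insert_of_mem _ hl
  have hinter : volume (convexHull ℝ S ∩ convexHull ℝ {w, u, l}) = 0 := by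
    refine measure_mono_null ?_ (volume_segment u l)
    rintro z ⟨hz1, hz2⟩
    obtain ⟨a, b, c, ha, hb, hc, h1, rfl⟩ := mem_convexHull_triangle.1 hz2
    have hz : 0 ≤ cross l u (a • w + b • u + c • l) := hsub hz1
    have : cross l u (a • w + b • u + c • l) = - (a * cross w u l) := by
      obtain rfl : b = 1 - a - c := by linarith
      simp [cross]; ring
    have ha0 : a = 0 := by
      rw [this] at hz
      by_contra hne
      have : 0 < a * cross w u l := mul_pos (lt_of_le_of_ne ha (Ne.symm hne)) h
      linarith
    subst ha0
    exact ⟨b, c, hb, hc, by linarith, by simp⟩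
  have hmeas : MeasurableSet (convexHull ℝ ({w, u, l} : Set Pt)) :=
    (Set.Finite.isClosed_convexHull ℝ (by simp)).measurableSet
  rw [hunion, measure_union₀ hmeas.nullMeasurableSet hinter, volume_triangle, abs_of_pos h]

end Imprecise

namespace List

theorem Triplewise.sublist {α : Type*} {p : α → α → α → Prop} {l l' : List α}
    (h : l'.Triplewise p) (hl : l <+ l') : l.Triplewise p := by
  induction hl with
  | slnil => exact .nil
  | cons a _ ih => exact ih (triplewise_cons.1 h).2
  | cons_cons a hs ih =>
    rw [triplewise_cons] at h ⊢
    exact ⟨h.1.sublist hs, ih h.2⟩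

end List

namespace Imprecise

/-! ### Twice the signed area of a closed polygon -/

/-- The determinant of two vectors. -/
def det2 (p q : Pt) : ℝ := p.1 * q.2 - p.2 * q.1

/-- The sum of the determinants of consecutive points of an open polygonal path. -/
def pathSum : List Pt → ℝ
  | [] => 0
  | [_] => 0
  | a :: b :: t => det2 a b + pathSum (b :: t)

/-- Twice the signed area enclosed by a closed polygonal path. -/
def shoelace : List Pt → ℝ
  | [] => 0
  | a :: t => pathSum (a :: t ++ [a])

theorem pathSum_append_pair (L : List Pt) (x y : Pt) :
    pathSum (L ++ [x, y]) = pathSum (L ++ [x]) + det2 x y := by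
  induction L with
  | nil => simp [pathSum]
  | cons a t ih =>
    cases t with
    | nil => simp [pathSum]
    | cons b t =>
      simp only [List.cons_append, pathSum] at ih ⊢
      rw [ih, add_assoc]

theorem shoelace_rotate_one (a : Pt) (t : List Pt) : shoelace (t ++ [a]) = shoelace (a :: t) := by
  cases t with
  | nil => rfl
  | cons b t =>
    have h := pathSum_append_pair (b :: t) a b
    simp only [shoelace, List.cons_append, List.append_assoc, List.nil_append, pathSum] at h ⊢
    rw [h, add_comm]

theorem shoelace_append_comm (A B : List Pt) : shoelace (A ++ B) = shoelace (B ++ A) := by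
  induction A generalizing B with
  | nil => simp
  | cons a A ih =>
    rw [List.cons_append, ← shoelace_rotate_one, List.append_assoc, ih, List.append_assoc]
    rfl

@[simp] theorem shoelace_singleton (a : Pt) : shoelace [a] = 0 := by
  simp [shoelace, pathSum, det2]; ring

@[simp] theorem shoelace_pair (a b : Pt) : shoelace [a, b] = 0 := by
  simp [shoelace, pathSum, det2]; ring

/-- The closing edge from `l` to `u` is replaced by the detour through `w`, which adds one signed
triangle. This is the source of three facts: the sum is affine in each vertex, deleting a vertex
changes it by a triangle, and the dynamic program has a local recurrence. -/
theorem shoelace_cons {w u l : Pt} {Q : List Pt} (hu : Q.head? = some u)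
    (hl : Q.getLast? = some l) : shoelace (w :: Q) = shoelace Q + cross l w u := by
  obtain ⟨t, rfl⟩ := List.head?_eq_some_iff.1 hu
  obtain ⟨i, hi⟩ := List.getLast?_eq_some_iff.1 hl
  have h1 := pathSum_append_pair i l w
  have h2 := pathSum_append_pair i l u
  have e1 : i ++ [l, w] = u :: t ++ [w] := by rw [hi]; simp
  have e2 : i ++ [l, u] = u :: t ++ [u] := by rw [hi]; simp
  rw [e1] at h1
  rw [e2] at h2
  simp only [shoelace, List.cons_append, pathSum] at h1 h2 ⊢
  rw [h1, h2]
  simp only [det2, cross]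
  ring

theorem shoelace_concat {w u l : Pt} {Q : List Pt} (hu : Q.head? = some u)
    (hl : Q.getLast? = some l) : shoelace (Q ++ [w]) = shoelace Q + cross l w u := by
  rw [shoelace_rotate_one, shoelace_cons hu hl]

/-! ### Convex polygons as lists of points -/

/-- The points of the list are in strictly convex position, in counterclockwise order. -/
abbrev ConvexList (L : List Pt) : Prop := L.Triplewise fun p q r => 0 < cross p q r

theorem ConvexList.rotate_one {a : Pt} {t : List Pt} (h : ConvexList (a :: t)) :
    ConvexList (t ++ [a]) := by
  rw [ConvexList, List.triplewise_cons] at h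
  rw [ConvexList, List.triplewise_append]
  refine ⟨h.2, by simp, by simp, ?_⟩
  intro b hb
  rw [List.mem_singleton] at hb
  subst hb
  exact h.1.imp fun {x y} hxy => by rwa [cross_rotate]

theorem ConvexList.append_comm {A B : List Pt} (h : ConvexList (A ++ B)) :
    ConvexList (B ++ A) := by
  induction A generalizing B with
  | nil => simpa using h
  | cons a A ih =>
    have := ih (B := B ++ [a]) (by simpa using ConvexList.rotate_one h)
    simpa using this

/-- By induction, the head is an ear over the chord joining its two cyclic neighbours, and both
sides grow by the same triangle. -/
theorem ConvexList.volume_convexHull {L : List Pt} (h : ConvexList L) :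
    0 ≤ shoelace L ∧ volume (convexHull ℝ {x | x ∈ L}) = ENNReal.ofReal (shoelace L / 2) := by
  induction L with
  | nil => simp [shoelace]
  | cons w Q ih =>
    rcases Q with _ | ⟨u, Q⟩
    · simp
    rcases List.eq_nil_or_concat Q with rfl | ⟨M, l, rfl⟩
    · refine ⟨by simp, ?_⟩
      have : {x | x ∈ [w, u]} = ({w, u} : Set Pt) := by ext; simp
      rw [this, convexHull_pair, volume_segment]
      simp
    · rw [List.concat_eq_append] at *
      have h' := h
      rw [ConvexList, List.triplewise_cons] at h
      obtain ⟨ih0, ih⟩ := ih h.2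
      have hw := h.1
      rw [List.pairwise_cons, List.pairwise_append] at hw
      have hwul : 0 < cross w u l := hw.1 l (by simp)
      have hl : ∀ q ∈ M, 0 < cross w q l := fun q hq => hw.2.2.2 q hq l (by simp)
      have hu : ∀ q ∈ M, 0 < cross w u q := fun q hq => hw.1 q (by simp [hq])
      have hul : ∀ q ∈ M, 0 < cross u q l := fun q hq => by
        have h2 := h.2
        rw [List.triplewise_cons, List.pairwise_append] at h2
        exact h2.1.2.2 q hq l (by simp)
      have hs : shoelace (w :: u :: (M ++ [l])) = shoelace (u :: (M ++ [l])) + cross l w u :=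
        shoelace_cons (by simp) (by rw [← List.cons_append, List.getLast?_concat])
      have hcr : cross l w u = cross w u l := by simp only [cross]; ring
      have hset : {x | x ∈ w :: u :: (M ++ [l])} = insert w {x | x ∈ u :: (M ++ [l])} := by
        ext; simp
      refine ⟨by rw [hs, hcr]; positivity, ?_⟩
      rw [hset, volume_convexHull_insert_ear (u := u) (l := l) (by simp) (by simp) hwul, ih, hs,
        hcr, ← ENNReal.ofReal_add (by positivity) (by positivity)]
      · congr 1; ring
      · intro q hq
        simp only [List.mem_cons, List.mem_append, Set.mem_ofPred_eq, List.not_mem_nil,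
          or_false] at hq
        rcases hq with rfl | hq | rfl
        · simp [cross, mul_comm]
        · exact (hu q hq).le
        · exact hwul.le
      · intro q hq
        simp only [List.mem_cons, List.mem_append, Set.mem_ofPred_eq, List.not_mem_nil,
          or_false] at hq
        rcases hq with rfl | hq | rfl
        · rw [hcr]; exact hwul.le
        · have := hl q hq
          rw [← cross_rotate, ← cross_rotate] at this
          exact this.le
        · simp [cross]
      · intro q hq
        simp only [List.mem_cons, List.mem_append, Set.mem_ofPred_eq, List.not_mem_nil,
          or_false] at hq
        rcases hq with rfl | hq | rfl
        · simp [cross, mul_comm]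
        · have := hul q hq
          rw [← cross_rotate, ← cross_rotate] at this
          exact this.le
        · simp [cross]

theorem IsConvexPolygon.convexList {m : ℕ} {v : Fin m → Pt} (h : IsConvexPolygon v) :
    ConvexList (List.ofFn v) := by
  rw [ConvexList, List.triplewise_iff_getElem]
  intro i j k hij hjk hk
  simp only [List.getElem_ofFn]
  exact h.2.2 _ _ _ (by simpa using hij) (by simpa using hjk)

theorem area_eq_shoelace {m : ℕ} {v : Fin m → Pt} (h : IsConvexPolygon v) :
    area v = shoelace (List.ofFn v) / 2 := by
  obtain ⟨h0, h1⟩ := h.convexList.volume_convexHull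
  have : Set.range v = {x | x ∈ List.ofFn v} := by
    ext x; simp [List.mem_ofFn]
  rw [area, this, h1, ENNReal.toReal_ofReal (by positivity)]

/-- With at least three vertices, two equal ones together with any third would form a degenerate
triple, so injectivity is automatic. -/
theorem ConvexList.isConvexPolygon {m : ℕ} {v : Fin m → Pt} (hm : 3 ≤ m)
    (h : ConvexList (List.ofFn v)) : IsConvexPolygon v := by
  rw [ConvexList, List.triplewise_iff_getElem] at h
  have h3 : ∀ i j l : Fin m, i < j → j < l → 0 < cross (v i) (v j) (v l) := by
    intro i j l hij hjl
    have := h i j l hij hjl (by simp)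
    simpa using this
  refine ⟨by omega, ?_, h3⟩
  have key : ∀ i j : Fin m, i < j → v i ≠ v j := by
    intro i j hij he
    -- The third index is taken between `i` and `j`, after `j`, or before `i`; one of these exists
    -- since `3 ≤ m`.
    by_cases h1 : (i : ℕ) + 1 < j
    · have := h3 i ⟨i + 1, by omega⟩ j (by simp [Fin.lt_def]) (by simpa [Fin.lt_def] using h1)
      rw [he] at this
      simp [cross, mul_comm] at this
    by_cases h2 : (j : ℕ) + 1 < m
    · have := h3 i j ⟨j + 1, h2⟩ hij (by simp [Fin.lt_def])
      rw [he] at this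
      simp [cross] at this
    have := h3 ⟨0, by omega⟩ i j (by rw [Fin.lt_def] at hij ⊢; simp; omega) hij
    rw [he] at this
    simp [cross, mul_comm] at this
  intro i j he
  rcases lt_trichotomy i j with h | h | h
  · exact absurd he (key i j h)
  · exact h
  · exact absurd he.symm (key j i h)

end Imprecise

namespace Imprecise

/-! ### Lists of keys without an interior peak -/

section Valley

variable {ι K : Type*} [LinearOrder K] {ρ : ι → K}

/-- The keys of the entries are distinct, first decrease and then increase. -/
def Valley (ρ : ι → K) (Q : List ι) : Prop :=
  Q.Pairwise (fun a b => ρ a ≠ ρ b) ∧ Q.Triplewise fun a b c => ¬(ρ a < ρ b ∧ ρ c < ρ b)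

theorem Valley.sublist {Q Q' : List ι} (h : Valley ρ Q') (hs : Q.Sublist Q') : Valley ρ Q :=
  ⟨h.1.sublist hs, h.2.sublist hs⟩

theorem Valley.cons {Q : List ι} {w : ι} (h : Valley ρ Q) (hw : ∀ q ∈ Q, ρ q < ρ w) :
    Valley ρ (w :: Q) := by
  refine ⟨List.pairwise_cons.2 ⟨fun q hq => (hw q hq).ne', h.1⟩,
    List.triplewise_cons.2 ⟨?_, h.2⟩⟩
  refine List.Pairwise.imp_of_mem (R := fun _ _ => True) ?_ (List.pairwise_of_forall (by simp))
  intro a b ha _ _ hab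
  exact (hw a ha).not_gt hab.1

theorem Valley.concat {Q : List ι} {w : ι} (h : Valley ρ Q) (hw : ∀ q ∈ Q, ρ q < ρ w) :
    Valley ρ (Q ++ [w]) := by
  refine ⟨List.pairwise_append.2 ⟨h.1, by simp, ?_⟩, List.triplewise_append.2
    ⟨h.2, by simp, by simp, ?_⟩⟩
  · intro a ha b hb
    rw [List.mem_singleton] at hb
    subst hb
    exact (hw a ha).ne
  · intro a ha
    rw [List.mem_singleton] at ha
    subst ha
    refine List.Pairwise.imp_of_mem (R := fun _ _ => True) ?_ (List.pairwise_of_forall (by simp))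
    intro x y _ hy _ hab
    exact (hw y hy).not_gt hab.2

/-- An inner entry exceeding both ends would be a peak. Hence an item with a key above both ends is
above the whole list, so the ends are all that a table entry has to remember. -/
theorem Valley.le_ends {Q : List ι} {u l : ι} (h : Valley ρ Q) (hu : Q.head? = some u)
    (hl : Q.getLast? = some l) {q : ι} (hq : q ∈ Q) : ρ q ≤ ρ u ∨ ρ q ≤ ρ l := by
  obtain ⟨t, rfl⟩ := List.head?_eq_some_iff.1 hu
  rcases List.eq_nil_or_concat t with rfl | ⟨M, l', rfl⟩
  · left; rw [List.mem_singleton] at hq; rw [hq]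
  · rw [List.concat_eq_append] at *
    rw [← List.cons_append, List.getLast?_concat, Option.some.injEq] at hl
    subst hl
    simp only [List.mem_cons, List.mem_append, List.not_mem_nil, or_false] at hq
    rcases hq with rfl | hq | rfl
    · exact Or.inl le_rfl
    · have h2 := (List.triplewise_cons.1 h.2).1
      rw [List.pairwise_append] at h2
      have := h2.2.2 q hq l' (by simp)
      by_contra hc
      push Not at hc
      exact this hc
    · exact Or.inr le_rfl

theorem valley_map {κ : Type*} {g : κ → ι} {Q : List κ} :
    Valley ρ (Q.map g) ↔ Valley (ρ ∘ g) Q := by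
  simp only [Valley, List.pairwise_map, List.triplewise_map, Function.comp_apply]

end Valley

/-! ### Convex polygons are valleys -/

theorem cross_eq_zero_of_det2_eq {d a b c : Pt} (hd : d ≠ 0) (hb : det2 d a = det2 d b)
    (hc : det2 d a = det2 d c) : cross a b c = 0 := by
  have h1 : d.1 * cross a b c = 0 := by
    simp only [det2, cross] at *
    linear_combination (a.1 - b.1) * hc - (a.1 - c.1) * hb
  have h2 : d.2 * cross a b c = 0 := by
    simp only [det2, cross] at *
    linear_combination (a.2 - b.2) * hc - (a.2 - c.2) * hb
  by_contra h
  apply hd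
  rw [mul_eq_zero, or_iff_left h] at h1 h2
  exact Prod.ext h1 h2

/-- The affine dependence of four points of the plane gives three nonnegative terms with sum zero.
All of them vanish, which puts `a`, `b`, `c` on one line parallel to `d`, against `habc`. -/
theorem no_peak_of_convex {d a b c e : Pt} (hd : d ≠ 0) (habc : 0 < cross a b c)
    (habe : 0 < cross a b e) (hbce : 0 < cross b c e)
    (hab : det2 d a ≤ det2 d b) (hcb : det2 d c ≤ det2 d b) (hbe : det2 d b ≤ det2 d e) :
    False := by
  have hsum : cross b c e * (det2 d b - det2 d a) + cross a b e * (det2 d b - det2 d c)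
      + cross a b c * (det2 d e - det2 d b) = 0 := by
    simp only [det2, cross]; ring
  have h1 := mul_nonneg hbce.le (sub_nonneg.2 hab)
  have h2 := mul_nonneg habe.le (sub_nonneg.2 hcb)
  have h3 := mul_nonneg habc.le (sub_nonneg.2 hbe)
  have h1' : cross b c e * (det2 d b - det2 d a) = 0 := by linarith
  have h2' : cross a b e * (det2 d b - det2 d c) = 0 := by linarith
  rw [mul_eq_zero, or_iff_right hbce.ne'] at h1'
  rw [mul_eq_zero, or_iff_right habe.ne'] at h2'
  exact habc.ne' (cross_eq_zero_of_det2_eq hd (by linarith) (by linarith))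

/-- The cycle is cut just after the vertex `M` of largest key. Any peak among the remaining vertices
contradicts `no_peak_of_convex` with `M` as the fourth point. -/
theorem ConvexList.exists_rotation_valley {ι K : Type*} [LinearOrder K] {ρ : ι → K} {P : ι → Pt}
    {d : Pt} (hd : d ≠ 0) {τ : List ι} (h : ConvexList (τ.map P))
    (hne : τ.Pairwise (fun a b => ρ a ≠ ρ b))
    (hmono : ∀ a ∈ τ, ∀ b ∈ τ, ρ a ≤ ρ b → det2 d (P a) ≤ det2 d (P b)) :
    ∃ A B, τ = A ++ B ∧ Valley ρ (B ++ A) := by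
  rcases eq_or_ne τ [] with rfl | h0
  · exact ⟨[], [], rfl, by simp [Valley]⟩
  classical
  obtain ⟨M, hM, hmax⟩ := Finset.exists_max_image τ.toFinset ρ
    (by obtain ⟨a, ha⟩ := List.exists_mem_of_ne_nil _ h0; exact ⟨a, by simpa using ha⟩)
  simp only [List.mem_toFinset] at hM hmax
  obtain ⟨A, B, rfl⟩ := List.append_of_mem hM
  refine ⟨A ++ [M], B, by simp, ?_⟩
  have hne' : (B ++ (A ++ [M])).Pairwise (fun a b => ρ a ≠ ρ b) := by
    refine (List.Perm.pairwise_iff (fun {x y} hxy => hxy.symm) ?_).1 hne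
    have : A ++ M :: B = (A ++ [M]) ++ B := by simp
    rw [this]
    exact List.perm_append_comm
  have hc : ConvexList ((B ++ A).map P ++ [P M]) := by
    have := ConvexList.append_comm (A := (A ++ [M]).map P) (B := B.map P) (by simpa using h)
    simpa using this
  rw [ConvexList, List.triplewise_append] at hc
  have hc2 := hc.2.2.2 (P M) (by simp)
  have hc1 := hc.1
  rw [← List.append_assoc] at hne' ⊢
  rw [List.triplewise_map] at hc1
  rw [List.pairwise_map] at hc2
  have hmem : ∀ q ∈ B ++ A, q ∈ A ++ M :: B := by
    intro q hq
    simp only [List.mem_append, List.mem_cons] at hq ⊢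
    tauto
  apply Valley.concat
  · refine ⟨(List.pairwise_append.1 hne').1, ?_⟩
    rw [List.triplewise_iff_getElem] at hc1 ⊢
    rw [List.pairwise_iff_getElem] at hc2
    intro i j k hij hjk hk hpeak
    have hm : ∀ (i : ℕ) (hi : i < (B ++ A).length), (B ++ A)[i] ∈ A ++ M :: B :=
      fun i hi => hmem _ (List.getElem_mem hi)
    exact no_peak_of_convex hd (hc1 i j k hij hjk hk) (hc2 i j (by omega) (by omega) hij)
      (hc2 j k (by omega) (by omega) (by omega))
      (hmono _ (hm _ _) _ (hm _ _) hpeak.1.le) (hmono _ (hm _ _) _ (hm _ _) hpeak.2.le)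
      (hmono _ (hm _ _) _ hM (hmax _ (hm _ _)))
  · intro q hq
    exact lt_of_le_of_ne (hmax q (hmem q hq))
      ((List.pairwise_append.1 hne').2.2 q hq M (by simp))

/-! ### Moving points to endpoints -/

/-- Since `i` occurs at most once in `τ`, moving `P i` leaves the other vertices fixed. The sum is
then affine in `P i`, so its maximum over the segment is attained at an endpoint. -/
theorem exists_endpoint_shoelace_le {n : ℕ} (L : Fin n → Seg) (P : Fin n → Pt) (i : Fin n)
    (hi : P i ∈ (L i).carrier) {τ : List (Fin n)} (hτ : τ.Nodup) :
    ∃ b : Bool, shoelace (τ.map P) ≤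
      shoelace (τ.map (Function.update P i ((L i).endpoint b))) := by
  by_cases hmem : i ∈ τ
  · obtain ⟨A, B, rfl⟩ := List.append_of_mem hmem
    have hnot : i ∉ B ++ A := by
      rw [List.nodup_append, List.nodup_cons] at hτ
      simp only [List.mem_append, not_or]
      exact ⟨hτ.2.1.1, fun h => hτ.2.2 i h i (by simp) rfl⟩
    have hrot : ∀ P' : Fin n → Pt, shoelace ((A ++ i :: B).map P') =
        shoelace (P' i :: (B ++ A).map P') := by
      intro P'
      rw [List.map_append, shoelace_append_comm]
      simp
    have hcongr : ∀ x, (B ++ A).map (Function.update P i x) = (B ++ A).map P := by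
      intro x
      apply List.map_congr_left
      intro j hj
      rw [Function.update_of_ne]
      rintro rfl
      exact hnot hj
    simp only [hrot, hcongr, Function.update_self]
    rcases eq_or_ne (B ++ A) [] with h0 | h0
    · rw [h0]; exact ⟨false, by simp⟩
    · have hne : (B ++ A).map P ≠ [] := by simpa using h0
      have hs : ∀ w, shoelace (w :: (B ++ A).map P) = _ := fun w => shoelace_cons (w := w)
        (List.head?_eq_some_head hne) (List.getLast?_eq_some_getLast hne)
      simp only [hs, add_le_add_iff_left]
      set u := ((B ++ A).map P).head hne
      set l := ((B ++ A).map P).getLast hne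
      obtain ⟨s, t, hs0, ht0, hst, hP⟩ := hi
      rw [← hP]
      have hlin : cross l (s • (L i).a + t • (L i).b) u =
          s * cross l (L i).a u + t * cross l (L i).b u := by
        obtain rfl : s = 1 - t := by linarith
        simp [cross]; ring
      rw [hlin]
      by_cases hle : cross l (L i).a u ≤ cross l (L i).b u
      · refine ⟨true, ?_⟩
        simp only [Seg.endpoint, if_true]
        obtain rfl : s = 1 - t := by linarith
        nlinarith
      · refine ⟨false, ?_⟩
        simp only [Seg.endpoint, Bool.false_eq_true, if_false]
        obtain rfl : s = 1 - t := by linarith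
        nlinarith
  · refine ⟨false, le_of_eq ?_⟩
    congr 1
    apply List.map_congr_left
    intro j hj
    rw [Function.update_of_ne]
    rintro rfl
    exact hmem hj

/-- The segments are treated one at a time. Only the order of the vertices is kept; the moved
polygon need not be convex. -/
theorem exists_endpointPlacement_shoelace_le {n : ℕ} (L : Fin n → Seg) {P : Fin n → Pt}
    (hP : IsPlacement L P) {τ : List (Fin n)} (hτ : τ.Nodup) :
    ∃ e : Fin n → Bool, shoelace (τ.map P) ≤ shoelace (τ.map (endpointPlacement L e)) := by
  have key : ∀ S : Finset (Fin n), ∃ P' : Fin n → Pt, IsPlacement L P' ∧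
      (∀ i ∈ S, ∃ b, P' i = (L i).endpoint b) ∧
      shoelace (τ.map P) ≤ shoelace (τ.map P') := by
    intro S
    induction S using Finset.induction_on with
    | empty => exact ⟨P, hP, by simp, le_rfl⟩
    | insert i S hi ih =>
      obtain ⟨P', h1, h2, h3⟩ := ih
      obtain ⟨b, hb⟩ := exists_endpoint_shoelace_le L P' i (h1 i) hτ
      refine ⟨_, ?_, ?_, h3.trans hb⟩
      · intro j
        rcases eq_or_ne j i with rfl | hj
        · rw [Function.update_self]
          cases b
          · exact left_mem_segment ℝ _ _
          · exact right_mem_segment ℝ _ _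
        · rw [Function.update_of_ne hj]; exact h1 j
      · intro j hj
        rcases eq_or_ne j i with rfl | hji
        · exact ⟨b, Function.update_self ..⟩
        · rw [Function.update_of_ne hji]
          exact h2 j ((Finset.mem_insert.1 hj).resolve_left hji)
  obtain ⟨P', -, h2, h3⟩ := key Finset.univ
  choose e he using fun i => h2 i (Finset.mem_univ i)
  refine ⟨e, ?_⟩
  have : P' = endpointPlacement L e := funext he
  rwa [← this]

/-! ### Locally convex valleys are convex -/

/-- Inside a closed half-plane, turning left is transitive by the Plücker identity `key`; the only
exception is two outer vectors both on the boundary line. -/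
theorem det2_trans {d x y z : Pt} (hx : 0 ≤ det2 d x) (hy : 0 ≤ det2 d y) (hz : 0 ≤ det2 d z)
    (hxy : 0 < det2 x y) (hyz : 0 < det2 y z) (hne : ¬(det2 d x = 0 ∧ det2 d z = 0)) :
    0 < det2 x z := by
  have key : det2 d y * det2 x z = det2 d z * det2 x y + det2 d x * det2 y z := by
    simp only [det2]; ring
  have hpos : 0 < det2 d y * det2 x z := by
    rw [key]
    rcases hx.eq_or_lt with h | h
    · have : 0 < det2 d z := lt_of_le_of_ne hz fun h' => hne ⟨h.symm, h'.symm⟩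
      have := mul_pos this hxy
      have := mul_nonneg hx hyz.le
      linarith
    · have := mul_pos h hyz
      have := mul_nonneg hz hxy.le
      linarith
  exact pos_of_mul_pos_right hpos hy

/-- Along a chain monotone across `d`, all edges and chords lie in one half-plane, so `det2_trans`
applies. Its exceptional case would make `a`, `b`, `c` collinear. -/
theorem cross_pos_of_chain {d a b c e : Pt} (hd : d ≠ 0) (hab : det2 d a ≤ det2 d b)
    (hbc : det2 d b ≤ det2 d c) (hce : det2 d c ≤ det2 d e) (h1 : 0 < cross a b c)
    (h2 : 0 < cross b c e) : 0 < cross a b e ∧ 0 < cross a c e := by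
  have hsub : ∀ x y : Pt, det2 d (x - y) = det2 d x - det2 d y := by
    intro x y; simp [det2]; ring
  constructor
  · have : cross a b e = det2 (b - a) (e - b) := by simp [cross, det2]; ring
    rw [this]
    refine det2_trans (d := d) (y := c - b) ?_ ?_ ?_ ?_ ?_ ?_
    · rw [hsub]; linarith
    · rw [hsub]; linarith
    · rw [hsub]; linarith
    · convert h1 using 1; simp [cross, det2]; ring
    · convert h2 using 1; simp [cross, det2]
    · rw [hsub, hsub]
      rintro ⟨h, h'⟩
      exact h1.ne' (cross_eq_zero_of_det2_eq hd (by linarith) (by linarith))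
  · have : cross a c e = det2 (c - a) (e - c) := by simp [cross, det2]; ring
    rw [this]
    refine det2_trans (d := d) (y := c - b) ?_ ?_ ?_ ?_ ?_ ?_
    · rw [hsub]; linarith
    · rw [hsub]; linarith
    · rw [hsub]; linarith
    · convert h1 using 1; simp [cross, det2]; ring
    · convert h2 using 1; simp [cross, det2]; ring
    · rw [hsub, hsub]
      rintro ⟨h, h'⟩
      exact h1.ne' (cross_eq_zero_of_det2_eq hd (by linarith) (by linarith))

/-- The same transitivity when the points appear in angular order around `o`: the half-plane is
bounded by the ray from `o` through the shared vertex, and strictness of that order excludes the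
exceptional case. -/
theorem cross_pos_of_apex {o a b c e : Pt} (hab : 0 < cross o a b) (hac : 0 < cross o a c)
    (hbc : 0 < cross o b c) (hbe : 0 < cross o b e) (hce : 0 < cross o c e)
    (h1 : 0 < cross a b c) (h2 : 0 < cross b c e) : 0 < cross a b e ∧ 0 < cross a c e := by
  constructor
  · have : cross a b e = det2 (b - a) (e - b) := by simp [cross, det2]; ring
    rw [this]
    have e1 : det2 (b - o) (b - a) = cross o a b := by simp [cross, det2]; ring
    have e2 : det2 (b - o) (c - b) = cross o b c := by simp [cross, det2]; ring
    have e3 : det2 (b - o) (e - b) = cross o b e := by simp [cross, det2]; ring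
    refine det2_trans (d := b - o) (y := c - b) (e1 ▸ hab.le) (e2 ▸ hbc.le) (e3 ▸ hbe.le) ?_ ?_
      fun h => ?_
    · convert h1 using 1; simp [cross, det2]; ring
    · convert h2 using 1; simp [cross, det2]
    · rw [e1] at h; exact hab.ne' h.1
  · have : cross a c e = det2 (c - a) (e - c) := by simp [cross, det2]; ring
    rw [this]
    have e1 : det2 (c - o) (c - a) = cross o a c := by simp [cross, det2]; ring
    have e2 : det2 (c - o) (c - b) = cross o b c := by simp [cross, det2]; ring
    have e3 : det2 (c - o) (e - c) = cross o c e := by simp [cross, det2]; ring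
    refine det2_trans (d := c - o) (y := c - b) (e1 ▸ hac.le) (e2 ▸ hbc.le) (e3 ▸ hce.le) ?_ ?_
      fun h => ?_
    · convert h1 using 1; simp [cross, det2]; ring
    · convert h2 using 1; simp [cross, det2]; ring
    · rw [e1] at h; exact hac.ne' h.1

/-- Induction on the span `k - i`: a triple with a gap is composed of two triples of smaller span
that overlap in two indices. -/
theorem triples_of_consecutive {p : ℕ → ℕ → ℕ → Prop} {lo hi : ℕ}
    (hloc : ∀ i, lo ≤ i → i + 2 ≤ hi → p i (i + 1) (i + 2))
    (htrans : ∀ i j k l, lo ≤ i → i < j → j < k → k < l → l ≤ hi → p i j k → p j k l →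
      p i j l ∧ p i k l) :
    ∀ i j k, lo ≤ i → i < j → j < k → k ≤ hi → p i j k := by
  have key : ∀ s i j k, k ≤ i + s → lo ≤ i → i < j → j < k → k ≤ hi → p i j k := by
    intro s
    induction s with
    | zero => intro i j k; omega
    | succ s ih =>
      intro i j k hs hi' hij hjk hk
      by_cases h1 : j + 1 < k
      · exact (htrans i j (j + 1) k hi' hij (by omega) h1 hk
          (ih i j (j + 1) (by omega) hi' hij (by omega) (by omega))
          (ih j (j + 1) k (by omega) (by omega) (by omega) h1 hk)).1
      by_cases h2 : i + 1 < j
      · exact (htrans i (i + 1) j k hi' (by omega) h2 hjk hk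
          (ih i (i + 1) j (by omega) hi' (by omega) h2 (by omega))
          (ih (i + 1) j k (by omega) (by omega) h2 hjk hk)).2
      obtain rfl : j = i + 1 := by omega
      obtain rfl : k = i + 2 := by omega
      exact hloc i hi' hk
  intro i j k
  exact key k i j k (by omega)

theorem cross_pos_of_monotone {d : Pt} (hd : d ≠ 0) {y : ℕ → Pt} {lo hi : ℕ}
    (hmono : ∀ i j, lo ≤ i → i < j → j ≤ hi → det2 d (y i) ≤ det2 d (y j))
    (hloc : ∀ i, lo ≤ i → i + 2 ≤ hi → 0 < cross (y i) (y (i + 1)) (y (i + 2))) :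
    ∀ i j k, lo ≤ i → i < j → j < k → k ≤ hi → 0 < cross (y i) (y j) (y k) :=
  triples_of_consecutive hloc fun i j k l hi' hij hjk hkl hl h1 h2 =>
    cross_pos_of_chain hd (hmono i j hi' hij (by omega)) (hmono j k (by omega) hjk (by omega))
      (hmono k l (by omega) hkl hl) h1 h2

/-- The descending and the ascending half are convex chains. Together they show that all points
appear in angular order around the top point `y 0`, and with `y 0` as apex local convexity spreads
to the triples that avoid it. -/
theorem cross_pos_of_unimodal {d : Pt} (hd : d ≠ 0) {y : ℕ → Pt} {m t : ℕ} (ht0 : 0 < t)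
    (htm : t < m) (hclosed : y m = y 0)
    (hdec : ∀ i j, i < j → j ≤ t → det2 d (y j) ≤ det2 d (y i))
    (hinc : ∀ i j, t ≤ i → i < j → j ≤ m → det2 d (y i) ≤ det2 d (y j))
    (hloc : ∀ i, i + 2 ≤ m → 0 < cross (y i) (y (i + 1)) (y (i + 2)))
    (hloc0 : 0 < cross (y (m - 1)) (y 0) (y 1)) :
    ∀ i j k, i < j → j < k → k < m → 0 < cross (y i) (y j) (y k) := by
  have hneg : ∀ x : Pt, det2 (-d) x = -det2 d x := by intro x; simp [det2]; ring
  have hsub : ∀ x y : Pt, det2 (-d) (x - y) = det2 d y - det2 d x := by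
    intro x y; simp [det2]; ring
  have hupper := cross_pos_of_monotone (neg_ne_zero.2 hd) (y := y) (lo := 0) (hi := t)
    (fun i j _ hij hj => by rw [hneg, hneg]; linarith [hdec i j hij hj])
    (fun i _ hi => hloc i (by omega))
  have hlower := cross_pos_of_monotone hd (y := y) (lo := t) (hi := m)
    (fun i j hi hij hj => hinc i j hi hij hj) (fun i _ hi => hloc i (by omega))
  have hlower0 : ∀ i j, t ≤ i → i < j → j < m → 0 < cross (y 0) (y i) (y j) := by
    intro i j hi hij hj
    rw [← cross_rotate, ← hclosed]
    exact hlower i j m hi hij hj le_rfl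
  have hfan : ∀ i j, 0 < i → i < j → j < m → 0 < cross (y 0) (y i) (y j) := by
    intro i j hi hij hj
    rcases le_or_gt j t with hjt | hjt
    · exact hupper 0 i j le_rfl hi hij hjt
    rcases le_or_gt t i with hti | hti
    · exact hlower0 i j hti hij hj
    have h1 := hupper 0 i t le_rfl hi hti le_rfl
    have h2 := hlower0 t j le_rfl hjt hj
    have e : ∀ a b, cross (y 0) a b = det2 (a - y 0) (b - y 0) := by
      intro a b; simp [cross, det2]
    rw [e] at h1 h2 ⊢
    have hi0 := hdec 0 i hi (by omega)
    have ht0' := hdec 0 t ht0 le_rfl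
    have hj0 := hinc j m (by omega) hj le_rfl
    rw [hclosed] at hj0
    refine det2_trans (d := -d) (y := y t - y 0) ?_ ?_ ?_ h1 h2 ?_
    · rw [hsub]; linarith
    · rw [hsub]; linarith
    · rw [hsub]; linarith
    · rw [hsub, hsub]
      -- If `y i` and `y j` were both level with `y 0`, then by monotonicity so would be its
      -- neighbours `y 1` and `y (m - 1)`, and the turn at `y 0` would be flat.
      rintro ⟨ha, hb⟩
      have hy1 : det2 d (y 0) = det2 d (y 1) := by
        have := hdec 0 1 (by omega) (by omega)
        rcases Nat.eq_or_lt_of_le (show 1 ≤ i from hi) with h | h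
        · subst h; linarith
        · have := hdec 1 i h (by omega); linarith
      have hym : det2 d (y 0) = det2 d (y (m - 1)) := by
        have := hinc (m - 1) m (by omega) (by omega) le_rfl
        rw [hclosed] at this
        rcases Nat.eq_or_lt_of_le (show j ≤ m - 1 by omega) with h | h
        · subst h; linarith
        · have := hinc j (m - 1) (by omega) h (by omega); linarith
      exact hloc0.ne' (cross_eq_zero_of_det2_eq hd (by linarith) (by linarith))
  have hrest := triples_of_consecutive (p := fun i j k => 0 < cross (y i) (y j) (y k))
    (lo := 1) (hi := m - 1) (fun i _ hi => hloc i (by omega))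
    (fun i j k l hi hij hjk hkl hl h1 h2 => cross_pos_of_apex (o := y 0)
      (hfan i j (by omega) hij (by omega)) (hfan i k (by omega) (by omega) (by omega))
      (hfan j k (by omega) (by omega) (by omega)) (hfan j l (by omega) (by omega) (by omega))
      (hfan k l (by omega) (by omega) (by omega)) h1 h2)
  intro i j k hij hjk hk
  rcases Nat.eq_zero_or_pos i with rfl | hi
  · exact hfan j k hij hjk hk
  · exact hrest i j k hi hij hjk (by omega)

end Imprecise

namespace Imprecise

/-! ### Valleys from which no point can be deleted without loss are convex -/

section Irredundant

variable {ι K : Type*} [LinearOrder K] {ρ : ι → K} {P : ι → Pt}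

/-- Rotating `Q` so that the deleted entry comes first, `shoelace_cons` identifies the loss with the
triangle formed with the cyclic neighbours. -/
theorem cross_pos_of_delete {Q : List ι} (h3 : 3 ≤ Q.length)
    (hdel : ∀ A b B, Q = A ++ b :: B → shoelace ((A ++ B).map P) < shoelace (Q.map P))
    {j : ℕ} (hj : j < Q.length) :
    0 < cross (P (Q[(Q.length - 1 + j) % Q.length]'(Nat.mod_lt _ (by omega)))) (P Q[j])
      (P (Q[(1 + j) % Q.length]'(Nat.mod_lt _ (by omega)))) := by
  have hQ : Q = Q.take j ++ Q[j] :: Q.drop (j + 1) := by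
    rw [List.getElem_cons_drop, List.take_append_drop]
  have hlt := hdel _ _ _ hQ
  have hrot : Q.rotate j = Q[j] :: (Q.drop (j + 1) ++ Q.take j) := by
    rw [List.rotate_eq_drop_append_take hj.le, ← List.getElem_cons_drop (h := hj),
      List.cons_append]
  set R := Q.drop (j + 1) ++ Q.take j with hR
  have hlen : R.length = Q.length - 1 := by
    have := congrArg List.length hrot
    rw [List.length_rotate, List.length_cons] at this
    omega
  have hget : ∀ (i : ℕ) (hi : i < R.length),
      R[i] = Q[(i + 1 + j) % Q.length]'(Nat.mod_lt _ (by omega)) := by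
    intro i hi
    have h1 := List.getElem_rotate Q j (i + 1) (by rw [List.length_rotate]; omega)
    rw [← h1]
    simp only [hrot, List.getElem_cons_succ]
  have hshoe : shoelace (Q.map P) = shoelace (P Q[j] :: R.map P) := by
    have : P Q[j] :: R.map P = (Q[j] :: Q.drop (j + 1)).map P ++ (Q.take j).map P := by
      rw [hR, List.map_append, List.map_cons, List.cons_append]
    rw [this, shoelace_append_comm, ← List.map_append, ← hQ]
  have hdel' : shoelace ((Q.take j ++ Q.drop (j + 1)).map P) = shoelace (R.map P) := by
    rw [List.map_append, shoelace_append_comm, hR, List.map_append]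
  have hu : (R.map P).head? = some (P (Q[(1 + j) % Q.length]'(Nat.mod_lt _ (by omega)))) := by
    rw [List.head?_eq_getElem?, List.getElem?_eq_getElem (by rw [List.length_map]; omega),
      List.getElem_map, hget]
  have hl : (R.map P).getLast? =
      some (P (Q[(Q.length - 1 + j) % Q.length]'(Nat.mod_lt _ (by omega)))) := by
    rw [List.getLast?_eq_getElem?, List.getElem?_eq_getElem (by rw [List.length_map]; omega),
      List.getElem_map, hget]
    simp only [List.length_map]
    rw! [show R.length - 1 + 1 + j = Q.length - 1 + j by omega]
    rfl
  rw [hshoe, hdel', shoelace_cons hu hl] at hlt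
  linarith

theorem convexList_of_head_max {d : Pt} (hd : d ≠ 0) {w : ι} {R : List ι}
    (h2 : 2 ≤ R.length) (hR : Valley ρ R) (hmax : ∀ q ∈ R, ρ q < ρ w)
    (hmono : ∀ a ∈ w :: R, ∀ b ∈ w :: R, ρ a ≤ ρ b → det2 d (P a) ≤ det2 d (P b))
    (hdel : ∀ A b B, w :: R = A ++ b :: B →
      shoelace ((A ++ B).map P) < shoelace ((w :: R).map P)) :
    ConvexList ((w :: R).map P) := by
  have hV := hR.cons hmax
  set Q := w :: R with hQ
  have h3 : 3 ≤ Q.length := by simp [hQ]; omega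
  have hmod : ∀ i, i % Q.length < Q.length := fun i => Nat.mod_lt _ (by omega)
  -- Cyclic indexing makes index `Q.length` the head again, so the sequence descends from the
  -- largest key to index `t` and ascends back to it.
  let x : ℕ → ι := fun i => Q[i % Q.length]'(hmod i)
  have hx : ∀ (i : ℕ) (hi : i < Q.length), x i = Q[i] := fun i hi => by
    simp only [x, Nat.mod_eq_of_lt hi]
  have hxm : ∀ i, x i ∈ Q := fun i => List.getElem_mem _
  have hx0 : x 0 = w := by rw [hx 0 (by omega)]; simp [hQ]
  have hxl : x Q.length = w := by rw [← hx0]; simp [x]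
  have hlt_w : ∀ i, 0 < i → i < Q.length → ρ (x i) < ρ w := by
    intro i hi hi'
    rw [hx i hi']
    apply hmax
    obtain ⟨i, rfl⟩ : ∃ k, i = k + 1 := ⟨i - 1, by omega⟩
    simp only [hQ, List.getElem_cons_succ]
    exact List.getElem_mem _
  have hne : ∀ i j, i < j → j < Q.length → ρ (x i) ≠ ρ (x j) := by
    intro i j hij hj
    rw [hx i (by omega), hx j hj]
    exact List.pairwise_iff_getElem.1 hV.1 i j _ _ hij
  have hpeak : ∀ i j k, i < j → j < k → k < Q.length →
      ¬(ρ (x i) < ρ (x j) ∧ ρ (x k) < ρ (x j)) := by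
    intro i j k hij hjk hk
    rw [hx i (by omega), hx j (by omega), hx k hk]
    exact List.triplewise_iff_getElem.1 hV.2 i j k hij hjk hk
  obtain ⟨t, ht, htmin⟩ := Finset.exists_min_image (Finset.range Q.length) (fun i => ρ (x i))
    ⟨0, by simp; omega⟩
  simp only [Finset.mem_range] at ht htmin
  have ht0 : 0 < t := by
    by_contra h0
    obtain rfl : t = 0 := by omega
    have := hlt_w 1 (by omega) (by omega)
    have h' := htmin 1 (by omega)
    rw [hx0] at h'
    exact absurd this h'.not_gt
  have hloc : ∀ i, 0 < cross (P (x i)) (P (x (i + 1))) (P (x (i + 2))) := by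
    intro i
    have := cross_pos_of_delete h3 hdel (hmod (i + 1))
    have e1 : (Q.length - 1 + (i + 1) % Q.length) % Q.length = i % Q.length := by
      rw [Nat.add_mod_mod, show Q.length - 1 + (i + 1) = i + Q.length by omega, Nat.add_mod_right]
    have e2 : (1 + (i + 1) % Q.length) % Q.length = (i + 2) % Q.length := by
      rw [Nat.add_mod_mod, show 1 + (i + 1) = i + 2 by omega]
    simpa only [e1, e2] using this
  have hall := cross_pos_of_unimodal hd (y := fun i => P (x i)) (m := Q.length) ht0 ht
    (by simp only [hxl, hx0]) ?_ ?_ (fun i _ => hloc i) ?_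
  · rw [ConvexList, List.triplewise_map, List.triplewise_iff_getElem]
    intro i j k hij hjk hk
    have : 0 < cross (P (x i)) (P (x j)) (P (x k)) := hall i j k hij hjk hk
    rwa [hx i (by omega), hx j (by omega), hx k hk] at this
  · intro i j hij hj
    apply hmono _ (hxm j) _ (hxm i)
    by_contra hc
    push Not at hc
    rcases hj.eq_or_lt with rfl | hjt
    · exact hc.not_ge (htmin i (by omega))
    · exact hpeak i j t hij hjt ht
        ⟨hc, lt_of_le_of_ne (htmin j (by omega)) (hne j t hjt ht).symm⟩
  · intro i j hi hij hj
    apply hmono _ (hxm i) _ (hxm j)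
    rcases hj.eq_or_lt with rfl | hjl
    · rw [hxl]; exact (hlt_w i (by omega) hij).le
    by_contra hc
    push Not at hc
    rcases hi.eq_or_lt with rfl | hit
    · exact hc.not_ge (htmin j (by omega))
    · exact hpeak t i j hit hij hjl
        ⟨lt_of_le_of_ne (htmin i (by omega)) (hne t i hit (by omega)), hc⟩
  · have h := hloc (Q.length - 1)
    rw [show Q.length - 1 + 1 = Q.length by omega,
      show Q.length - 1 + 2 = Q.length + 1 by omega] at h
    have e1 : x (Q.length + 1) = x 1 := by simp [x]
    rw [hxl, e1] at h
    rwa [hx0]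

/-- The largest key is at one end. If it is the last entry, moving it to the front changes neither
the sum, nor convexity, nor the effect of deletions, so `convexList_of_head_max` applies. -/
theorem Valley.convexList {d : Pt} (hd : d ≠ 0) {Q : List ι} (h3 : 3 ≤ Q.length)
    (hQ : Valley ρ Q)
    (hmono : ∀ a ∈ Q, ∀ b ∈ Q, ρ a ≤ ρ b → det2 d (P a) ≤ det2 d (P b))
    (hdel : ∀ A b B, Q = A ++ b :: B → shoelace ((A ++ B).map P) < shoelace (Q.map P)) :
    ConvexList (Q.map P) := by
  obtain ⟨u, R, rfl⟩ : ∃ u R, Q = u :: R := List.exists_cons_of_length_pos (by omega)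
  rcases List.eq_nil_or_concat R with rfl | ⟨M, l, rfl⟩
  · simp at h3
  rw [List.concat_eq_append] at *
  have hul : ρ u ≠ ρ l := (List.pairwise_cons.1 hQ.1).1 l (by simp)
  have hle : ∀ q ∈ u :: (M ++ [l]), ρ q ≤ ρ u ∨ ρ q ≤ ρ l := fun q hq =>
    hQ.le_ends (by simp) (by rw [← List.cons_append, List.getLast?_concat]) hq
  rcases hul.lt_or_gt with h | h
  · have hne := hQ.1
    rw [← List.cons_append, List.pairwise_append] at hne
    have hlt : ∀ q ∈ u :: M, ρ q < ρ l := by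
      intro q hq
      refine lt_of_le_of_ne ?_ (hne.2.2 q hq l (by simp))
      rcases hle q (by rw [← List.cons_append]; exact List.mem_append_left _ hq) with h' | h'
      · exact h'.trans h.le
      · exact h'
    have hV : Valley ρ (u :: M) := hQ.sublist (by simp)
    have hmem : ∀ q ∈ l :: u :: M, q ∈ u :: (M ++ [l]) := by
      intro q hq
      simp only [List.mem_cons, List.mem_append, List.not_mem_nil, or_false] at hq ⊢
      tauto
    have hrot : shoelace ((u :: (M ++ [l])).map P) = shoelace ((l :: u :: M).map P) := by
      rw [← List.cons_append, List.map_append, shoelace_append_comm]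
      simp
    have hc := convexList_of_head_max hd (w := l) (R := u :: M) (by simp at h3 ⊢; omega) hV hlt
      (fun a ha b hb => hmono a (hmem a ha) b (hmem b hb)) ?_
    · have := ConvexList.append_comm (A := [P l]) (B := (u :: M).map P) (by simpa using hc)
      simpa using this
    · intro A b B hAB
      rw [← hrot]
      rcases A with _ | ⟨a, A⟩
      · rw [List.nil_append, List.cons.injEq] at hAB
        have := hdel (u :: M) l [] (by simp)
        rw [← hAB.2]
        simpa using this
      · rw [List.cons_append, List.cons.injEq] at hAB
        have := hdel A b (B ++ [l]) (by rw [← List.cons_append, hAB.2]; simp)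
        rw [← List.append_assoc, List.map_append, shoelace_append_comm] at this
        rw [← hAB.1]
        simpa using this
  · have hlt : ∀ q ∈ M ++ [l], ρ q < ρ u := by
      intro q hq
      refine lt_of_le_of_ne ?_ ((List.pairwise_cons.1 hQ.1).1 q hq).symm
      rcases hle q (List.mem_cons_of_mem _ hq) with h' | h'
      · exact h'
      · exact h'.trans h.le
    exact convexList_of_head_max hd (by simp at h3 ⊢; omega) (hQ.sublist (by simp)) hlt hmono hdel

end Irredundant

end Imprecise

namespace Imprecise

/-! ### The dynamic program -/

section Table

variable {K : Type*} [LinearOrder K] (ρ : ℕ → K) (pt : ℕ → Pt)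

/-- `v` is the value reached by extending a valley with table entry `t` by its new end `l` or `u`,
where `p` is the end that the new one is attached to. -/
def Extends (t : ℕ → ℕ → ℝ) (l u p : ℕ) (v : ℝ) : Prop :=
  (ρ u < ρ l ∧ ρ p < ρ l ∧ ρ p ≠ ρ u ∧ v = t p u + cross (pt p) (pt l) (pt u)) ∨
    (ρ l < ρ u ∧ ρ p < ρ u ∧ ρ p ≠ ρ l ∧ v = t l p + cross (pt p) (pt l) (pt u))

open Classical in
/-- One step of the maximization over the attachment end `p`. -/
noncomputable def relax (t : ℕ → ℕ → ℝ) (l u : ℕ) (acc : ℝ) (p : ℕ) : ℝ :=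
  if ρ u < ρ l ∧ ρ p < ρ l ∧ ρ p ≠ ρ u then max acc (t p u + cross (pt p) (pt l) (pt u))
  else if ρ l < ρ u ∧ ρ p < ρ u ∧ ρ p ≠ ρ l then max acc (t l p + cross (pt p) (pt l) (pt u))
  else acc

/-- The maximum over all attachment ends `p < j`. -/
noncomputable def relaxAll (t : ℕ → ℕ → ℝ) (l u j : ℕ) : ℝ :=
  (List.range j).foldl (relax ρ pt t l u) (t l u)

/-- `table ρ pt N r l u` is the largest twice signed area of a valley with at most `r + 2` entries
below `N`, first entry `u` and last entry `l`. -/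
noncomputable def table (N : ℕ) : ℕ → ℕ → ℕ → ℝ
  | 0 => fun _ _ => 0
  | r + 1 => fun l u => relaxAll ρ pt (table N r) l u N

variable {ρ pt}

theorem relaxAll_zero (t : ℕ → ℕ → ℝ) (l u : ℕ) : relaxAll ρ pt t l u 0 = t l u := rfl

theorem relaxAll_succ (t : ℕ → ℕ → ℝ) (l u j : ℕ) :
    relaxAll ρ pt t l u (j + 1) = relax ρ pt t l u (relaxAll ρ pt t l u j) j := by
  rw [relaxAll, List.range_succ, List.foldl_append]
  rfl

theorem le_relax (t : ℕ → ℕ → ℝ) (l u : ℕ) (acc : ℝ) (p : ℕ) : acc ≤ relax ρ pt t l u acc p := by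
  unfold relax
  split_ifs
  · exact le_max_left _ _
  · exact le_max_left _ _
  · exact le_rfl

theorem Extends.le_relax {t : ℕ → ℕ → ℝ} {l u p : ℕ} {v : ℝ} (h : Extends ρ pt t l u p v)
    (acc : ℝ) : v ≤ relax ρ pt t l u acc p := by
  unfold relax
  rcases h with ⟨h1, h2, h3, rfl⟩ | ⟨h1, h2, h3, rfl⟩
  · rw [if_pos ⟨h1, h2, h3⟩]; exact le_max_right _ _
  · rw [if_neg (fun h => h.1.not_gt h1), if_pos ⟨h1, h2, h3⟩]; exact le_max_right _ _

theorem relax_eq (t : ℕ → ℕ → ℝ) (l u : ℕ) (acc : ℝ) (p : ℕ) :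
    relax ρ pt t l u acc p = acc ∨ Extends ρ pt t l u p (relax ρ pt t l u acc p) := by
  unfold relax
  split_ifs with h1 h2
  · rcases max_choice acc (t p u + cross (pt p) (pt l) (pt u)) with h | h
    · exact Or.inl h
    · exact Or.inr (Or.inl ⟨h1.1, h1.2.1, h1.2.2, h⟩)
  · rcases max_choice acc (t l p + cross (pt p) (pt l) (pt u)) with h | h
    · exact Or.inl h
    · exact Or.inr (Or.inr ⟨h2.1, h2.2.1, h2.2.2, h⟩)
  · exact Or.inl rfl

theorem le_relaxAll (t : ℕ → ℕ → ℝ) (l u j : ℕ) : t l u ≤ relaxAll ρ pt t l u j := by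
  induction j with
  | zero => exact le_rfl
  | succ j ih => rw [relaxAll_succ]; exact ih.trans (le_relax ..)

theorem Extends.le_relaxAll {t : ℕ → ℕ → ℝ} {l u p : ℕ} {v : ℝ} (h : Extends ρ pt t l u p v)
    {j : ℕ} (hp : p < j) : v ≤ relaxAll ρ pt t l u j := by
  induction j with
  | zero => omega
  | succ j ih =>
    rw [relaxAll_succ]
    rcases Nat.lt_succ_iff_lt_or_eq.1 hp with hlt | rfl
    · exact (ih hlt).trans (Imprecise.le_relax ..)
    · exact h.le_relax _

theorem relaxAll_eq (t : ℕ → ℕ → ℝ) (l u j : ℕ) : relaxAll ρ pt t l u j = t l u ∨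
    ∃ p < j, Extends ρ pt t l u p (relaxAll ρ pt t l u j) := by
  induction j with
  | zero => exact Or.inl rfl
  | succ j ih =>
    rw [relaxAll_succ]
    rcases relax_eq (ρ := ρ) (pt := pt) t l u (relaxAll ρ pt t l u j) j with h | h
    · rw [h]
      exact ih.imp_right fun ⟨p, hp, h'⟩ => ⟨p, by omega, h'⟩
    · exact Or.inr ⟨j, by omega, h⟩

variable {N : ℕ}

theorem table_le_succ (r l u : ℕ) : table ρ pt N r l u ≤ table ρ pt N (r + 1) l u :=
  le_relaxAll ..

/-- The end with the larger key is removed and its neighbour `p` becomes the new end. The shorter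
valley is bounded by induction, and the removed triangle is exactly what `Extends` adds back. -/
theorem Valley.shoelace_le_table {r : ℕ} {Q : List ℕ} {u l : ℕ} (hQ : Valley ρ Q)
    (hN : ∀ q ∈ Q, q < N) (hu : Q.head? = some u) (hl : Q.getLast? = some l)
    (h2 : 2 ≤ Q.length) (hr : Q.length ≤ r + 2) :
    shoelace (Q.map pt) ≤ table ρ pt N r l u := by
  induction r generalizing Q u l with
  | zero =>
    obtain ⟨a, b, rfl⟩ := List.length_eq_two.1 (by omega : Q.length = 2)
    simp [table]
  | succ r ih =>
    rcases Nat.lt_or_ge (r + 2) Q.length with hlen | hlen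
    · have hends : ∀ q ∈ Q, ρ q ≤ ρ u ∨ ρ q ≤ ρ l := fun q hq => hQ.le_ends hu hl hq
      obtain ⟨R, rfl⟩ := List.head?_eq_some_iff.1 hu
      obtain ⟨S, hS⟩ := List.getLast?_eq_some_iff.1 hl
      have hlenR : R.length = r + 2 := by simp at hlen hr; omega
      have hlenS : S.length = r + 2 := by
        have := congrArg List.length hS
        simp at this; omega
      obtain ⟨M, rfl⟩ : ∃ M, R = M ++ [l] := by
        rcases List.eq_nil_or_concat R with rfl | ⟨M, l', rfl⟩
        · simp at hlenR
        · rw [List.concat_eq_append] at *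
          rw [← List.cons_append, List.getLast?_concat, Option.some.injEq] at hl
          exact ⟨M, by rw [hl]⟩
      have hul : ρ u ≠ ρ l := (List.pairwise_cons.1 hQ.1).1 l (by simp)
      rcases hul.lt_or_gt with h | h
      · have hQ' : Valley ρ (u :: M) := hQ.sublist (by simp)
        have hne : (u :: M) ≠ [] := by simp
        have hp : (u :: M).getLast? = some ((u :: M).getLast hne) :=
          List.getLast?_eq_some_getLast hne
        set p := (u :: M).getLast hne
        have hpm : p ∈ u :: M := List.getLast_mem hne
        have hpl : ρ p < ρ l := by
          have hne' := hQ.1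
          rw [← List.cons_append, List.pairwise_append] at hne'
          refine lt_of_le_of_ne ?_ (hne'.2.2 p hpm l (by simp))
          rcases hends p (by rw [← List.cons_append]; exact List.mem_append_left _ hpm) with h' | h'
          · exact h'.trans h.le
          · exact h'
        have hpu : ρ p ≠ ρ u := by
          rcases List.eq_nil_or_concat M with rfl | ⟨M', p', rfl⟩
          · simp at hlenR
          · rw [List.concat_eq_append] at *
            rw [← List.cons_append, List.getLast?_concat, Option.some.injEq] at hp
            rw [← hp]
            exact ((List.pairwise_cons.1 hQ'.1).1 p' (by simp)).symm
        have hih := ih (u := u) (l := p) hQ' (fun q hq => hN q (by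
          rw [← List.cons_append]; exact List.mem_append_left _ hq)) (by simp) hp
          (by simp at hlenR ⊢; omega) (by simp at hlenR ⊢; omega)
        have hs : shoelace ((u :: (M ++ [l])).map pt) =
            shoelace ((u :: M).map pt) + cross (pt p) (pt l) (pt u) := by
          rw [← List.cons_append, List.map_append]
          exact shoelace_concat (by simp) (by rw [List.getLast?_map, hp]; rfl)
        rw [hs]
        refine le_trans (add_le_add_left hih _) ?_
        exact Extends.le_relaxAll (p := p) (Or.inl ⟨h, hpl, hpu, rfl⟩)
          (hN p (by rw [← List.cons_append]; exact List.mem_append_left _ hpm))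
      · have hQ' : Valley ρ (M ++ [l]) := hQ.sublist (by simp)
        have hne : (M ++ [l]) ≠ [] := by simp
        have hp : (M ++ [l]).head? = some ((M ++ [l]).head hne) := List.head?_eq_some_head hne
        set p := (M ++ [l]).head hne
        have hpm : p ∈ M ++ [l] := List.head_mem hne
        have hpu : ρ p < ρ u := by
          refine lt_of_le_of_ne ?_ ((List.pairwise_cons.1 hQ.1).1 p hpm).symm
          rcases hends p (List.mem_cons_of_mem _ hpm) with h' | h'
          · exact h'
          · exact h'.trans h.le
        have hpl : ρ p ≠ ρ l := by
          rcases M with _ | ⟨p', M'⟩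
          · simp at hlenR
          · rw [List.cons_append, List.head?_cons, Option.some.injEq] at hp
            rw [← hp]
            exact (List.pairwise_cons.1 hQ'.1).1 l (by simp)
        have hih := ih (u := p) (l := l) hQ' (fun q hq => hN q (List.mem_cons_of_mem _ hq))
          hp (by simp) (by omega) (by omega)
        have hs : shoelace ((u :: (M ++ [l])).map pt) =
            shoelace ((M ++ [l]).map pt) + cross (pt p) (pt l) (pt u) := by
          rw [List.map_cons, shoelace_cons (u := pt p) (l := pt l)
            (by rw [List.head?_map, hp]; rfl) (by simp)]
          congr 1
          simp only [cross]; ring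
        rw [hs]
        refine le_trans (add_le_add_left hih _) ?_
        exact Extends.le_relaxAll (p := p) (Or.inr ⟨h, hpu, hpl, rfl⟩)
          (hN p (List.mem_cons_of_mem _ hpm))
    · exact (ih hQ hN hu hl h2 hlen).trans (table_le_succ ..)

/-- The best extension of an entry that improves on the previous layer also improves. -/
theorem Extends.table_lt {r l u p : ℕ} (hp : p < N)
    (h : Extends ρ pt (table ρ pt N (r + 1)) l u p (table ρ pt N (r + 2) l u))
    (hlt : table ρ pt N (r + 1) l u < table ρ pt N (r + 2) l u) :
    (ρ u < ρ l → table ρ pt N r p u < table ρ pt N (r + 1) p u) ∧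
      (ρ l < ρ u → table ρ pt N r l p < table ρ pt N (r + 1) l p) := by
  rcases h with ⟨h1, h2, h3, h4⟩ | ⟨h1, h2, h3, h4⟩
  · refine ⟨fun _ => ?_, fun h => absurd h h1.not_gt⟩
    -- The same `p` was already a candidate one layer earlier. Had its entry not improved since, the
    -- extension would not exceed the earlier value at `l u`.
    have := Extends.le_relaxAll (ρ := ρ) (pt := pt) (t := table ρ pt N r) (l := l) (u := u)
      (Or.inl ⟨h1, h2, h3, rfl⟩) hp
    change _ ≤ table ρ pt N (r + 1) l u at this
    linarith
  · refine ⟨fun h => absurd h h1.not_gt, fun _ => ?_⟩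
    have := Extends.le_relaxAll (ρ := ρ) (pt := pt) (t := table ρ pt N r) (l := l) (u := u)
      (Or.inr ⟨h1, h2, h3, rfl⟩) hp
    change _ ≤ table ρ pt N (r + 1) l u at this
    linarith

variable (ρ pt N) in
/-- Every valley realizing the table entry `r l u` becomes, between `A` and `B`, a valley of
twice signed area `V`. -/
def Completes (V : ℝ) (r l u : ℕ) (A B : List ℕ) : Prop :=
  ∀ Q : List ℕ, Valley ρ Q → (∀ q ∈ Q, q < N) → Q.head? = some u → Q.getLast? = some l →
    Q.length = r + 2 → shoelace (Q.map pt) = table ρ pt N r l u →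
    Valley ρ (A ++ Q ++ B) ∧ (∀ q ∈ A ++ Q ++ B, q < N) ∧ shoelace ((A ++ Q ++ B).map pt) = V

/-- The traceback finds the outermost entries first. Correctness is therefore stated as a
continuation: whatever valley later realizes the smaller entry, adding `l` realizes the current one.
-/
theorem Completes.snoc {V : ℝ} {r l u p : ℕ} {A B : List ℕ}
    (h : Completes ρ pt N V (r + 1) l u A B) (hl : l < N) (h1 : ρ u < ρ l) (h2 : ρ p < ρ l)
    (hv : table ρ pt N (r + 1) l u = table ρ pt N r p u + cross (pt p) (pt l) (pt u)) :
    Completes ρ pt N V r p u A (l :: B) := by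
  intro Q hQ hN hu hp hlen hs
  have := h (Q ++ [l]) (hQ.concat fun q hq => ?_) ?_ ?_ (by simp) (by simp [hlen]) ?_
  · simpa using this
  · rcases hQ.le_ends hu hp hq with h' | h'
    · exact h'.trans_lt h1
    · exact h'.trans_lt h2
  · intro q hq
    simp only [List.mem_append, List.mem_singleton] at hq
    rcases hq with hq | rfl
    · exact hN q hq
    · exact hl
  · rw [List.head?_append, hu]; rfl
  · rw [List.map_append, List.map_singleton, shoelace_concat (u := pt u) (l := pt p)
      (by rw [List.head?_map, hu]; rfl) (by rw [List.getLast?_map, hp]; rfl), hs, hv]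

theorem Completes.cons {V : ℝ} {r l u p : ℕ} {A B : List ℕ}
    (h : Completes ρ pt N V (r + 1) l u A B) (hu : u < N) (h1 : ρ l < ρ u) (h2 : ρ p < ρ u)
    (hv : table ρ pt N (r + 1) l u = table ρ pt N r l p + cross (pt p) (pt l) (pt u)) :
    Completes ρ pt N V r l p (A ++ [u]) B := by
  intro Q hQ hN hp hl hlen hs
  have := h (u :: Q) (hQ.cons fun q hq => ?_) ?_ (by simp) ?_ (by simp [hlen]) ?_
  · simpa using this
  · rcases hQ.le_ends hp hl hq with h' | h'
    · exact h'.trans_lt h2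
    · exact h'.trans_lt h1
  · intro q hq
    rcases List.mem_cons.1 hq with rfl | hq
    · exact hu
    · exact hN q hq
  · rw [List.getLast?_cons, hl]; rfl
  · rw [List.map_cons, shoelace_cons (u := pt p) (l := pt l)
      (by rw [List.head?_map, hp]; rfl) (by rw [List.getLast?_map, hl]; rfl), hs, hv]
    congr 1
    simp only [cross]; ring

end Table

end Imprecise

namespace Imprecise

/-! ### Optimal solutions from optimal valleys -/

section Optimal

variable {n : ℕ} {L : Fin n → Seg}

/-- Endpoint number `2 i` is the first and endpoint number `2 i + 1` the second one of `L i`. -/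
noncomputable def itemPt (L : Fin n → Seg) (x : ℕ) : Pt :=
  ((inputState L 0).real (2 * x), (inputState L 0).real (2 * x + 1))

/-- Endpoints are ordered by the line through their segment, ties are broken by the segment. -/
noncomputable def itemKey (L : Fin n → Seg) (d : Pt) (x : ℕ) : ℝ ×ₗ ℕ :=
  toLex (det2 d (itemPt L x), x / 2)

theorem itemPt_endpoint (L : Fin n → Seg) (i : Fin n) (e : Bool) :
    itemPt L (2 * i + e.toNat) = (L i).endpoint e := by
  cases e
  · have h1 : 2 * (2 * (i : ℕ)) / 4 = i := by omega
    have h2 : 2 * (2 * (i : ℕ)) % 4 = 0 := by omega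
    have h3 : (2 * (2 * (i : ℕ)) + 1) / 4 = i := by omega
    have h4 : (2 * (2 * (i : ℕ)) + 1) % 4 = 1 := by omega
    simp [itemPt, inputState, h1, h2, h3, h4, Seg.endpoint, Seg.coord]
  · have h1 : 2 * (2 * (i : ℕ) + 1) / 4 = i := by omega
    have h2 : 2 * (2 * (i : ℕ) + 1) % 4 = 2 := by omega
    have h3 : (2 * (2 * (i : ℕ) + 1) + 1) / 4 = i := by omega
    have h4 : (2 * (2 * (i : ℕ) + 1) + 1) % 4 = 3 := by omega
    simp [itemPt, inputState, h1, h2, h3, h4, Seg.endpoint, Seg.coord]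

theorem det2_endpoint {d : Pt} (hpar : ∀ i, det2 d (L i).a = det2 d (L i).b) (i : Fin n)
    (e : Bool) : det2 d ((L i).endpoint e) = det2 d (L i).a := by
  cases e
  · rfl
  · exact (hpar i).symm

theorem det2_mem_carrier {d : Pt} (hpar : ∀ i, det2 d (L i).a = det2 d (L i).b) {i : Fin n}
    {p : Pt} (hp : p ∈ (L i).carrier) : det2 d p = det2 d (L i).a := by
  obtain ⟨s, t, hs, ht, hst, rfl⟩ := hp
  have h : det2 d (s • (L i).a + t • (L i).b) = s * det2 d (L i).a + t * det2 d (L i).b := by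
    simp [det2]; ring
  rw [h, ← hpar i, ← add_mul, hst, one_mul]

theorem itemKey_item {d : Pt} (hpar : ∀ i, det2 d (L i).a = det2 d (L i).b) (i : Fin n)
    (e : Bool) : itemKey L d (2 * i + e.toNat) = toLex (det2 d (L i).a, (i : ℕ)) := by
  have : (2 * (i : ℕ) + e.toNat) / 2 = i := by cases e <;> simp; omega
  rw [itemKey, itemPt_endpoint, det2_endpoint hpar, this]

/-- Equality of keys means belonging to the same segment. -/
theorem itemKey_eq_iff {d : Pt} (hpar : ∀ i, det2 d (L i).a = det2 d (L i).b) {x y : ℕ}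
    (hx : x < 2 * n) : itemKey L d x = itemKey L d y ↔ x / 2 = y / 2 := by
  constructor
  · intro h
    exact congrArg Prod.snd (toLex.injective h)
  · intro h
    have key : ∀ z, z / 2 = x / 2 → itemKey L d z =
        toLex (det2 d (L ⟨x / 2, by omega⟩).a, x / 2) := by
      intro z hz
      have hz' : z = 2 * ((⟨x / 2, by omega⟩ : Fin n) : ℕ) + (decide (z % 2 = 1)).toNat := by
        rcases Nat.mod_two_eq_zero_or_one z with h | h <;> simp [h] <;> omega
      rw [hz', itemKey_item hpar]
    rw [key x rfl, key y h.symm]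

theorem det2_le_of_itemKey_le {d : Pt} {x y : ℕ} (h : itemKey L d x ≤ itemKey L d y) :
    det2 d (itemPt L x) ≤ det2 d (itemPt L y) := by
  rw [itemKey, itemKey, Prod.Lex.toLex_le_toLex] at h
  rcases h with h | h
  · exact h.le
  · exact h.1.le

/-- Every polygon on any placement is at most as large as some valley of endpoints. -/
theorem exists_valley_of_polygon {d : Pt} (hd : d ≠ 0)
    (hpar : ∀ i, det2 d (L i).a = det2 d (L i).b) {P : Fin n → Pt} (hP : IsPlacement L P)
    {m : ℕ} {σ : Fin m → Fin n} (hσ : IsConvexPolygon (P ∘ σ)) :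
    ∃ Q : List ℕ, Valley (itemKey L d) Q ∧ (∀ q ∈ Q, q < 2 * n) ∧ Q.length = m ∧
      area (P ∘ σ) ≤ shoelace (Q.map (itemPt L)) / 2 := by
  have hinj : Function.Injective σ := hσ.2.1.of_comp
  have hmap : List.ofFn (P ∘ σ) = (List.ofFn σ).map P := by rw [List.map_ofFn]
  have hnodup : (List.ofFn σ).Nodup := List.nodup_ofFn.2 hinj
  have hconv := hσ.convexList
  rw [hmap] at hconv
  let ρ : Fin n → ℝ ×ₗ ℕ := fun i => toLex (det2 d (L i).a, (i : ℕ))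
  have hρ : Function.Injective ρ := fun i j h => Fin.ext (congrArg Prod.snd (toLex.injective h))
  obtain ⟨A, B, hAB, hV⟩ := hconv.exists_rotation_valley (ρ := ρ) hd
    (hnodup.imp fun {a b} hab h => hab (hρ h)) (by
      intro a _ b _ hab
      rw [det2_mem_carrier hpar (hP a), det2_mem_carrier hpar (hP b)]
      simp only [ρ, Prod.Lex.toLex_le_toLex] at hab
      rcases hab with h | h
      · exact h.le
      · exact h.1.le)
  have hnodup' : (B ++ A).Nodup := by
    rw [hAB] at hnodup
    exact List.perm_append_comm.nodup_iff.1 hnodup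
  -- The points are moved only after the order is fixed. Keys depend on the segments alone, so the
  -- list of chosen endpoints remains a valley.
  obtain ⟨e, he⟩ := exists_endpointPlacement_shoelace_le L hP hnodup'
  refine ⟨(B ++ A).map fun i : Fin n => 2 * (i : ℕ) + (e i).toNat, ?_, ?_, ?_, ?_⟩
  · rw [valley_map]
    have : itemKey L d ∘ (fun i : Fin n => 2 * (i : ℕ) + (e i).toNat) = ρ := by
      funext i
      exact itemKey_item hpar i (e i)
    rwa [this]
  · intro q hq
    obtain ⟨i, -, rfl⟩ := List.mem_map.1 hq
    have := i.2
    have := Bool.toNat_le (e i)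
    omega
  · have := congrArg List.length hAB
    rw [List.length_ofFn, List.length_append] at this
    rw [List.length_map, List.length_append]
    omega
  · rw [area_eq_shoelace hσ, hmap, hAB, List.map_append, shoelace_append_comm, ← List.map_append,
      List.map_map]
    have : itemPt L ∘ (fun i : Fin n => 2 * (i : ℕ) + (e i).toNat) = endpointPlacement L e := by
      funext i
      exact itemPt_endpoint L i (e i)
    rw [this]
    linarith

theorem isOptimalSolution_of_bound {d : Pt} (hd : d ≠ 0)
    (hpar : ∀ i, det2 d (L i).a = det2 d (L i).b) {k m : ℕ} {e : Fin n → Bool}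
    {σ : Fin m → Fin n} (hmk : m ≤ k) (hσ : IsConvexPolygon (endpointPlacement L e ∘ σ))
    (hbound : ∀ Q : List ℕ, Valley (itemKey L d) Q → (∀ q ∈ Q, q < 2 * n) → Q.length ≤ k →
      shoelace (Q.map (itemPt L)) / 2 ≤ area (endpointPlacement L e ∘ σ)) :
    IsOptimalSolution L k (endpointPlacement L e) σ := by
  have hbest : ∀ P : Fin n → Pt, IsPlacement L P → ∀ A ∈ polygonAreas k P,
      A ≤ area (endpointPlacement L e ∘ σ) := by
    rintro P hP A ⟨m', hm', σ', hσ', rfl⟩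
    obtain ⟨Q, h1, h2, h3, h4⟩ := exists_valley_of_polygon hd hpar hP hσ'
    exact h4.trans (hbound Q h1 h2 (h3.trans_le hm'))
  have hpl : IsPlacement L (endpointPlacement L e) := by
    intro i
    simp only [endpointPlacement]
    cases e i
    · exact left_mem_segment ℝ _ _
    · exact right_mem_segment ℝ _ _
  exact ⟨hpl, hmk, hσ, ⟨⟨m, hmk, σ, hσ, rfl⟩, fun A hA => hbest _ hpl A hA⟩,
    fun P hP A hA => hbest P hP A hA.1⟩

/-- The hypothesis `hmin` applies to every sublist obtained by one deletion, which makes `Q` convex;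
its sum is then a genuine area and `hmax` bounds all competitors. -/
theorem isOptimalSolution_of_valley {d : Pt} (hd : d ≠ 0)
    (hpar : ∀ i, det2 d (L i).a = det2 d (L i).b) {k : ℕ} {Q : List ℕ}
    (hQ : Valley (itemKey L d) Q) (hN : ∀ q ∈ Q, q < 2 * n) (h3 : 3 ≤ Q.length)
    (hk : Q.length ≤ k)
    (hmax : ∀ Q' : List ℕ, Valley (itemKey L d) Q' → (∀ q ∈ Q', q < 2 * n) → Q'.length ≤ k →
      shoelace (Q'.map (itemPt L)) ≤ shoelace (Q.map (itemPt L)))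
    (hmin : ∀ Q' : List ℕ, Valley (itemKey L d) Q' → (∀ q ∈ Q', q < 2 * n) →
      Q'.length < Q.length → shoelace (Q'.map (itemPt L)) < shoelace (Q.map (itemPt L)))
    {e : Fin n → Bool} {σ : Fin Q.length → Fin n}
    (hσ : ∀ j : Fin Q.length, Q[j] = 2 * (σ j : ℕ) + (e (σ j)).toNat) :
    IsOptimalSolution L k (endpointPlacement L e) σ ∧
      area (endpointPlacement L e ∘ σ) = shoelace (Q.map (itemPt L)) / 2 := by
  have hmap : List.ofFn (endpointPlacement L e ∘ σ) = Q.map (itemPt L) := by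
    apply List.ext_getElem
    · simp
    · intro i h1 h2
      rw [List.length_map] at h2
      have := hσ ⟨i, h2⟩
      simp only [Fin.getElem_fin] at this
      simp only [List.getElem_ofFn, List.getElem_map, Function.comp_apply]
      rw [this, itemPt_endpoint]
      rfl
  have hconv : ConvexList (Q.map (itemPt L)) := hQ.convexList hd h3
    (fun a _ b _ hab => det2_le_of_itemKey_le hab) (by
      rintro A b B rfl
      have hs : (A ++ B).Sublist (A ++ b :: B) :=
        List.Sublist.append_left (List.sublist_cons_self b B) A
      exact hmin _ (hQ.sublist hs) (fun q hq => hN q (hs.subset hq)) (by simp))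
  have hpoly : IsConvexPolygon (endpointPlacement L e ∘ σ) := by
    apply ConvexList.isConvexPolygon h3
    rwa [hmap]
  have harea : area (endpointPlacement L e ∘ σ) = shoelace (Q.map (itemPt L)) / 2 := by
    rw [area_eq_shoelace hpoly, hmap]
  refine ⟨isOptimalSolution_of_bound hd hpar hk hpoly fun Q' h1 h2 h3 => ?_, harea⟩
  rw [harea]
  linarith [hmax Q' h1 h2 h3]

theorem isOptimalSolution_of_nonpos {d : Pt} (hd : d ≠ 0)
    (hpar : ∀ i, det2 d (L i).a = det2 d (L i).b) {k : ℕ} (hk : 1 ≤ k)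
    (hmax : ∀ Q' : List ℕ, Valley (itemKey L d) Q' → (∀ q ∈ Q', q < 2 * n) → Q'.length ≤ k →
      shoelace (Q'.map (itemPt L)) ≤ 0) (e : Fin n → Bool) (σ : Fin 1 → Fin n) :
    IsOptimalSolution L k (endpointPlacement L e) σ ∧ area (endpointPlacement L e ∘ σ) = 0 := by
  have hpoly : IsConvexPolygon (endpointPlacement L e ∘ σ) :=
    ⟨one_pos, Function.injective_of_subsingleton _, fun i j _ hij => by omega⟩
  have harea : area (endpointPlacement L e ∘ σ) = 0 := by
    rw [area_eq_shoelace hpoly]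
    simp
  refine ⟨isOptimalSolution_of_bound hd hpar hk hpoly fun Q' h1 h2 h3 => ?_, harea⟩
  rw [harea]
  linarith [hmax Q' h1 h2 h3]

end Optimal

end Imprecise

namespace RealRAM

/-! ### Total correctness with time bounds -/

/-- Started in `s`, the program `p` halts after at most `T` steps in a state satisfying `Q`. -/
def Exec (p : Prog) (s : State) (T : ℕ) (Q : State → Prop) : Prop :=
  ∃ s' t, Runs p s s' t ∧ t ≤ T ∧ Q s'

theorem Exec.mono {p : Prog} {s : State} {T T' : ℕ} {Q Q' : State → Prop} (h : Exec p s T Q)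
    (hT : T ≤ T') (hQ : ∀ s', Q s' → Q' s') : Exec p s T' Q' := by
  obtain ⟨s', t, h1, h2, h3⟩ := h
  exact ⟨s', t, h1, h2.trans hT, hQ _ h3⟩

theorem Exec.seq {p q : Prog} {s : State} {T T' : ℕ} {Q Q' : State → Prop} (h : Exec p s T Q)
    (h' : ∀ s', Q s' → Exec q s' T' Q') : Exec (.seq p q) s (T + T') Q' := by
  obtain ⟨s', t, h1, h2, h3⟩ := h
  obtain ⟨s'', t', h4, h5, h6⟩ := h' s' h3
  exact ⟨s'', t + t', .seq h1 h4, add_le_add h2 h5, h6⟩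

theorem Exec.branch {c : Cond} {p q : Prog} {s : State} {T T' : ℕ} {Q : State → Prop}
    (h : c.holds s → Exec p s T Q) (h' : ¬c.holds s → Exec q s T' Q) :
    Exec (.branch c p q) s (c.cost + 1 + (T + T')) Q := by
  by_cases hc : c.holds s
  · obtain ⟨s', t, h1, h2, h3⟩ := h hc
    exact ⟨s', _, .branchTrue q hc h1, by omega, h3⟩
  · obtain ⟨s', t, h1, h2, h3⟩ := h' hc
    exact ⟨s', _, .branchFalse p hc h1, by omega, h3⟩

/-- A loop with invariant `I` that makes `M` iterations. -/
theorem Exec.loop {c : Cond} {p : Prog} {T M : ℕ} (I : ℕ → State → Prop)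
    (hstep : ∀ i, i < M → ∀ s, I i s → c.holds s ∧ Exec p s T (I (i + 1)))
    (hend : ∀ s, I M s → ¬c.holds s) {s : State} (h0 : I 0 s) :
    Exec (.loop c p) s (M * (c.cost + 1 + T) + (c.cost + 1)) (I M) := by
  have key : ∀ j i, i + j = M → ∀ s, I i s →
      Exec (.loop c p) s (j * (c.cost + 1 + T) + (c.cost + 1)) (I M) := by
    intro j
    induction j with
    | zero =>
      intro i hi s hs
      obtain rfl : i = M := by omega
      exact ⟨s, _, .loopFalse p (hend s hs), by omega, hs⟩
    | succ j ih =>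
      intro i hi s hs
      obtain ⟨hc, s', t, h1, h2, h3⟩ := hstep i (by omega) s hs
      obtain ⟨s'', t', h4, h5, h6⟩ := ih (i + 1) (by omega) s' h3
      refine ⟨s'', _, .loopTrue hc h1 h4, ?_, h6⟩
      rw [Nat.succ_mul]
      omega
  exact key M 0 (by omega) s h0

/-- Programs without loops. -/
def Prog.LoopFree : Prog → Prop
  | .skip => True
  | .setNat _ _ => True
  | .setReal _ _ => True
  | .seq p q => p.LoopFree ∧ q.LoopFree
  | .branch _ p q => p.LoopFree ∧ q.LoopFree
  | .loop _ _ => False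

open Classical in
/-- The result of a program without loops. -/
noncomputable def Prog.run : Prog → State → State
  | .skip, s => s
  | .setNat a x, s => { s with nat := Function.update s.nat (a.eval s) (x.eval s) }
  | .setReal a x, s => { s with real := Function.update s.real (a.eval s) (x.eval s) }
  | .seq p q, s => q.run (p.run s)
  | .branch c p q, s => if c.holds s then p.run s else q.run s
  | .loop _ _, s => s

theorem Prog.run_seq (p q : Prog) (s : State) : (Prog.seq p q).run s = q.run (p.run s) := rfl

open Classical in
theorem Prog.run_branch (c : Cond) (p q : Prog) (s : State) :
    (Prog.branch c p q).run s = if c.holds s then p.run s else q.run s := rfl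

/-- A bound for the running time of a program without loops. -/
def Prog.time : Prog → ℕ
  | .skip => 1
  | .setNat a x => a.cost + x.cost + 1
  | .setReal a x => a.cost + x.cost + 1
  | .seq p q => p.time + q.time
  | .branch c p q => c.cost + 1 + (p.time + q.time)
  | .loop _ _ => 0

theorem Exec.of_loopFree {p : Prog} (hp : p.LoopFree) {s : State} {Q : State → Prop}
    (hQ : Q (p.run s)) : Exec p s p.time Q := by
  induction p generalizing s Q with
  | skip => exact ⟨s, 1, .skip s, le_rfl, hQ⟩
  | setNat a x => exact ⟨_, _, .setNat a x s, le_rfl, hQ⟩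
  | setReal a x => exact ⟨_, _, .setReal a x s, le_rfl, hQ⟩
  | seq p q ihp ihq =>
    exact Exec.seq (ihp hp.1 (Q := fun s' => s' = p.run s) rfl)
      fun s' hs' => by subst hs'; exact ihq hp.2 hQ
  | branch c p q ihp ihq =>
    refine Exec.branch (fun hc => ihp hp.1 ?_) fun hc => ihq hp.2 ?_
    · rwa [Prog.run, if_pos hc] at hQ
    · rwa [Prog.run, if_neg hc] at hQ
  | loop c p _ => exact hp.elim

end RealRAM

namespace Imprecise

open RealRAM

/-! ### The program -/

/-- The contents of natural cell `i`. -/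
abbrev cell (i : ℕ) : NatExpr := .load (.const i)

/-- Increment of natural cell `i`. -/
abbrev incr (i : ℕ) : Prog := .setNat (.const i) (.add (cell i) (.const 1))

/-- The segment of an item. -/
abbrev segE (x : NatExpr) : NatExpr := .load (.add (cell 4) x)

/-- The first coordinate of an item. -/
abbrev xE (x : NatExpr) : RealExpr := .load (.add x x)

/-- The second coordinate of an item. -/
abbrev yE (x : NatExpr) : RealExpr := .load (.add (.add x x) (.const 1))

/-- The position of an item in the direction across the segments. -/
abbrev posE (x : NatExpr) : RealExpr :=
  .sub (.mul (.load (cell 5)) (yE x)) (.mul (.load (.add (cell 5) (.const 1))) (xE x))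

/-- The key of `x` is smaller than the key of `y`. -/
def keyLt (x y : NatExpr) : Cond :=
  .conj (.realLe (posE x) (posE y))
    (.neg (.conj (.realLe (posE y) (posE x)) (.natLe (segE y) (segE x))))

/-- The keys of `x` and `y` differ. -/
def keyNe (x y : NatExpr) : Cond := .neg (.natEq (segE x) (segE y))

/-- Twice the signed area of the triangle of three items. -/
def crossE (p q r : NatExpr) : RealExpr :=
  .sub (.mul (.sub (xE q) (xE p)) (.sub (yE r) (yE p)))
    (.mul (.sub (yE q) (yE p)) (.sub (xE r) (xE p)))

/-- The last entry `l` can be attached to `p`. -/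
def lastC : Cond :=
  .conj (keyLt (cell 11) (cell 10))
    (.conj (keyLt (cell 12) (cell 10)) (keyNe (cell 12) (cell 11)))

/-- The first entry `u` can be attached to `p`. -/
def firstC : Cond :=
  .conj (keyLt (cell 10) (cell 11))
    (.conj (keyLt (cell 12) (cell 11)) (keyNe (cell 12) (cell 10)))

/-- The value of the extension from the table entry at the address in cell `q`. -/
def valueE (q : ℕ) : RealExpr :=
  .add (.load (cell q)) (crossE (cell 12) (cell 10) (cell 11))

/-- Advance to the next `p`. -/
def nextP : Prog :=
  .seq (incr 12) (.seq (.setNat (.const 13) (.add (cell 13) (cell 2))) (incr 14))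

/-- Initialize the loop over `p`. -/
def firstP : Prog :=
  .seq (.setNat (.const 12) (.const 0))
    (.seq (.setNat (.const 13) (.add (cell 8) (cell 11)))
      (.setNat (.const 14) (.sub (.sub (cell 7) (cell 3)) (cell 11))))

/-- `x < y` for natural cells. -/
def cellLt (x y : ℕ) : Cond := .neg (.natLe (cell y) (cell x))

/-- Cells 2 and 3 hold `N = 2n` and `N * N`; 4 and 5 the addresses of the item-to-segment lookup and
of the direction, which the table follows in real memory; 7 the address of the current entry, 8 the
start of the previous layer, 9 the layer; 10, 11, 12 the items `l`, `u`, `p`. Cells 13 and 14 point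
to the previous-layer entries `p u` and `l p`, so they advance by `N` and by 1. Cells 15 to 18 and
20 describe the best entry, 19 points to the output buffer, 21 and 22 hold the result of a search,
23 and 24 the write positions of the traceback. -/
def relaxBody : Prog :=
  .seq
    (.branch lastC
      (.branch (.realLe (valueE 13) (.load (cell 7))) .skip (.setReal (cell 7) (valueE 13)))
      (.branch firstC
        (.branch (.realLe (valueE 14) (.load (cell 7))) .skip (.setReal (cell 7) (valueE 14)))
        .skip))
    nextP

def relaxLoop : Prog := .loop (cellLt 12 2) relaxBody

def entryInit : Prog :=
  .seq (.setReal (cell 7) (.load (.sub (cell 7) (cell 3)))) firstP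

/-- The record is replaced only on strict improvement, so ties favour the earlier layer, that is,
fewer vertices. -/
def entryEnd : Prog :=
  .seq
    (.branch (.realLe (.load (cell 7)) (.load (cell 15))) .skip
      (.seq (.setNat (.const 15) (cell 7)) (.seq (.setNat (.const 16) (cell 9))
        (.seq (.setNat (.const 17) (cell 10)) (.seq (.setNat (.const 18) (cell 11))
          (.setNat (.const 20) (cell 8)))))))
    (.seq (incr 11) (incr 7))

/-- Compute one table entry. -/
def entryProg : Prog := .seq entryInit (.seq relaxLoop entryEnd)

def rowProg : Prog :=
  .seq (.setNat (.const 11) (.const 0)) (.seq (.loop (cellLt 11 2) entryProg) (incr 10))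

def layerEnd : Prog := .seq (.setNat (.const 8) (.add (cell 8) (cell 3))) (incr 9)

def layerProg : Prog :=
  .seq (.setNat (.const 10) (.const 0)) (.seq (.loop (cellLt 10 2) rowProg) layerEnd)

def tableInit : Prog :=
  .seq (.setNat (.const 8) (.add (cell 5) (.const 2)))
    (.seq (.setNat (.const 7) (.add (cell 8) (cell 3))) (.seq (.setNat (.const 9) (.const 1))
      (.setNat (.const 15) (cell 8))))

def tableProg : Prog :=
  .seq tableInit (.loop (.natLe (.add (cell 9) (.const 2)) (cell 1)) layerProg)

def setup : Prog :=
  .seq (.setNat (.const 2) (.add (cell 0) (cell 0)))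
    (.seq (.setNat (.const 5) (.add (cell 2) (cell 2)))
      (.seq (.setNat (.const 19) (.add (.const 32) (cell 2)))
        (.seq (.setNat (.const 4) (.add (.const 33) (cell 5)))
          (.setReal (.add (cell 5) (.const 1)) (.const 1)))))

/-- Coordinate number `j` of the segment in cell `6`. -/
abbrev coordE (j : ℕ) : RealExpr :=
  .load (.add (.add (.add (cell 6) (cell 6)) (.add (cell 6) (cell 6))) (.const j))

def degenerateC : Cond :=
  .conj (.conj (.realLe (coordE 0) (coordE 2)) (.realLe (coordE 2) (coordE 0)))
    (.conj (.realLe (coordE 1) (coordE 3)) (.realLe (coordE 3) (coordE 1)))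

/-- Natural numbers can only be added and subtracted, so `(2n)^2` is accumulated as `n` summands
`4n`, and halving an item number is replaced by a lookup table. A nondegenerate segment overwrites
the stored direction. -/
def segBody : Prog :=
  .seq (.setNat (.const 3) (.add (.add (cell 3) (cell 2)) (cell 2)))
    (.seq (.setNat (.add (cell 4) (.add (cell 6) (cell 6))) (cell 6))
      (.seq (.setNat (.add (cell 4) (.add (.add (cell 6) (cell 6)) (.const 1))) (cell 6))
        (.seq
          (.branch degenerateC .skip
            (.seq (.setReal (cell 5) (.sub (coordE 2) (coordE 0)))
              (.setReal (.add (cell 5) (.const 1)) (.sub (coordE 3) (coordE 1)))))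
          (incr 6))))

def segProg : Prog := .seq setup (.loop (cellLt 6 0) segBody)

/-- No back pointers are stored: an optimal `p` is found again by comparing each extension with the
known maximum. -/
def searchBody : Prog :=
  .seq
    (.branch (.conj lastC (.realLe (.load (cell 7)) (valueE 13)))
      (.seq (.setNat (.const 21) (cell 12)) (.setNat (.const 22) (cell 13)))
      (.branch (.conj firstC (.realLe (.load (cell 7)) (valueE 14)))
        (.seq (.setNat (.const 21) (cell 12)) (.setNat (.const 22) (cell 14)))
        .skip))
    nextP

def searchLoop : Prog := .loop (cellLt 12 2) searchBody

/-- Write the item in cell `x` to the address in cell `i` of the output buffer. -/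
def emit (i x : ℕ) : Prog :=
  .seq (.setNat (cell i) (segE (cell x)))
    (.setNat (.add (.add (cell 19) (.const 1)) (segE (cell x)))
      (.sub (.sub (cell x) (segE (cell x))) (segE (cell x))))

/-- The end with the larger key was attached last. It is written to the back of the buffer if it is
`l` and to the front if it is `u`, which preserves the counterclockwise order. -/
def traceStep : Prog :=
  .seq
    (.branch (keyLt (cell 11) (cell 10))
      (.seq (emit 24 10) (.seq (.setNat (.const 24) (.sub (cell 24) (.const 1)))
        (.setNat (.const 10) (cell 21))))
      (.seq (emit 23 11) (.seq (incr 23) (.setNat (.const 11) (cell 21)))))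
    (.seq (.setNat (.const 7) (cell 22)) (.seq (.setNat (.const 8) (.sub (cell 8) (cell 3)))
      (.setNat (.const 9) (.sub (cell 9) (.const 1)))))

def traceBody : Prog := .seq firstP (.seq searchLoop traceStep)

def traceInit : Prog :=
  .seq (.setNat (cell 19) (.add (cell 16) (.const 2)))
    (.seq (.setNat (.const 9) (cell 16)) (.seq (.setNat (.const 10) (cell 17))
      (.seq (.setNat (.const 11) (cell 18)) (.seq (.setNat (.const 7) (cell 15))
        (.seq (.setNat (.const 8) (cell 20))
          (.seq (.setNat (.const 23) (.add (.add (cell 19) (.const 1)) (cell 0)))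
            (.setNat (.const 24) (.add (.add (cell 23) (cell 16)) (.const 1)))))))))

def traceEnd : Prog :=
  .seq (emit 23 11) (.seq (emit 24 10)
    (.setReal (.const 0) (.mul (.load (cell 15)) (.const (1 / 2)))))

def traceProg : Prog :=
  .seq traceInit (.seq (.loop (.neg (.natLe (cell 9) (.const 0))) traceBody) traceEnd)

def pointProg : Prog := .seq (.setNat (cell 19) (.const 1)) (.setReal (.const 0) (.const 0))

def resultProg : Prog := .branch (.natEq (cell 16) (.const 0)) pointProg traceProg

def copyInit : Prog := .seq (.setNat (.const 0) (cell 19)) (.setNat (.const 1) (cell 2))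

/-- The output area overlaps the working cells, hence the buffer. Copying runs downwards and uses
only cells 0 and 1, which receive their own values last. -/
def copyBody : Prog :=
  .seq (.setNat (cell 1) (.load (.add (cell 0) (cell 1))))
    (.setNat (.const 1) (.sub (cell 1) (.const 1)))

def copyEnd : Prog :=
  .seq (.setNat (.const 1) (.load (.add (cell 0) (.const 1)))) (.setNat (.const 0) (.load (cell 0)))

/-- Move the output from the buffer to its place. -/
def copyProg : Prog :=
  .seq copyInit (.seq (.loop (.neg (.natLe (cell 1) (.const 1))) copyBody) copyEnd)

/-- The algorithm. -/
def maxMaxArea : Prog := .seq segProg (.seq tableProg (.seq resultProg copyProg))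

end Imprecise

namespace Imprecise

open RealRAM

/-! ### Verification of the table computation -/

/-- The cells that do not change once the input has been preprocessed. -/
structure Common {n : ℕ} (k : ℕ) (L : Fin n → Seg) (d : Pt) (s : State) : Prop where
  n0 : s.nat 0 = n
  n1 : s.nat 1 = k
  n2 : s.nat 2 = 2 * n
  n3 : s.nat 3 = 2 * n * (2 * n)
  n4 : s.nat 4 = 33 + 4 * n
  n5 : s.nat 5 = 4 * n
  n19 : s.nat 19 = 32 + 2 * n
  seg : ∀ x, x < 2 * n → s.nat (33 + 4 * n + x) = x / 2
  input : ∀ c, c < 4 * n → s.real c = (inputState L k).real c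
  d1 : s.real (4 * n) = d.1
  d2 : s.real (4 * n + 1) = d.2

section

variable {n k : ℕ} {L : Fin n → Seg} {d : Pt} {s s' : State}

theorem Common.frame (h : Common k L d s)
    (hn : ∀ c, c < 6 ∨ c = 19 ∨ 33 + 4 * n ≤ c → s'.nat c = s.nat c)
    (hr : ∀ c, c < 4 * n + 2 → s'.real c = s.real c) : Common k L d s' where
  n0 := by rw [hn 0 (by omega), h.n0]
  n1 := by rw [hn 1 (by omega), h.n1]
  n2 := by rw [hn 2 (by omega), h.n2]
  n3 := by rw [hn 3 (by omega), h.n3]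
  n4 := by rw [hn 4 (by omega), h.n4]
  n5 := by rw [hn 5 (by omega), h.n5]
  n19 := by rw [hn 19 (by omega), h.n19]
  seg x hx := by rw [hn _ (by omega), h.seg x hx]
  input c hc := by rw [hr _ (by omega), h.input c hc]
  d1 := by rw [hr _ (by omega), h.d1]
  d2 := by rw [hr _ (by omega), h.d2]

theorem Common.eval_seg (h : Common k L d s) {x : NatExpr} (hx : x.eval s < 2 * n) :
    (segE x).eval s = x.eval s / 2 := by
  simp only [NatExpr.eval, h.n4]
  exact h.seg _ hx

theorem Common.eval_x (h : Common k L d s) {x : NatExpr} (hx : x.eval s < 2 * n) :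
    (xE x).eval s = (itemPt L (x.eval s)).1 := by
  simp only [RealExpr.eval, NatExpr.eval]
  rw [h.input _ (by omega), ← two_mul]
  rfl

theorem Common.eval_y (h : Common k L d s) {x : NatExpr} (hx : x.eval s < 2 * n) :
    (yE x).eval s = (itemPt L (x.eval s)).2 := by
  simp only [RealExpr.eval, NatExpr.eval]
  rw [h.input _ (by omega), ← two_mul]
  rfl

theorem Common.eval_pos (h : Common k L d s) {x : NatExpr} (hx : x.eval s < 2 * n) :
    (posE x).eval s = det2 d (itemPt L (x.eval s)) := by
  have h1 : (posE x).eval s = s.real (s.nat 5) * (yE x).eval s -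
    s.real (s.nat 5 + 1) * (xE x).eval s := rfl
  rw [h1, h.eval_x hx, h.eval_y hx, h.n5, h.d1, h.d2]
  rfl

theorem Common.eval_cross (h : Common k L d s) {p q r : NatExpr} (hp : p.eval s < 2 * n)
    (hq : q.eval s < 2 * n) (hr : r.eval s < 2 * n) : (crossE p q r).eval s =
      cross (itemPt L (p.eval s)) (itemPt L (q.eval s)) (itemPt L (r.eval s)) := by
  have h1 : (crossE p q r).eval s = ((xE q).eval s - (xE p).eval s) *
    ((yE r).eval s - (yE p).eval s) - ((yE q).eval s - (yE p).eval s) *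
    ((xE r).eval s - (xE p).eval s) := rfl
  rw [h1, h.eval_x hp, h.eval_y hp, h.eval_x hq, h.eval_y hq, h.eval_x hr, h.eval_y hr]
  rfl

theorem Common.holds_keyLt (h : Common k L d s) {x y : NatExpr} (hx : x.eval s < 2 * n)
    (hy : y.eval s < 2 * n) : (keyLt x y).holds s ↔
      itemKey L d (x.eval s) < itemKey L d (y.eval s) := by
  have h1 : (keyLt x y).holds s ↔ ((posE x).eval s ≤ (posE y).eval s ∧
    ¬((posE y).eval s ≤ (posE x).eval s ∧ (segE y).eval s ≤ (segE x).eval s)) := Iff.rfl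
  rw [h1, h.eval_pos hx, h.eval_pos hy, h.eval_seg hx, h.eval_seg hy, itemKey, itemKey,
    Prod.Lex.toLex_lt_toLex]
  simp only [not_and, not_le]
  constructor
  · rintro ⟨h1, h2⟩
    rcases h1.lt_or_eq with h3 | h3
    · exact Or.inl h3
    · exact Or.inr ⟨h3, h2 h3.ge⟩
  · rintro (h1 | ⟨h1, h2⟩)
    · exact ⟨h1.le, fun h3 => absurd h1 h3.not_gt⟩
    · exact ⟨h1.le, fun _ => h2⟩

theorem Common.holds_keyNe (h : Common k L d s)
    (hpar : ∀ i, det2 d (L i).a = det2 d (L i).b) {x y : NatExpr} (hx : x.eval s < 2 * n)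
    (hy : y.eval s < 2 * n) : (keyNe x y).holds s ↔
      itemKey L d (x.eval s) ≠ itemKey L d (y.eval s) := by
  have h1 : (keyNe x y).holds s ↔ ¬((segE x).eval s = (segE y).eval s) := Iff.rfl
  rw [h1, h.eval_seg hx, h.eval_seg hy, Ne, itemKey_eq_iff hpar hx]

theorem Common.holds_lastC (h : Common k L d s)
    (hpar : ∀ i, det2 d (L i).a = det2 d (L i).b) {l u p : ℕ} (h10 : s.nat 10 = l)
    (h11 : s.nat 11 = u) (h12 : s.nat 12 = p) (hl : l < 2 * n) (hu : u < 2 * n)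
    (hp : p < 2 * n) : lastC.holds s ↔ itemKey L d u < itemKey L d l ∧
      itemKey L d p < itemKey L d l ∧ itemKey L d p ≠ itemKey L d u := by
  subst h10 h11 h12
  exact and_congr (h.holds_keyLt hu hl) (and_congr (h.holds_keyLt hp hl)
    (h.holds_keyNe hpar hp hu))

theorem Common.holds_firstC (h : Common k L d s)
    (hpar : ∀ i, det2 d (L i).a = det2 d (L i).b) {l u p : ℕ} (h10 : s.nat 10 = l)
    (h11 : s.nat 11 = u) (h12 : s.nat 12 = p) (hl : l < 2 * n) (hu : u < 2 * n)
    (hp : p < 2 * n) : firstC.holds s ↔ itemKey L d l < itemKey L d u ∧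
      itemKey L d p < itemKey L d u ∧ itemKey L d p ≠ itemKey L d l := by
  subst h10 h11 h12
  exact and_congr (h.holds_keyLt hl hu) (and_congr (h.holds_keyLt hp hu)
    (h.holds_keyNe hpar hp hl))

theorem Common.eval_value (h : Common k L d s) {l u p : ℕ} (h10 : s.nat 10 = l)
    (h11 : s.nat 11 = u) (h12 : s.nat 12 = p) (hl : l < 2 * n) (hu : u < 2 * n)
    (hp : p < 2 * n) (q : ℕ) : (valueE q).eval s =
      s.real (s.nat q) + cross (itemPt L p) (itemPt L l) (itemPt L u) := by
  subst h10 h11 h12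
  exact congrArg (s.real (s.nat q) + ·) (h.eval_cross (p := cell 12) (q := cell 10)
    (r := cell 11) hp hl hu)

theorem run_nextP (s : State) : nextP.run s = { s with nat := Function.update (Function.update
    (Function.update s.nat 12 (s.nat 12 + 1)) 13 (s.nat 13 + s.nat 2)) 14 (s.nat 14 + 1) } := by
  simp [nextP, Prog.run, NatExpr.eval]

theorem run_relaxBody (h : Common k L d s)
    (hpar : ∀ i, det2 d (L i).a = det2 d (L i).b) {l u p : ℕ} (h10 : s.nat 10 = l)
    (h11 : s.nat 11 = u) (h12 : s.nat 12 = p) (hl : l < 2 * n) (hu : u < 2 * n)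
    (hp : p < 2 * n) {t : ℕ → ℕ → ℝ} (h13 : s.real (s.nat 13) = t p u)
    (h14 : s.real (s.nat 14) = t l p) {acc : ℝ} (h7 : s.real (s.nat 7) = acc) :
    relaxBody.run s = nextP.run ⟨s.nat, Function.update s.real (s.nat 7)
      (relax (itemKey L d) (itemPt L) t l u acc p)⟩ := by
  have hskip : s = { s with real := Function.update s.real (s.nat 7) acc } := by
    rw [← h7, Function.update_eq_self]
  have key : ∀ q v, (valueE q).eval s = v →
      Prog.run (.branch (.realLe (valueE q) (.load (cell 7))) .skip
        (.setReal (cell 7) (valueE q))) s =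
      { s with real := Function.update s.real (s.nat 7) (max acc v) } := by
    intro q v hv
    have hc : (Cond.realLe (valueE q) (.load (cell 7))).holds s ↔ v ≤ acc := by
      rw [← hv, ← h7]; rfl
    rw [Prog.run]
    split_ifs with h1
    · rw [hc] at h1
      rw [max_eq_left h1]
      exact hskip
    · rw [hc, not_le] at h1
      rw [max_eq_right h1.le, Prog.run, hv]
      rfl
  rw [relaxBody, Prog.run]
  congr 1
  rw [Prog.run, h.holds_lastC hpar h10 h11 h12 hl hu hp, relax]
  split_ifs with h1 h2
  · exact key 13 _ (by rw [h.eval_value h10 h11 h12 hl hu hp, h13])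
  · rw [Prog.run, if_pos ((h.holds_firstC hpar h10 h11 h12 hl hu hp).2 h2)]
    exact key 14 _ (by rw [h.eval_value h10 h11 h12 hl hu hp, h14])
  · rw [Prog.run, if_neg (mt (h.holds_firstC hpar h10 h11 h12 hl hu hp).1 h2)]
    exact hskip

/-- The offset of the table entry `r l u`, for tables with rows of length `N`. -/
def offset (N r l u : ℕ) : ℕ := (r * N + l) * N + u

/-- The table entry with a given offset. -/
noncomputable def entry (L : Fin n → Seg) (d : Pt) (x : ℕ) : ℝ :=
  table (itemKey L d) (itemPt L) (2 * n) (x / (2 * n) / (2 * n)) (x / (2 * n) % (2 * n))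
    (x % (2 * n))

theorem entry_offset {r l u : ℕ} (hl : l < 2 * n) (hu : u < 2 * n) :
    entry L d (offset (2 * n) r l u) = table (itemKey L d) (itemPt L) (2 * n) r l u := by
  have h1 : offset (2 * n) r l u / (2 * n) = r * (2 * n) + l := by
    rw [offset, mul_comm _ (2 * n), Nat.mul_add_div (by omega), Nat.div_eq_of_lt hu, add_zero]
  have h2 : offset (2 * n) r l u % (2 * n) = u := by
    rw [offset, mul_comm _ (2 * n), Nat.mul_add_mod, Nat.mod_eq_of_lt hu]
  rw [entry, h1, h2, mul_comm r, Nat.mul_add_div (by omega), Nat.div_eq_of_lt hl, add_zero,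
    Nat.mul_add_mod, Nat.mod_eq_of_lt hl]

theorem offset_succ_layer (N r l u : ℕ) : offset N (r + 1) l u = offset N r l u + N * N := by
  simp only [offset]; ring

theorem offset_succ_row (N r l u : ℕ) : offset N r (l + 1) u = offset N r l u + N := by
  simp only [offset]; ring

theorem offset_add (N r l u : ℕ) : offset N r l u = offset N r l 0 + u := by
  simp only [offset]; ring

theorem offset_add_row (N r l u : ℕ) : offset N r l u = offset N r 0 u + l * N := by
  simp only [offset]; ring

theorem offset_row_end (N r l : ℕ) : offset N r l N = offset N r (l + 1) 0 := by
  simp only [offset]; ring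

theorem offset_layer_end (N r : ℕ) : offset N r N 0 = offset N (r + 1) 0 0 := by
  simp only [offset]; ring

theorem offset_lt_layer {N r l u : ℕ} (hl : l < N) (hu : u < N) :
    offset N r l u < offset N (r + 1) 0 0 := by
  rw [← offset_layer_end, offset_add N r l u, offset_add_row N r l, offset_add_row N r N]
  have : (l + 1) * N ≤ N * N := Nat.mul_le_mul_right _ hl
  rw [Nat.succ_mul] at this
  omega

/-- The running maximum lives in the cell of the new entry, while only cells of the previous layer
are read; the two address ranges are disjoint by `offset_lt_layer`. -/
theorem exec_relaxLoop (h : Common k L d s)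
    (hpar : ∀ i, det2 d (L i).a = det2 d (L i).b) {r l u : ℕ} (h10 : s.nat 10 = l)
    (h11 : s.nat 11 = u) (h12 : s.nat 12 = 0) (hl : l < 2 * n) (hu : u < 2 * n)
    (h13 : s.nat 13 = 4 * n + 2 + offset (2 * n) r 0 u)
    (h14 : s.nat 14 = 4 * n + 2 + offset (2 * n) r l 0)
    (h7 : s.nat 7 = 4 * n + 2 + offset (2 * n) (r + 1) l u)
    (htab : ∀ x, x < offset (2 * n) (r + 1) 0 0 → s.real (4 * n + 2 + x) = entry L d x)
    (hacc : s.real (4 * n + 2 + offset (2 * n) (r + 1) l u) =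
      table (itemKey L d) (itemPt L) (2 * n) r l u) :
    Exec relaxLoop s (2 * n * ((cellLt 12 2).cost + 1 + relaxBody.time) + ((cellLt 12 2).cost + 1))
      fun s' => (∀ c, c ∉ [12, 13, 14] → s'.nat c = s.nat c) ∧
        s'.real = Function.update s.real (4 * n + 2 + offset (2 * n) (r + 1) l u)
          (table (itemKey L d) (itemPt L) (2 * n) (r + 1) l u) := by
  refine (Exec.loop (M := 2 * n) (T := relaxBody.time) (fun p s' =>
    (∀ c, c ∉ [12, 13, 14] → s'.nat c = s.nat c) ∧ s'.nat 12 = p ∧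
    s'.nat 13 = 4 * n + 2 + offset (2 * n) r p u ∧
    s'.nat 14 = 4 * n + 2 + offset (2 * n) r l p ∧
    s'.real = Function.update s.real (4 * n + 2 + offset (2 * n) (r + 1) l u)
      (relaxAll (itemKey L d) (itemPt L) (table (itemKey L d) (itemPt L) (2 * n) r) l u p))
    ?_ ?_ ?_).mono le_rfl fun s' hs' => ⟨hs'.1, hs'.2.2.2.2⟩
  · rintro p hp s' ⟨e0, e12, e13, e14, er⟩
    have hC : Common k L d s' := h.frame
      (fun c hc => e0 c (by simp; omega)) (by
        intro c hc
        rw [er, Function.update_of_ne (by omega)])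
    have e10 : s'.nat 10 = l := by rw [e0 10 (by decide), h10]
    have e11 : s'.nat 11 = u := by rw [e0 11 (by decide), h11]
    have e7 : s'.nat 7 = 4 * n + 2 + offset (2 * n) (r + 1) l u := by
      rw [e0 7 (by decide), h7]
    refine ⟨?_, Exec.of_loopFree (by simp [relaxBody, nextP, Prog.LoopFree]) ?_⟩
    · simp only [cellLt, Cond.holds, NatExpr.eval, hC.n2, e12]
      omega
    have hle : offset (2 * n) (r + 1) 0 0 ≤ offset (2 * n) (r + 1) l u := by
      rw [offset_add _ _ l, offset_add_row _ _ l]; omega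
    have hread : ∀ l' u', l' < 2 * n → u' < 2 * n →
        s'.real (4 * n + 2 + offset (2 * n) r l' u') =
          table (itemKey L d) (itemPt L) (2 * n) r l' u' := by
      intro l' u' hl' hu'
      have := offset_lt_layer (r := r) hl' hu'
      rw [er, Function.update_of_ne (by omega), htab _ this, entry_offset hl' hu']
    rw [run_relaxBody hC hpar e10 e11 e12 hl hu hp
      (t := table (itemKey L d) (itemPt L) (2 * n) r) (by rw [e13, hread p u hp hu])
      (by rw [e14, hread l p hl hp]) (by rw [e7, er, Function.update_self]), run_nextP]
    refine ⟨?_, ?_, ?_, ?_, ?_⟩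
    · intro c hc
      simp only [List.mem_cons, List.not_mem_nil, or_false, not_or] at hc
      simp only [Function.update_of_ne hc.1, Function.update_of_ne hc.2.1,
        Function.update_of_ne hc.2.2]
      exact e0 c (by simpa using hc)
    · simp [e12]
    · simp [e13, hC.n2, offset_succ_row]; ring
    · simp [e14]; rw [offset_add _ _ _ (p + 1), offset_add _ _ _ p]; ring
    · simp only [e7, er, Function.update_idem, relaxAll_succ]
  · rintro s' ⟨e0, e12, -⟩
    simp only [cellLt, Cond.holds, NatExpr.eval, e12, e0 2 (by decide), h.n2]
    omega
  · refine ⟨fun c _ => rfl, h12, h13, h14, ?_⟩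
    rw [relaxAll_zero, ← hacc, Function.update_eq_self]

end

end Imprecise

namespace Imprecise

open RealRAM

/-! ### Filling the table: loops over entries, rows and layers -/

section

variable {n k : ℕ} {L : Fin n → Seg} {d : Pt} {s s' : State}

/-- The cells `15` to `18` and `20` describe a largest one of the first `x` table entries, which
is larger than all entries of the layers before its own. -/
def BestEntry (k : ℕ) (L : Fin n → Seg) (d : Pt) (x : ℕ) (s : State) : Prop :=
  ∃ br bl bu, bl < 2 * n ∧ bu < 2 * n ∧ s.nat 15 = 4 * n + 2 + offset (2 * n) br bl bu ∧
    s.nat 16 = br ∧ s.nat 17 = bl ∧ s.nat 18 = bu ∧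
    (0 < br → s.nat 20 = 4 * n + 2 + offset (2 * n) (br - 1) 0 0) ∧
    offset (2 * n) br bl bu < x ∧ (br = 0 ∨ br + 2 ≤ k) ∧
    (∀ y, y < x → entry L d y ≤ table (itemKey L d) (itemPt L) (2 * n) br bl bu) ∧
    ∀ y, y < offset (2 * n) br 0 0 →
      entry L d y < table (itemKey L d) (itemPt L) (2 * n) br bl bu

/-- The invariant of the table computation when `x` entries are known. -/
structure TableInv {n : ℕ} (k : ℕ) (L : Fin n → Seg) (d : Pt) (x : ℕ) (s : State) : Prop where
  common : Common k L d s
  zero : ∀ c, 32 + 2 * n ≤ c → c < 33 + 4 * n → s.nat c = 0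
  filled : ∀ y, y < x → s.real (4 * n + 2 + y) = entry L d y
  best : BestEntry k L d x s

theorem TableInv.frame {x : ℕ} (h : TableInv k L d x s)
    (hn : ∀ c, c ∉ [6, 7, 8, 9, 10, 11, 12, 13, 14] → s'.nat c = s.nat c)
    (hr : s'.real = s.real) : TableInv k L d x s' where
  common := h.common.frame (fun c hc => hn c (by simp; omega)) fun c _ => by rw [hr]
  zero c h1 h2 := by rw [hn c (by simp; omega), h.zero c h1 h2]
  filled y hy := by rw [hr, h.filled y hy]
  best := by
    obtain ⟨br, bl, bu, h1, h2, h3, h4, h5, h6, h7, h8⟩ := h.best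
    exact ⟨br, bl, bu, h1, h2, by rw [hn 15 (by decide), h3], by rw [hn 16 (by decide), h4],
      by rw [hn 17 (by decide), h5], by rw [hn 18 (by decide), h6],
      fun h => by rw [hn 20 (by decide), h7 h], h8⟩

theorem exec_entryProg (hpar : ∀ i, det2 d (L i).a = det2 d (L i).b) {r l u : ℕ}
    (hl : l < 2 * n) (hu : u < 2 * n) (hr : r + 3 ≤ k)
    (h : TableInv k L d (offset (2 * n) (r + 1) l u) s)
    (h7 : s.nat 7 = 4 * n + 2 + offset (2 * n) (r + 1) l u)
    (h8 : s.nat 8 = 4 * n + 2 + offset (2 * n) r 0 0) (h9 : s.nat 9 = r + 1)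
    (h10 : s.nat 10 = l) (h11 : s.nat 11 = u) :
    Exec entryProg s (entryInit.time + ((2 * n * ((cellLt 12 2).cost + 1 + relaxBody.time) +
      ((cellLt 12 2).cost + 1)) + entryEnd.time)) fun s' =>
        TableInv k L d (offset (2 * n) (r + 1) l u + 1) s' ∧
        s'.nat 7 = 4 * n + 2 + offset (2 * n) (r + 1) l u + 1 ∧
        s'.nat 8 = 4 * n + 2 + offset (2 * n) r 0 0 ∧ s'.nat 9 = r + 1 ∧ s'.nat 10 = l ∧
        s'.nat 11 = u + 1 := by
  have hC := h.common
  have hsucc := offset_succ_layer (2 * n) r l u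
  have hlay : offset (2 * n) (r + 1) 0 0 ≤ offset (2 * n) (r + 1) l u := by
    rw [offset_add _ _ l, offset_add_row _ _ l]; omega
  have hlt := offset_lt_layer (r := r) hl hu
  have h73 : s.nat 7 - s.nat 3 = 4 * n + 2 + offset (2 * n) r l u := by
    rw [h7, hC.n3]; omega
  refine Exec.seq (Q := fun s1 => (∀ c, c ∉ [12, 13, 14] → s1.nat c = s.nat c) ∧ s1.nat 12 = 0 ∧
      s1.nat 13 = 4 * n + 2 + offset (2 * n) r 0 u ∧
      s1.nat 14 = 4 * n + 2 + offset (2 * n) r l 0 ∧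
      s1.real = Function.update s.real (4 * n + 2 + offset (2 * n) (r + 1) l u)
        (table (itemKey L d) (itemPt L) (2 * n) r l u))
    (Exec.of_loopFree (by simp [entryInit, firstP, Prog.LoopFree]) ?_) ?_
  · have hrun : entryInit.run s = ⟨Function.update (Function.update (Function.update s.nat 12 0) 13
        (s.nat 8 + s.nat 11)) 14 (s.nat 7 - s.nat 3 - s.nat 11),
        Function.update s.real (s.nat 7) (s.real (s.nat 7 - s.nat 3))⟩ := by
      simp [entryInit, firstP, Prog.run, NatExpr.eval, RealExpr.eval]
    rw [hrun]
    refine ⟨?_, by simp, ?_, ?_, ?_⟩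
    · intro c hc
      simp only [List.mem_cons, List.not_mem_nil, or_false, not_or] at hc
      simp only [Function.update_of_ne hc.1, Function.update_of_ne hc.2.1,
        Function.update_of_ne hc.2.2]
    · simp [h8, h11]; rw [offset_add _ _ 0 u]; ring
    · simp only [Function.update_self, h73, h11]; rw [offset_add _ r l u]; omega
    · simp only [h73]
      rw [h.filled _ (by omega), entry_offset hl hu, h7]
  rintro s1 ⟨e0, e12, e13, e14, er⟩
  have hC1 : Common k L d s1 := hC.frame (fun c hc => e0 c (by simp; omega)) fun c hc => by
    rw [er, Function.update_of_ne (by omega)]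
  refine Exec.seq (exec_relaxLoop hC1 hpar (r := r) (l := l) (u := u)
    (by rw [e0 10 (by decide), h10]) (by rw [e0 11 (by decide), h11]) e12 hl hu e13 e14
    (by rw [e0 7 (by decide), h7]) ?_ ?_) ?_
  · intro x hx
    rw [er, Function.update_of_ne (by omega), h.filled _ (by omega)]
  · rw [er, Function.update_self]
  rintro s2 ⟨f0, fr⟩
  have g0 : ∀ c, c ∉ [12, 13, 14] → s2.nat c = s.nat c := fun c hc => by rw [f0 c hc, e0 c hc]
  rw [er, Function.update_idem] at fr
  apply Exec.of_loopFree (by simp [entryEnd, Prog.LoopFree])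
  obtain ⟨br, bl, bu, b1, b2, b15, b16, b17, b18, b20, bx, bk, bmax, bprev⟩ := h.best
  have hcond : (Cond.realLe (.load (cell 7)) (.load (cell 15))).holds s2 ↔
      table (itemKey L d) (itemPt L) (2 * n) (r + 1) l u ≤
        table (itemKey L d) (itemPt L) (2 * n) br bl bu := by
    simp only [Cond.holds, RealExpr.eval, NatExpr.eval]
    rw [g0 7 (by decide), g0 15 (by decide), h7, b15, fr, Function.update_self,
      Function.update_of_ne (by omega), h.filled _ bx, entry_offset b1 b2]
  have hfill : ∀ y, y < offset (2 * n) (r + 1) l u + 1 → s2.real (4 * n + 2 + y) =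
      entry L d y := by
    intro y hy
    rcases Nat.lt_succ_iff_lt_or_eq.1 hy with hy | rfl
    · rw [fr, Function.update_of_ne (by omega), h.filled _ hy]
    · rw [fr, Function.update_self, entry_offset hl hu]
  have hC2 : Common k L d s2 := hC.frame (fun c hc => g0 c (by simp; omega)) fun c hc => by
    rw [fr, Function.update_of_ne (by omega)]
  have hend : ∀ (s3 : State) (hs3 : TableInv k L d (offset (2 * n) (r + 1) l u + 1) s3)
      (h3 : ∀ c, c ∈ [7, 8, 9, 10, 11] → s3.nat c = s.nat c),
      (fun s' => TableInv k L d (offset (2 * n) (r + 1) l u + 1) s' ∧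
        s'.nat 7 = 4 * n + 2 + offset (2 * n) (r + 1) l u + 1 ∧
        s'.nat 8 = 4 * n + 2 + offset (2 * n) r 0 0 ∧ s'.nat 9 = r + 1 ∧ s'.nat 10 = l ∧
        s'.nat 11 = u + 1) ((Prog.seq (incr 11) (incr 7)).run s3) := by
    intro s3 hs3 h3
    have hrun : (Prog.seq (incr 11) (incr 7)).run s3 = ⟨Function.update (Function.update s3.nat 11
        (s3.nat 11 + 1)) 7 (s3.nat 7 + 1), s3.real⟩ := by
      simp [Prog.run, NatExpr.eval]
    rw [hrun]
    refine ⟨hs3.frame ?_ rfl, ?_, ?_, ?_, ?_, ?_⟩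
    · intro c hc
      simp only [List.mem_cons, List.not_mem_nil, or_false, not_or] at hc
      simp only [Function.update_of_ne hc.2.1, Function.update_of_ne hc.2.2.2.2.2.1]
    · simp [h3 7, h7]
    · simp [h3 8, h8]
    · simp [h3 9, h9]
    · simp [h3 10, h10]
    · simp [h3 11, h11]
  rw [entryEnd, Prog.run]
  apply hend
  · rw [Prog.run]
    split_ifs with hc
    · rw [hcond] at hc
      refine ⟨hC2, fun c h1 h2 => by rw [Prog.run, g0 c (by simp; omega), h.zero c h1 h2], hfill,
        ⟨br, bl, bu, b1, b2, by rw [Prog.run, g0 15 (by decide), b15],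
        by rw [Prog.run, g0 16 (by decide), b16], by rw [Prog.run, g0 17 (by decide), b17],
        by rw [Prog.run, g0 18 (by decide), b18],
        fun h => by rw [Prog.run, g0 20 (by decide), b20 h], by omega, bk, ?_, bprev⟩⟩
      intro y hy
      rcases Nat.lt_succ_iff_lt_or_eq.1 hy with hy | rfl
      · exact bmax y hy
      · rwa [entry_offset hl hu]
    · rw [hcond, not_le] at hc
      have hrun : (Prog.seq (.setNat (.const 15) (cell 7)) (.seq (.setNat (.const 16) (cell 9))
          (.seq (.setNat (.const 17) (cell 10)) (.seq (.setNat (.const 18) (cell 11))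
          (.setNat (.const 20) (cell 8)))))).run s2 = ⟨Function.update (Function.update
            (Function.update (Function.update (Function.update s2.nat 15 (s2.nat 7)) 16
              (s2.nat 9)) 17 (s2.nat 10)) 18 (s2.nat 11)) 20 (s2.nat 8), s2.real⟩ := by
        simp [Prog.run, NatExpr.eval]
      rw [hrun]
      refine ⟨hC2.frame ?_ fun _ _ => rfl, ?_, hfill, ⟨r + 1, l, u, hl, hu, ?_, ?_, ?_, ?_, ?_,
        by omega, Or.inr (by omega), ?_, ?_⟩⟩
      · intro c hc
        simp (disch := omega) only [Function.update_of_ne]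
      · intro c h1 h2
        simp (disch := omega) only [Function.update_of_ne]
        rw [g0 c (by simp; omega), h.zero c h1 h2]
      · simp [g0 7, h7]
      · simp [g0 9, h9]
      · simp [g0 10, h10]
      · simp [g0 11, h11]
      · intro _
        simp [g0 8, h8]
      · intro y hy
        rcases Nat.lt_succ_iff_lt_or_eq.1 hy with hy | rfl
        · exact (bmax y hy).trans hc.le
        · rw [entry_offset hl hu]
      -- A new record exceeds the old one strictly, and the old one bounds every entry computed so
      -- far, in particular all earlier layers.
      · intro y hy
        exact (bmax y (by omega)).trans_lt hc
  · intro c hc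
    simp only [List.mem_cons, List.not_mem_nil, or_false] at hc
    rw [Prog.run]
    split_ifs
    · exact g0 c (by simp; omega)
    · simp only [Prog.run, NatExpr.eval]
      simp (disch := omega) only [Function.update_of_ne]
      exact g0 c (by simp; omega)

/-- A bound for the time to compute one table entry. -/
def entryTime (N : ℕ) : ℕ :=
  entryInit.time + ((N * ((cellLt 12 2).cost + 1 + relaxBody.time) + ((cellLt 12 2).cost + 1)) +
    entryEnd.time)

/-- A bound for the time to compute one row of a layer of the table. -/
def rowTime (N : ℕ) : ℕ :=
  (Prog.setNat (.const 11) (.const 0)).time +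
    ((N * ((cellLt 11 2).cost + 1 + entryTime N) + ((cellLt 11 2).cost + 1)) + (incr 10).time)

/-- A bound for the time to compute one layer of the table. -/
def layerTime (N : ℕ) : ℕ :=
  (Prog.setNat (.const 10) (.const 0)).time +
    ((N * ((cellLt 10 2).cost + 1 + rowTime N) + ((cellLt 10 2).cost + 1)) + layerEnd.time)

theorem exec_rowProg (hpar : ∀ i, det2 d (L i).a = det2 d (L i).b) {r l : ℕ}
    (hl : l < 2 * n) (hr : r + 3 ≤ k)
    (h : TableInv k L d (offset (2 * n) (r + 1) l 0) s)
    (h7 : s.nat 7 = 4 * n + 2 + offset (2 * n) (r + 1) l 0)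
    (h8 : s.nat 8 = 4 * n + 2 + offset (2 * n) r 0 0) (h9 : s.nat 9 = r + 1)
    (h10 : s.nat 10 = l) :
    Exec rowProg s (rowTime (2 * n)) fun s' =>
        TableInv k L d (offset (2 * n) (r + 1) (l + 1) 0) s' ∧
        s'.nat 7 = 4 * n + 2 + offset (2 * n) (r + 1) (l + 1) 0 ∧
        s'.nat 8 = 4 * n + 2 + offset (2 * n) r 0 0 ∧ s'.nat 9 = r + 1 ∧ s'.nat 10 = l + 1 := by
  let I : ℕ → State → Prop := fun u s' => TableInv k L d (offset (2 * n) (r + 1) l u) s' ∧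
    s'.nat 7 = 4 * n + 2 + offset (2 * n) (r + 1) l u ∧
    s'.nat 8 = 4 * n + 2 + offset (2 * n) r 0 0 ∧ s'.nat 9 = r + 1 ∧ s'.nat 10 = l ∧
    s'.nat 11 = u
  refine Exec.seq (Q := I 0) (Exec.of_loopFree (by simp [Prog.LoopFree]) ?_)
    fun s1 hs1 => Exec.seq (Exec.loop (M := 2 * n) (T := entryTime (2 * n)) I ?_ ?_ hs1) ?_
  · refine ⟨h.frame ?_ rfl, ?_, ?_, ?_, ?_, ?_⟩
    · intro c hc
      simp only [List.mem_cons, List.not_mem_nil, or_false, not_or] at hc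
      simp [Prog.run, NatExpr.eval, hc]
    all_goals simp [Prog.run, NatExpr.eval, h7, h8, h9, h10]
  · rintro u hu s2 ⟨i0, i7, i8, i9, i10, i11⟩
    refine ⟨?_, (exec_entryProg hpar hl hu hr i0 i7 i8 i9 i10 i11).mono le_rfl ?_⟩
    · simp only [cellLt, Cond.holds, NatExpr.eval, i0.common.n2, i11]; omega
    · rintro s3 ⟨j0, j7, j8⟩
      rw [add_assoc] at j7
      have : offset (2 * n) (r + 1) l u + 1 = offset (2 * n) (r + 1) l (u + 1) := by
        simp only [offset]; ring
      rw [this] at j0 j7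
      exact ⟨j0, j7, j8⟩
  · rintro s2 ⟨i0, i7, i8, i9, i10, i11⟩
    simp only [cellLt, Cond.holds, NatExpr.eval, i0.common.n2, i11]; omega
  · rintro s2 ⟨i0, i7, i8, i9, i10, i11⟩
    rw [offset_row_end] at i0 i7
    refine Exec.of_loopFree (by simp [Prog.LoopFree]) ⟨i0.frame ?_ rfl, ?_, ?_, ?_, ?_⟩
    · intro c hc
      simp only [List.mem_cons, List.not_mem_nil, or_false, not_or] at hc
      simp [Prog.run, NatExpr.eval, hc]
    all_goals simp [Prog.run, NatExpr.eval, i7, i8, i9, i10]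

theorem exec_layerProg (hpar : ∀ i, det2 d (L i).a = det2 d (L i).b) {r : ℕ} (hr : r + 3 ≤ k)
    (h : TableInv k L d (offset (2 * n) (r + 1) 0 0) s)
    (h7 : s.nat 7 = 4 * n + 2 + offset (2 * n) (r + 1) 0 0)
    (h8 : s.nat 8 = 4 * n + 2 + offset (2 * n) r 0 0) (h9 : s.nat 9 = r + 1) :
    Exec layerProg s (layerTime (2 * n)) fun s' =>
        TableInv k L d (offset (2 * n) (r + 2) 0 0) s' ∧
        s'.nat 7 = 4 * n + 2 + offset (2 * n) (r + 2) 0 0 ∧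
        s'.nat 8 = 4 * n + 2 + offset (2 * n) (r + 1) 0 0 ∧ s'.nat 9 = r + 2 := by
  let I : ℕ → State → Prop := fun l s' => TableInv k L d (offset (2 * n) (r + 1) l 0) s' ∧
    s'.nat 7 = 4 * n + 2 + offset (2 * n) (r + 1) l 0 ∧
    s'.nat 8 = 4 * n + 2 + offset (2 * n) r 0 0 ∧ s'.nat 9 = r + 1 ∧ s'.nat 10 = l
  refine Exec.seq (Q := I 0) (Exec.of_loopFree (by simp [Prog.LoopFree]) ?_)
    fun s1 hs1 => Exec.seq (Exec.loop (M := 2 * n) (T := rowTime (2 * n)) I ?_ ?_ hs1) ?_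
  · refine ⟨h.frame ?_ rfl, ?_, ?_, ?_, ?_⟩
    · intro c hc
      simp only [List.mem_cons, List.not_mem_nil, or_false, not_or] at hc
      simp [Prog.run, NatExpr.eval, hc]
    all_goals simp [Prog.run, NatExpr.eval, h7, h8, h9]
  · rintro l hl s2 ⟨i0, i7, i8, i9, i10⟩
    refine ⟨?_, exec_rowProg hpar hl hr i0 i7 i8 i9 i10⟩
    simp only [cellLt, Cond.holds, NatExpr.eval, i0.common.n2, i10]; omega
  · rintro s2 ⟨i0, i7, i8, i9, i10⟩
    simp only [cellLt, Cond.holds, NatExpr.eval, i0.common.n2, i10]; omega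
  · rintro s2 ⟨i0, i7, i8, i9, i10⟩
    rw [offset_layer_end] at i0 i7
    refine Exec.of_loopFree (by simp [layerEnd, Prog.LoopFree]) ⟨i0.frame ?_ rfl, ?_, ?_, ?_⟩
    · intro c hc
      simp only [List.mem_cons, List.not_mem_nil, or_false, not_or] at hc
      simp [layerEnd, Prog.run, NatExpr.eval, hc]
    · simp [layerEnd, Prog.run, NatExpr.eval, i7]
    · have := offset_succ_layer (2 * n) r 0 0
      simp only [layerEnd, Prog.run, NatExpr.eval, i8, i0.common.n3]
      simp
      omega
    · simp [layerEnd, Prog.run, NatExpr.eval, i9]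

/-- Layer 0 is zero and the memory starts out zero, so it costs nothing and serves as the initial
record. The truncated `k - 2` covers `k ≤ 2`, where no further layer is needed. -/
theorem exec_tableProg (hpar : ∀ i, det2 d (L i).a = det2 d (L i).b) (hn : 1 ≤ n)
    (h : Common k L d s) (hz : ∀ c, 32 + 2 * n ≤ c → c < 33 + 4 * n → s.nat c = 0)
    (h16 : s.nat 16 = 0) (h17 : s.nat 17 = 0) (h18 : s.nat 18 = 0)
    (hr : ∀ c, 4 * n + 2 ≤ c → s.real c = 0) :
    Exec tableProg s (tableInit.time + ((k - 2) *
      ((Cond.natLe (.add (cell 9) (.const 2)) (cell 1)).cost + 1 + layerTime (2 * n)) +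
      ((Cond.natLe (.add (cell 9) (.const 2)) (cell 1)).cost + 1)))
      (TableInv k L d (offset (2 * n) (k - 2 + 1) 0 0)) := by
  let I : ℕ → State → Prop := fun r s' => TableInv k L d (offset (2 * n) (r + 1) 0 0) s' ∧
    s'.nat 7 = 4 * n + 2 + offset (2 * n) (r + 1) 0 0 ∧
    s'.nat 8 = 4 * n + 2 + offset (2 * n) r 0 0 ∧ s'.nat 9 = r + 1
  have ho : offset (2 * n) 0 0 0 = 0 := by simp [offset]
  have ho1 : offset (2 * n) 1 0 0 = 2 * n * (2 * n) := by simp [offset]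
  refine Exec.seq (Q := I 0) (Exec.of_loopFree (by simp [tableInit, Prog.LoopFree]) ?_)
    fun s1 hs1 => (Exec.loop (M := k - 2) (T := layerTime (2 * n)) I ?_ ?_ hs1).mono le_rfl
      fun s2 hs2 => hs2.1
  · have hrun : tableInit.run s = ⟨Function.update (Function.update (Function.update
        (Function.update s.nat 8 (4 * n + 2)) 7 (4 * n + 2 + 2 * n * (2 * n))) 9 1) 15
        (4 * n + 2), s.real⟩ := by
      simp [tableInit, Prog.run, NatExpr.eval, h.n3, h.n5]
    have hentry : ∀ y, y < offset (2 * n) 1 0 0 → entry L d y = 0 := by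
      intro y hy
      rw [ho1] at hy
      rw [entry, Nat.div_div_eq_div_mul, Nat.div_eq_of_lt hy]
      rfl
    rw [hrun]
    refine ⟨⟨h.frame ?_ fun _ _ => rfl, ?_, ?_, ⟨0, 0, 0, by omega, by omega, ?_, ?_, ?_, ?_,
      fun h => absurd h (lt_irrefl 0), ?_, Or.inl rfl, ?_, ?_⟩⟩, ?_, ?_, ?_⟩
    · intro c hc
      simp (disch := omega) only [Function.update_of_ne]
    · intro c h1 h2
      simp (disch := omega) only [Function.update_of_ne]
      exact hz c h1 h2
    · intro y hy
      rw [hentry y hy]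
      exact hr _ (by omega)
    · simp [ho]
    · simp [h16]
    · simp [h17]
    · simp [h18]
    · rw [ho, ho1]; positivity
    · intro y hy
      rw [hentry y hy]
      rfl
    · intro y hy
      rw [ho] at hy
      omega
    · simp [ho1]
    · simp [ho]
    · simp
  · rintro r hr s2 ⟨i0, i7, i8, i9⟩
    refine ⟨?_, exec_layerProg hpar (by omega) i0 i7 i8 i9⟩
    simp only [Cond.holds, NatExpr.eval, i0.common.n1, i9]; omega
  · rintro s2 ⟨i0, i7, i8, i9⟩
    simp only [Cond.holds, NatExpr.eval, i0.common.n1, i9]; omega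

end

end Imprecise

namespace Imprecise

open RealRAM

/-! ### Verification of the output computation -/

section

variable {n k : ℕ} {L : Fin n → Seg} {d : Pt} {s s' : State}

theorem exec_searchLoop (h : Common k L d s)
    (hpar : ∀ i, det2 d (L i).a = det2 d (L i).b) {r l u : ℕ} (h10 : s.nat 10 = l)
    (h11 : s.nat 11 = u) (h12 : s.nat 12 = 0) (hl : l < 2 * n) (hu : u < 2 * n)
    (h13 : s.nat 13 = 4 * n + 2 + offset (2 * n) r 0 u)
    (h14 : s.nat 14 = 4 * n + 2 + offset (2 * n) r l 0)
    (h7 : s.real (s.nat 7) = table (itemKey L d) (itemPt L) (2 * n) (r + 1) l u)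
    (htab : ∀ x, x < offset (2 * n) (r + 1) 0 0 → s.real (4 * n + 2 + x) = entry L d x)
    (hex : ∃ p < 2 * n, Extends (itemKey L d) (itemPt L)
      (table (itemKey L d) (itemPt L) (2 * n) r) l u p
      (table (itemKey L d) (itemPt L) (2 * n) (r + 1) l u)) :
    Exec searchLoop s
      (2 * n * ((cellLt 12 2).cost + 1 + searchBody.time) + ((cellLt 12 2).cost + 1))
      fun s' => (∀ c, c ∉ [12, 13, 14, 21, 22] → s'.nat c = s.nat c) ∧ s'.real = s.real ∧
        ∃ p < 2 * n, s'.nat 21 = p ∧ Extends (itemKey L d) (itemPt L)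
          (table (itemKey L d) (itemPt L) (2 * n) r) l u p
          (table (itemKey L d) (itemPt L) (2 * n) (r + 1) l u) ∧
          (itemKey L d u < itemKey L d l → s'.nat 22 = 4 * n + 2 + offset (2 * n) r p u) ∧
          (itemKey L d l < itemKey L d u → s'.nat 22 = 4 * n + 2 + offset (2 * n) r l p) := by
  set v := table (itemKey L d) (itemPt L) (2 * n) (r + 1) l u with hv
  set t := table (itemKey L d) (itemPt L) (2 * n) r with ht
  let Found : State → Prop := fun s' => ∃ p < 2 * n, s'.nat 21 = p ∧
    Extends (itemKey L d) (itemPt L) t l u p v ∧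
    (itemKey L d u < itemKey L d l → s'.nat 22 = 4 * n + 2 + offset (2 * n) r p u) ∧
    (itemKey L d l < itemKey L d u → s'.nat 22 = 4 * n + 2 + offset (2 * n) r l p)
  refine (Exec.loop (M := 2 * n) (T := searchBody.time) (fun j s' =>
    (∀ c, c ∉ [12, 13, 14, 21, 22] → s'.nat c = s.nat c) ∧ s'.real = s.real ∧
    s'.nat 12 = j ∧ s'.nat 13 = 4 * n + 2 + offset (2 * n) r j u ∧
    s'.nat 14 = 4 * n + 2 + offset (2 * n) r l j ∧
    ((∃ p < j, Extends (itemKey L d) (itemPt L) t l u p v) → Found s'))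
    ?_ ?_ ?_).mono le_rfl fun s' hs' => ⟨hs'.1, hs'.2.1, hs'.2.2.2.2.2 hex⟩
  · rintro j hj s' ⟨e0, er, e12, e13, e14, eF⟩
    have hC : Common k L d s' := h.frame (fun c hc => e0 c (by simp; omega))
      fun c _ => by rw [er]
    have e10 : s'.nat 10 = l := by rw [e0 10 (by decide), h10]
    have e11 : s'.nat 11 = u := by rw [e0 11 (by decide), h11]
    refine ⟨?_, Exec.of_loopFree (by simp [searchBody, nextP, Prog.LoopFree]) ?_⟩
    · simp only [cellLt, Cond.holds, NatExpr.eval, hC.n2, e12]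
      omega
    have hread : ∀ l' u', l' < 2 * n → u' < 2 * n →
        s'.real (4 * n + 2 + offset (2 * n) r l' u') = t l' u' := by
      intro l' u' hl' hu'
      rw [er, htab _ (offset_lt_layer (r := r) hl' hu'), entry_offset hl' hu']
    have c1 : (Cond.conj lastC (.realLe (.load (cell 7)) (valueE 13))).holds s' ↔
        (itemKey L d u < itemKey L d l ∧ itemKey L d j < itemKey L d l ∧
          itemKey L d j ≠ itemKey L d u) ∧
        v ≤ t j u + cross (itemPt L j) (itemPt L l) (itemPt L u) := by
      refine and_congr (hC.holds_lastC hpar e10 e11 e12 hl hu hj) ?_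
      have : (Cond.realLe (.load (cell 7)) (valueE 13)).holds s' ↔
        s'.real (s'.nat 7) ≤ (valueE 13).eval s' := Iff.rfl
      rw [this, hC.eval_value e10 e11 e12 hl hu hj, e13, hread j u hj hu, er,
        e0 7 (by decide), h7]
    have c2 : (Cond.conj firstC (.realLe (.load (cell 7)) (valueE 14))).holds s' ↔
        (itemKey L d l < itemKey L d u ∧ itemKey L d j < itemKey L d u ∧
          itemKey L d j ≠ itemKey L d l) ∧
        v ≤ t l j + cross (itemPt L j) (itemPt L l) (itemPt L u) := by
      refine and_congr (hC.holds_firstC hpar e10 e11 e12 hl hu hj) ?_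
      have : (Cond.realLe (.load (cell 7)) (valueE 14)).holds s' ↔
        s'.real (s'.nat 7) ≤ (valueE 14).eval s' := Iff.rfl
      rw [this, hC.eval_value e10 e11 e12 hl hu hj, e14, hread l j hl hj, er,
        e0 7 (by decide), h7]
    -- the state before `p` is advanced
    obtain ⟨s2, hs2, f0, fr, fF⟩ : ∃ s2, searchBody.run s' = nextP.run s2 ∧
        (∀ c, c ∉ [21, 22] → s2.nat c = s'.nat c) ∧ s2.real = s'.real ∧
        ((∃ p < j + 1, Extends (itemKey L d) (itemPt L) t l u p v) → Found s2) := by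
      refine ⟨_, rfl, ?_⟩
      rw [Prog.run]
      split_ifs with h1
      · rw [c1] at h1
        obtain ⟨⟨k1, k2, k3⟩, k4⟩ := h1
        -- The program tests only `≤`; the reverse inequality holds because `v` is the maximum over
        -- all candidates, so the test detects equality.
        have hle : t j u + cross (itemPt L j) (itemPt L l) (itemPt L u) ≤ v :=
          Extends.le_relaxAll (Or.inl ⟨k1, k2, k3, rfl⟩) hj
        refine ⟨?_, rfl, fun _ => ⟨j, hj, ?_, Or.inl ⟨k1, k2, k3, le_antisymm k4 hle⟩,
          fun _ => ?_, fun hh => absurd hh k1.not_gt⟩⟩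
        · intro c hc
          simp only [List.mem_cons, List.not_mem_nil, or_false, not_or] at hc
          simp [Prog.run, NatExpr.eval, hc]
        · simp [Prog.run, NatExpr.eval, e12]
        · simp [Prog.run, NatExpr.eval, e13]
      rw [Prog.run]
      split_ifs with h2
      · rw [c2] at h2
        obtain ⟨⟨k1, k2, k3⟩, k4⟩ := h2
        have hle : t l j + cross (itemPt L j) (itemPt L l) (itemPt L u) ≤ v :=
          Extends.le_relaxAll (Or.inr ⟨k1, k2, k3, rfl⟩) hj
        refine ⟨?_, rfl, fun _ => ⟨j, hj, ?_, Or.inr ⟨k1, k2, k3, le_antisymm k4 hle⟩,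
          fun hh => absurd hh k1.not_gt, fun _ => ?_⟩⟩
        · intro c hc
          simp only [List.mem_cons, List.not_mem_nil, or_false, not_or] at hc
          simp [Prog.run, NatExpr.eval, hc]
        · simp [Prog.run, NatExpr.eval, e12]
        · simp [Prog.run, NatExpr.eval, e14]
      · refine ⟨fun _ _ => rfl, rfl, ?_⟩
        rintro ⟨p, hp, hE⟩
        rcases Nat.lt_succ_iff_lt_or_eq.1 hp with hp | rfl
        · exact eF ⟨p, hp, hE⟩
        · rcases hE with ⟨k1, k2, k3, k4⟩ | ⟨k1, k2, k3, k4⟩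
          · exact absurd (c1.2 ⟨⟨k1, k2, k3⟩, k4.le⟩) h1
          · exact absurd (c2.2 ⟨⟨k1, k2, k3⟩, k4.le⟩) h2
    rw [hs2, run_nextP]
    refine ⟨?_, by rw [← er, ← fr], ?_, ?_, ?_, ?_⟩
    · intro c hc
      rw [← e0 c hc, ← f0 c (by simp at hc ⊢; omega)]
      simp only [List.mem_cons, List.not_mem_nil, or_false, not_or] at hc
      simp [hc]
    · simp [f0 12, e12]
    · simp [f0 13, f0 2, e13, hC.n2, offset_succ_row]; ring
    · simp [f0 14, e14]; rw [offset_add _ _ _ (j + 1), offset_add _ _ _ j]; ring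
    · intro hE
      obtain ⟨p, hp, q1, q2, q3, q4⟩ := fF hE
      exact ⟨p, hp, by simpa using q1, q2, by simpa using q3, by simpa using q4⟩
  · rintro s' ⟨e0, -, e12, -⟩
    simp only [cellLt, Cond.holds, NatExpr.eval, e12, e0 2 (by decide), h.n2]
    omega
  · exact ⟨fun c _ => rfl, rfl, h12, h13, h14, fun ⟨p, hp, _⟩ => absurd hp (by omega)⟩

/-- The buffer holds the first entries `A` and the last entries `B` of a list of `m` items, with
a gap of length `g` between them. -/
structure Buffer (n : ℕ) (A B : List ℕ) (g m : ℕ) (s : State) : Prop where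
  length : A.length + g + B.length = m
  size : s.nat (32 + 2 * n) = m
  front : ∀ i x, A[i]? = some x → s.nat (33 + 3 * n + i) = x / 2
  back : ∀ i x, B[i]? = some x → s.nat (33 + 3 * n + (A.length + g + i)) = x / 2
  ends : ∀ x, x ∈ A ∨ x ∈ B → s.nat (33 + 2 * n + x / 2) = x % 2
  bit : ∀ i, i < n → s.nat (33 + 2 * n + i) ≤ 1

theorem Buffer.frame {A B : List ℕ} {g m : ℕ} (h : Buffer n A B g m s) (hm : m ≤ n)
    (hA : ∀ x, x ∈ A ∨ x ∈ B → x < 2 * n)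
    (hs : ∀ c, 32 + 2 * n ≤ c → c < 33 + 4 * n → s'.nat c = s.nat c) : Buffer n A B g m s' where
  length := h.length
  size := by rw [hs _ (by omega) (by omega), h.size]
  front i x hx := by
    have := (List.getElem?_eq_some_iff.1 hx).1
    have := h.length
    rw [hs _ (by omega) (by omega), h.front i x hx]
  back i x hx := by
    have := (List.getElem?_eq_some_iff.1 hx).1
    have := h.length
    rw [hs _ (by omega) (by omega), h.back i x hx]
  ends x hx := by
    have := hA x hx
    rw [hs _ (by omega) (by omega), h.ends x hx]
  bit i hi := by rw [hs _ (by omega) (by omega)]; exact h.bit i hi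

/-- By `hne` the segment of `x` is new, so writing its endpoint bit does not spoil the bit of an
earlier vertex. -/
theorem Buffer.push_front {A B : List ℕ} {g m x : ℕ} (h : Buffer n A B (g + 1) m s)
    (hx : x < 2 * n) (hne : ∀ y, y ∈ A ∨ y ∈ B → y / 2 ≠ x / 2)
    (hA : ∀ y, y ∈ A ∨ y ∈ B → y < 2 * n)
    (hs : s'.nat = Function.update (Function.update s.nat (33 + 3 * n + A.length) (x / 2))
      (33 + 2 * n + x / 2) (x % 2)) : Buffer n (A ++ [x]) B g m s' where
  length := by have := h.length; simp; omega
  size := by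
    rw [hs]
    simp (disch := omega) only [Function.update_of_ne]
    exact h.size
  front i y hy := by
    have hl := h.length
    rw [hs, Function.update_of_ne (by omega)]
    rcases lt_or_ge i A.length with hi | hi
    · rw [Function.update_of_ne (by omega)]
      rw [List.getElem?_append_left hi] at hy
      exact h.front i y hy
    · have hi' := (List.getElem?_eq_some_iff.1 hy).1
      rw [List.length_append, List.length_singleton] at hi'
      obtain rfl : i = A.length := by omega
      rw [List.getElem?_append_right le_rfl] at hy
      simp at hy
      rw [Function.update_self, hy]
  back i y hy := by
    have hl := h.length
    rw [hs, Function.update_of_ne (by omega), Function.update_of_ne (by simp; omega),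
      ← h.back i y hy]
    congr 1
    simp
    omega
  ends y hy := by
    rw [hs]
    by_cases hyx : y / 2 = x / 2
    · have : y = x := by
        by_contra hne'
        refine hne y ?_ hyx
        simp only [List.mem_append, List.mem_singleton] at hy
        tauto
      rw [this, Function.update_self]
    · have hy' : y ∈ A ∨ y ∈ B := by
        have : y ≠ x := fun h => hyx (by rw [h])
        simp only [List.mem_append, List.mem_singleton] at hy
        tauto
      have := hA y hy'
      rw [Function.update_of_ne (by omega), Function.update_of_ne (by omega), h.ends y hy']
  bit i hi := by
    rw [hs]
    by_cases hix : i = x / 2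
    · rw [hix, Function.update_self]; omega
    · rw [Function.update_of_ne (by omega), Function.update_of_ne (by omega)]
      exact h.bit i hi

theorem Buffer.push_back {A B : List ℕ} {g m x : ℕ} (h : Buffer n A B (g + 1) m s)
    (hx : x < 2 * n) (hne : ∀ y, y ∈ A ∨ y ∈ B → y / 2 ≠ x / 2)
    (hA : ∀ y, y ∈ A ∨ y ∈ B → y < 2 * n)
    (hs : s'.nat = Function.update (Function.update s.nat (33 + 3 * n + (A.length + g)) (x / 2))
      (33 + 2 * n + x / 2) (x % 2)) : Buffer n A (x :: B) g m s' where
  length := by have := h.length; simp; omega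
  size := by
    rw [hs]
    simp (disch := omega) only [Function.update_of_ne]
    exact h.size
  front i y hy := by
    have := (List.getElem?_eq_some_iff.1 hy).1
    have hl := h.length
    rw [hs, Function.update_of_ne (by omega), Function.update_of_ne (by omega), h.front i y hy]
  back i y hy := by
    have hl := h.length
    rw [hs, Function.update_of_ne (by omega)]
    rcases i with _ | i
    · simp at hy
      rw [add_zero, Function.update_self, hy]
    · rw [List.getElem?_cons_succ] at hy
      rw [Function.update_of_ne (by omega), ← h.back i y hy]
      congr 1
      omega
  ends y hy := by
    rw [hs]
    by_cases hyx : y / 2 = x / 2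
    · have : y = x := by
        by_contra hne'
        refine hne y ?_ hyx
        simp only [List.mem_cons] at hy
        tauto
      rw [this, Function.update_self]
    · have hy' : y ∈ A ∨ y ∈ B := by
        have : y ≠ x := fun h => hyx (by rw [h])
        simp only [List.mem_cons] at hy
        tauto
      have := hA y hy'
      rw [Function.update_of_ne (by omega), Function.update_of_ne (by omega), h.ends y hy']
  bit i hi := by
    rw [hs]
    by_cases hix : i = x / 2
    · rw [hix, Function.update_self]; omega
    · rw [Function.update_of_ne (by omega), Function.update_of_ne (by omega)]
      exact h.bit i hi

theorem run_emit (h : Common k L d s) {i x a v : ℕ} (hx32 : x < 32) (hi : s.nat i = 33 + 3 * n + a)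
    (ha : a < n) (hx : s.nat x = v) (hv : v < 2 * n) : (emit i x).run s =
      ⟨Function.update (Function.update s.nat (33 + 3 * n + a) (v / 2)) (33 + 2 * n + v / 2)
        (v % 2), s.real⟩ := by
  have hseg : s.nat (33 + 4 * n + v) = v / 2 := h.seg v hv
  have e1 : 33 + 2 * n = 32 + 2 * n + 1 := by omega
  -- The parity of an item, which names its endpoint, is obtained by subtracting the looked-up half
  -- twice.
  have e2 : v - v / 2 - v / 2 = v % 2 := by omega
  have u1 : ∀ c, c < 32 → Function.update s.nat (33 + 3 * n + a) (v / 2) c = s.nat c :=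
    fun c hc => Function.update_of_ne (by omega) _ _
  have u2 : Function.update s.nat (33 + 3 * n + a) (v / 2) (33 + 4 * n + v) = v / 2 := by
    rw [Function.update_of_ne (by omega), hseg]
  simp only [emit, Prog.run, NatExpr.eval, hi, hx, h.n4, hseg, u1 4 (by omega),
    u1 19 (by omega), u1 x hx32, u2, h.n19, e2, ← e1]

end

end Imprecise

namespace Imprecise

open RealRAM

/-! ### Traceback through the table -/

section

variable {n k : ℕ} {L : Fin n → Seg} {d : Pt} {s s' : State}

/-- The invariant of the traceback at the table entry `r l u`, with `s₀` the state at its start. -/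
def TraceInv {n : ℕ} (k : ℕ) (L : Fin n → Seg) (d : Pt) (V : ℝ) (m : ℕ) (s₀ : State) (r : ℕ)
    (s : State) : Prop :=
  Common k L d s ∧ s.real = s₀.real ∧ s.nat 15 = s₀.nat 15 ∧ ∃ l u A B, l < 2 * n ∧ u < 2 * n ∧
    itemKey L d l ≠ itemKey L d u ∧
    (∀ x, x ∈ A ∨ x ∈ B → x < 2 * n ∧ itemKey L d l < itemKey L d x ∧
      itemKey L d u < itemKey L d x) ∧
    Completes (itemKey L d) (itemPt L) (2 * n) V r l u A B ∧
    (∀ r', r = r' + 1 → table (itemKey L d) (itemPt L) (2 * n) r' l u <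
      table (itemKey L d) (itemPt L) (2 * n) r l u) ∧
    s.nat 9 = r ∧ s.nat 10 = l ∧ s.nat 11 = u ∧ s.nat 7 = 4 * n + 2 + offset (2 * n) r l u ∧
    (∀ r', r = r' + 1 → s.nat 8 = 4 * n + 2 + offset (2 * n) r' 0 0) ∧
    s.nat 23 = 33 + 3 * n + A.length ∧ s.nat 24 = 33 + 3 * n + (A.length + (r + 1)) ∧
    Buffer n A B (r + 2) m s

/-- Strict improvement over the previous layer guarantees that the entry is a true extension and not
a copied value, so a `p` exists; `Extends.table_lt` passes strictness on to the next entry. All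
emitted items have keys above both current ends, hence no segment is emitted twice. -/
theorem exec_traceBody (hpar : ∀ i, det2 d (L i).a = det2 d (L i).b) {V : ℝ} {m r : ℕ}
    {s₀ : State} (hm : m ≤ n)
    (htab : ∀ x, x < offset (2 * n) (r + 2) 0 0 → s₀.real (4 * n + 2 + x) = entry L d x)
    (h : TraceInv k L d V m s₀ (r + 1) s) :
    Exec traceBody s (firstP.time + ((2 * n * ((cellLt 12 2).cost + 1 + searchBody.time) +
      ((cellLt 12 2).cost + 1)) + traceStep.time)) (TraceInv k L d V m s₀ r) := by
  obtain ⟨hC, hreal, h15, l, u, A, B, hl, hu, hne, hAB, hcomp, hstrict, h9, h10, h11, h7, h8, h23,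
    h24, hbuf⟩ := h
  have h8 := h8 r rfl
  have hstrict := hstrict r rfl
  have hlen := hbuf.length
  have hsucc := offset_succ_layer (2 * n) r l u
  refine Exec.seq (Q := fun s1 => (∀ c, c ∉ [12, 13, 14] → s1.nat c = s.nat c) ∧ s1.nat 12 = 0 ∧
      s1.nat 13 = 4 * n + 2 + offset (2 * n) r 0 u ∧
      s1.nat 14 = 4 * n + 2 + offset (2 * n) r l 0 ∧ s1.real = s₀.real)
    (Exec.of_loopFree (by simp [firstP, Prog.LoopFree]) ?_) ?_
  · have hrun : firstP.run s = ⟨Function.update (Function.update (Function.update s.nat 12 0) 13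
        (s.nat 8 + s.nat 11)) 14 (s.nat 7 - s.nat 3 - s.nat 11), s.real⟩ := by
      simp [firstP, Prog.run, NatExpr.eval]
    rw [hrun]
    refine ⟨?_, by simp, ?_, ?_, hreal⟩
    · intro c hc
      simp only [List.mem_cons, List.not_mem_nil, or_false, not_or] at hc
      simp only [Function.update_of_ne hc.1, Function.update_of_ne hc.2.1,
        Function.update_of_ne hc.2.2]
    · simp [h8, h11]; rw [offset_add _ _ 0 u]; ring
    · simp only [Function.update_self, h7, h11, hC.n3, hsucc]
      rw [offset_add _ r l u]; omega
  rintro s1 ⟨e0, e12, e13, e14, er⟩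
  have hC1 : Common k L d s1 := hC.frame (fun c hc => e0 c (by simp; omega))
    fun c _ => by rw [er, hreal]
  have hv : s1.real (s1.nat 7) = table (itemKey L d) (itemPt L) (2 * n) (r + 1) l u := by
    rw [er, e0 7 (by decide), h7, htab _ (offset_lt_layer hl hu), entry_offset hl hu]
  have hlay : offset (2 * n) (r + 2) 0 0 = offset (2 * n) (r + 1) 0 0 + 2 * n * (2 * n) :=
    offset_succ_layer (2 * n) (r + 1) 0 0
  refine Exec.seq (exec_searchLoop hC1 hpar (r := r) (l := l) (u := u)
    (by rw [e0 10 (by decide), h10]) (by rw [e0 11 (by decide), h11]) e12 hl hu e13 e14 hv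
    (fun x hx => by rw [er, htab _ (by omega)])
    ((relaxAll_eq _ l u (2 * n)).resolve_left hstrict.ne')) ?_
  rintro s2 ⟨f0, fr, p, hp, f21, hE, f22, f22'⟩
  have g0 : ∀ c, c ∉ [12, 13, 14, 21, 22] → s2.nat c = s.nat c := fun c hc => by
    rw [f0 c hc, e0 c (by simp at hc ⊢; omega)]
  have hC2 : Common k L d s2 := hC1.frame (fun c hc => f0 c (by simp; omega))
    fun c _ => by rw [fr]
  have hbuf2 : Buffer n A B (r + 1 + 2) m s2 :=
    hbuf.frame hm (fun x hx => (hAB x hx).1) fun c h1 _ => g0 c (by simp; omega)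
  have hr2 : s2.real = s₀.real := by rw [fr, er]
  have hseg : ∀ x, x < 2 * n → ∀ y, itemKey L d x < itemKey L d y → y / 2 ≠ x / 2 :=
    fun x hx y hlt h => hlt.ne ((itemKey_eq_iff hpar hx).2 h.symm)
  apply Exec.of_loopFree (by simp [traceStep, emit, Prog.LoopFree])
  have hcond : (keyLt (cell 11) (cell 10)).holds s2 ↔ itemKey L d u < itemKey L d l := by
    have e11 : (cell 11).eval s2 = u := (g0 11 (by decide)).trans h11
    have e10 : (cell 10).eval s2 = l := (g0 10 (by decide)).trans h10
    rw [hC2.holds_keyLt (by rw [e11]; exact hu) (by rw [e10]; exact hl), e10, e11]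
  rw [traceStep, Prog.run_seq, Prog.run_branch, hcond]
  split_ifs with hlt
  · obtain ⟨k1, k2, k3, k4⟩ := hE.resolve_right fun hh => absurd hh.1 hlt.not_gt
    set f := Function.update (Function.update s2.nat (33 + 3 * n + (A.length + (r + 2))) (l / 2))
      (33 + 2 * n + l / 2) (l % 2) with hf
    have hf32 : ∀ c, c < 32 → f c = s2.nat c := fun c hc => by
      rw [hf, Function.update_of_ne (by omega), Function.update_of_ne (by omega)]
    have hemit : (emit 24 10).run s2 = ⟨f, s2.real⟩ :=
      run_emit hC2 (by omega) (by rw [g0 24 (by decide), h24]) (by omega)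
        (by rw [g0 10 (by decide), h10]) hl
    have hrun : (Prog.seq (.setNat (.const 7) (cell 22))
        (.seq (.setNat (.const 8) (.sub (cell 8) (cell 3)))
        (.setNat (.const 9) (.sub (cell 9) (.const 1))))).run
        ((Prog.seq (emit 24 10) (.seq (.setNat (.const 24) (.sub (cell 24) (.const 1)))
        (.setNat (.const 10) (cell 21)))).run s2) = ⟨Function.update (Function.update
          (Function.update (Function.update (Function.update f 24 (f 24 - 1)) 10 (f 21)) 7 (f 22))
          8 (f 8 - f 3)) 9 (f 9 - 1), s2.real⟩ := by
      rw [Prog.run_seq (emit 24 10), hemit]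
      simp [Prog.run, NatExpr.eval]
    rw [hrun]
    have hpush : Buffer n A (l :: B) (r + 2) m ⟨f, s2.real⟩ :=
      hbuf2.push_back hl (fun y hy => hseg l hl y (hAB y hy).2.1) (fun y hy => (hAB y hy).1) rfl
    have hAB' : ∀ x, x ∈ A ∨ x ∈ l :: B → x < 2 * n ∧ itemKey L d p < itemKey L d x ∧
        itemKey L d u < itemKey L d x := by
      intro x hx
      rw [List.mem_cons] at hx
      by_cases hxl : x = l
      · subst hxl; exact ⟨hl, k2, k1⟩
      · obtain ⟨q1, q2, q3⟩ := hAB x (by tauto)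
        exact ⟨q1, k2.trans q2, q3⟩
    refine ⟨hC2.frame ?_ fun _ _ => rfl, hr2, ?_, p, u, A, l :: B, hp, hu, k3, hAB',
      hcomp.snoc hl k1 k2 k4, ?_, ?_, ?_, ?_, ?_, ?_, ?_, ?_, ?_⟩
    · intro c hc
      have hseg' := hC2.seg
      simp (disch := omega) only [Function.update_of_ne]
      rw [hf]
      simp (disch := omega) only [Function.update_of_ne]
    · simp [hf32 15, g0 15, h15]
    · rintro r' rfl
      exact (hE.table_lt hp hstrict).1 k1
    · simp [hf32 9, g0 9, h9]
    · simp [hf32 21, f21]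
    · simp [hf32 11, g0 11, h11]
    · simp [hf32 22, f22 k1]
    · rintro r' rfl
      have := offset_succ_layer (2 * n) r' 0 0
      simp [hf32 8, g0 8, h8, hf32 3, hC2.n3]
      omega
    · simp [hf32 23, g0 23, h23]
    · simp [hf32 24, g0 24, h24]; omega
    · refine hpush.frame hm (fun x hx => (hAB' x hx).1) fun c _ _ => ?_
      simp (disch := omega) only [Function.update_of_ne]
  · have hlt' : itemKey L d l < itemKey L d u := lt_of_le_of_ne (not_lt.1 hlt) hne
    obtain ⟨k1, k2, k3, k4⟩ := hE.resolve_left fun hh => absurd hh.1 hlt'.not_gt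
    set f := Function.update (Function.update s2.nat (33 + 3 * n + A.length) (u / 2))
      (33 + 2 * n + u / 2) (u % 2) with hf
    have hf32 : ∀ c, c < 32 → f c = s2.nat c := fun c hc => by
      rw [hf, Function.update_of_ne (by omega), Function.update_of_ne (by omega)]
    have hemit : (emit 23 11).run s2 = ⟨f, s2.real⟩ :=
      run_emit hC2 (by omega) (by rw [g0 23 (by decide), h23]) (by omega)
        (by rw [g0 11 (by decide), h11]) hu
    have hrun : (Prog.seq (.setNat (.const 7) (cell 22))
        (.seq (.setNat (.const 8) (.sub (cell 8) (cell 3)))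
        (.setNat (.const 9) (.sub (cell 9) (.const 1))))).run
        ((Prog.seq (emit 23 11) (.seq (incr 23) (.setNat (.const 11) (cell 21)))).run s2) =
          ⟨Function.update (Function.update
          (Function.update (Function.update (Function.update f 23 (f 23 + 1)) 11 (f 21)) 7 (f 22))
          8 (f 8 - f 3)) 9 (f 9 - 1), s2.real⟩ := by
      rw [Prog.run_seq (emit 23 11), hemit]
      simp [Prog.run, NatExpr.eval]
    rw [hrun]
    have hpush : Buffer n (A ++ [u]) B (r + 2) m ⟨f, s2.real⟩ :=
      hbuf2.push_front hu (fun y hy => hseg u hu y (hAB y hy).2.2) (fun y hy => (hAB y hy).1) rfl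
    have hAB' : ∀ x, x ∈ A ++ [u] ∨ x ∈ B → x < 2 * n ∧ itemKey L d l < itemKey L d x ∧
        itemKey L d p < itemKey L d x := by
      intro x hx
      rw [List.mem_append, List.mem_singleton] at hx
      by_cases hxl : x = u
      · subst hxl; exact ⟨hu, k1, k2⟩
      · obtain ⟨q1, q2, q3⟩ := hAB x (by tauto)
        exact ⟨q1, q2, k2.trans q3⟩
    refine ⟨hC2.frame ?_ fun _ _ => rfl, hr2, ?_, l, p, A ++ [u], B, hl, hp, k3.symm, hAB',
      hcomp.cons hu k1 k2 k4, ?_, ?_, ?_, ?_, ?_, ?_, ?_, ?_, ?_⟩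
    · intro c hc
      simp (disch := omega) only [Function.update_of_ne]
      rw [hf]
      simp (disch := omega) only [Function.update_of_ne]
    · simp [hf32 15, g0 15, h15]
    · rintro r' rfl
      exact (hE.table_lt hp hstrict).2 k1
    · simp [hf32 9, g0 9, h9]
    · simp [hf32 10, g0 10, h10]
    · simp [hf32 21, f21]
    · simp [hf32 22, f22' k1]
    · rintro r' rfl
      have := offset_succ_layer (2 * n) r' 0 0
      simp [hf32 8, g0 8, h8, hf32 3, hC2.n3]
      omega
    · simp [hf32 23, g0 23, h23]; omega
    · simp [hf32 24, g0 24, h24]; omega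
    · refine hpush.frame hm (fun x hx => (hAB' x hx).1) fun c _ _ => ?_
      simp (disch := omega) only [Function.update_of_ne]

end

end Imprecise

namespace Imprecise

open RealRAM

/-! ### Optimality of the stored result -/

section

variable {n k : ℕ} {L : Fin n → Seg} {d : Pt} {s s' : State}

theorem offset_mono (N : ℕ) {r r' : ℕ} (h : r ≤ r') : offset N r 0 0 ≤ offset N r' 0 0 := by
  simp only [offset, add_zero]
  gcongr

/-- An optimal solution is stored in the output buffer. -/
def HasResult {n : ℕ} (k : ℕ) (L : Fin n → Seg) (s : State) : Prop :=
  s.nat 2 = 2 * n ∧ s.nat 19 = 32 + 2 * n ∧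
  ∃ (e : Fin n → Bool) (m : ℕ) (σ : Fin m → Fin n), m ≤ n ∧ s.nat (32 + 2 * n) = m ∧
    (∀ i : Fin n, s.nat (33 + 2 * n + i) = (e i).toNat) ∧
    (∀ j : Fin m, s.nat (33 + 3 * n + j) = σ j) ∧
    s.real 0 = area (endpointPlacement L e ∘ σ) ∧
    IsOptimalSolution L k (endpointPlacement L e) σ

theorem Buffer.hasResult {A B : List ℕ} {m : ℕ} (h : Buffer n A B 0 m s) (hm : m ≤ n)
    (h2 : s.nat 2 = 2 * n) (h19 : s.nat 19 = 32 + 2 * n) (hN : ∀ x ∈ A ++ B, x < 2 * n)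
    (hopt : ∀ (e : Fin n → Bool) (σ : Fin (A ++ B).length → Fin n),
      (∀ j : Fin (A ++ B).length, (A ++ B)[j] = 2 * (σ j : ℕ) + (e (σ j)).toNat) →
      IsOptimalSolution L k (endpointPlacement L e) σ ∧
        s.real 0 = area (endpointPlacement L e ∘ σ)) : HasResult k L s := by
  have hlen : (A ++ B).length = m := by have := h.length; simp; omega
  have hmem : ∀ j : Fin (A ++ B).length, (A ++ B)[j] ∈ A ++ B := fun j => List.getElem_mem _
  have hlt : ∀ j : Fin (A ++ B).length, (A ++ B)[j] / 2 < n := fun j => by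
    have := hN _ (hmem j)
    omega
  have hbit : ∀ i : Fin n, s.nat (33 + 2 * n + i) =
      (decide (s.nat (33 + 2 * n + i) = 1)).toNat := by
    intro i
    have := h.bit i i.2
    interval_cases s.nat (33 + 2 * n + i) <;> rfl
  obtain ⟨h3, h4⟩ := hopt (fun i => decide (s.nat (33 + 2 * n + i) = 1))
    (fun j => ⟨(A ++ B)[j] / 2, hlt j⟩) (by
      intro j
      have h5 := h.ends _ (List.mem_append.1 (hmem j))
      have h6 := hbit ⟨(A ++ B)[j] / 2, hlt j⟩
      simp only at h6
      change (A ++ B)[j] = 2 * ((A ++ B)[j] / 2) +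
        (decide (s.nat (33 + 2 * n + (A ++ B)[j] / 2) = 1)).toNat
      rw [← h6, h5]
      omega)
  refine ⟨h2, h19, _, _, _, hlen.trans_le hm, by rw [h.size, hlen], hbit, ?_, h4, h3⟩
  intro j
  simp only
  have hj : (A ++ B)[(j : ℕ)]? = some (A ++ B)[j] := List.getElem?_eq_getElem j.2
  rcases lt_or_ge (j : ℕ) A.length with hjA | hjA
  · rw [List.getElem?_append_left hjA] at hj
    exact h.front _ _ hj
  · rw [List.getElem?_append_right hjA] at hj
    rw [← h.back _ _ hj]
    congr 2
    omega

theorem Valley.shoelace_le {V : ℝ} {r : ℕ} (h0 : 0 ≤ V)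
    (hV : ∀ l u, l < 2 * n → u < 2 * n → table (itemKey L d) (itemPt L) (2 * n) r l u ≤ V)
    {Q : List ℕ} (hQ : Valley (itemKey L d) Q) (hN : ∀ q ∈ Q, q < 2 * n)
    (hr : Q.length ≤ r + 2) : shoelace (Q.map (itemPt L)) ≤ V := by
  rcases Nat.lt_or_ge Q.length 2 with h | h
  · rcases Q with _ | ⟨a, _ | ⟨b, Q⟩⟩
    · simpa [shoelace] using h0
    · simpa using h0
    · simp at h
  · have hne : Q ≠ [] := by rintro rfl; simp at h
    exact (hQ.shoelace_le_table hN (List.head?_eq_some_head hne)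
      (List.getLast?_eq_some_getLast hne) h hr).trans
      (hV _ _ (hN _ (List.getLast_mem hne)) (hN _ (List.head_mem hne)))

/-- A record in layer 0 means that no valley has positive value. The untouched zeros of the buffer
already encode the first endpoints and segment 0 as the only vertex. -/
theorem exec_pointProg (hd : d ≠ 0) (hpar : ∀ i, det2 d (L i).a = det2 d (L i).b) (hk : 1 ≤ k)
    (hkn : k ≤ n) (h : TableInv k L d (offset (2 * n) (k - 2 + 1) 0 0) s) (h16 : s.nat 16 = 0) :
    Exec pointProg s pointProg.time (HasResult k L) := by
  apply Exec.of_loopFree (by simp [pointProg, Prog.LoopFree])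
  have hC := h.common
  obtain ⟨br, bl, bu, -, -, -, b16, -, -, -, -, -, bmax, -⟩ := h.best
  obtain rfl : br = 0 := by omega
  have hrun : pointProg.run s = ⟨Function.update s.nat (32 + 2 * n) 1,
      Function.update s.real 0 0⟩ := by
    simp [pointProg, Prog.run, NatExpr.eval, RealExpr.eval, hC.n19]
  have hopt := isOptimalSolution_of_nonpos hd hpar hk (fun Q hQ hN hlen =>
    hQ.shoelace_le (r := k - 2) le_rfl (fun l u hl hu => by
      rw [← entry_offset hl hu]
      exact bmax _ (offset_lt_layer hl hu)) hN (by omega)) (fun _ => false)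
      (fun _ => (⟨0, by omega⟩ : Fin n))
  rw [hrun]
  refine ⟨?_, ?_, _, 1, _, by omega, ?_, ?_, ?_, ?_, hopt.1⟩
  · simp (disch := omega) only [Function.update_of_ne]
    exact hC.n2
  · simp (disch := omega) only [Function.update_of_ne]
    exact hC.n19
  · simp
  · intro i
    have := i.2
    simp (disch := omega) only [Function.update_of_ne]
    rw [h.zero _ (by omega) (by omega)]
    rfl
  · intro j
    simp (disch := omega) only [Function.update_of_ne]
    rw [h.zero _ (by omega) (by omega)]
  · rw [hopt.2]
    simp

/-- The record lies in layer `b + 1` and strictly exceeds layer `b`, so the traced valley has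
exactly `b + 3` entries and beats every shorter one, as `isOptimalSolution_of_valley` demands. -/
theorem exec_traceProg (hd : d ≠ 0) (hpar : ∀ i, det2 d (L i).a = det2 d (L i).b)
    (hkn : k ≤ n) (h : TableInv k L d (offset (2 * n) (k - 2 + 1) 0 0) s) (h16 : s.nat 16 ≠ 0) :
    Exec traceProg s (traceInit.time + ((k * ((Cond.neg (.natLe (cell 9) (.const 0))).cost + 1 +
      (firstP.time + ((2 * n * ((cellLt 12 2).cost + 1 + searchBody.time) +
        ((cellLt 12 2).cost + 1)) + traceStep.time))) +
      ((Cond.neg (.natLe (cell 9) (.const 0))).cost + 1)) + traceEnd.time)) (HasResult k L) := by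
  have hC := h.common
  obtain ⟨br, bl, bu, hbl, hbu, b15, b16, b17, b18, b20, bx, bk, bmax, bprev⟩ := h.best
  obtain ⟨b, rfl⟩ : ∃ b, br = b + 1 := ⟨br - 1, by omega⟩
  have hbk : b + 3 ≤ k := by omega
  set V := table (itemKey L d) (itemPt L) (2 * n) (b + 1) bl bu with hV
  have hstrict : table (itemKey L d) (itemPt L) (2 * n) b bl bu < V := by
    rw [← entry_offset hbl hbu]
    exact bprev _ (offset_lt_layer hbl hbu)
  have hne : itemKey L d bl ≠ itemKey L d bu := by
    obtain ⟨p, -, hE⟩ := (relaxAll_eq (table (itemKey L d) (itemPt L) (2 * n) b) bl bu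
      (2 * n)).resolve_left hstrict.ne'
    rcases hE with hE | hE
    · exact hE.1.ne'
    · exact hE.1.ne
  have hV0 : 0 < V := by
    have := bprev (offset (2 * n) 0 bl bu) ((offset_lt_layer hbl hbu).trans_le
      (offset_mono _ (by omega)))
    rw [entry_offset hbl hbu] at this
    exact this
  refine Exec.seq (Q := TraceInv k L d V (b + 3) s (b + 1))
    (Exec.of_loopFree (by simp [traceInit, Prog.LoopFree]) ?_) fun s1 hs1 =>
    Exec.seq ((Exec.loop (M := b + 1) (fun t => TraceInv k L d V (b + 3) s (b + 1 - t)) ?_ ?_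
      hs1).mono (by gcongr; omega) fun _ h => h) ?_
  · set f := Function.update s.nat (32 + 2 * n) (b + 3) with hf
    have hf32 : ∀ c, c < 32 → f c = s.nat c := fun c hc => by
      rw [hf, Function.update_of_ne (by omega)]
    have hrun : traceInit.run s = ⟨Function.update (Function.update (Function.update
        (Function.update (Function.update (Function.update (Function.update f 9 (f 16)) 10 (f 17))
        11 (f 18)) 7 (f 15)) 8 (f 20)) 23 (f 19 + 1 + f 0)) 24 (f 19 + 1 + f 0 + f 16 + 1),
        s.real⟩ := by
      rw [traceInit, Prog.run_seq]
      have : (Prog.setNat (cell 19) (.add (cell 16) (.const 2))).run s = ⟨f, s.real⟩ := by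
        simp only [Prog.run, NatExpr.eval, hC.n19, b16]
        rfl
      rw [this]
      simp [Prog.run, NatExpr.eval]
    rw [hrun]
    refine ⟨hC.frame ?_ fun _ _ => rfl, rfl, ?_, bl, bu, [], [], hbl, hbu, hne, by simp, ?_, ?_,
      ?_, ?_, ?_, ?_, ?_, ?_, ?_, ⟨by simp, ?_, by simp, by simp, by simp, ?_⟩⟩
    · intro c hc
      simp (disch := omega) only [Function.update_of_ne]
      rw [hf, Function.update_of_ne (by omega)]
    · simp [hf32 15]
    · intro Q hQ hN _ _ _ hs
      simpa using ⟨hQ, hN, hs⟩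
    · intro r' hr'
      obtain rfl : r' = b := by omega
      exact hstrict
    · simp [hf32 16, b16]
    · simp [hf32 17, b17]
    · simp [hf32 18, b18]
    · simp [hf32 15, b15]
    · intro r' hr'
      obtain rfl : r' = b := by omega
      simpa [hf32 20] using b20 (by omega)
    · simp [hf32 19, hf32 0, hC.n19, hC.n0]; ring
    · simp [hf32 19, hf32 0, hf32 16, hC.n19, hC.n0, b16]; ring
    · simp (disch := omega) only [Function.update_of_ne]
      rw [hf, Function.update_self]
    · intro i hi
      simp (disch := omega) only [Function.update_of_ne]
      rw [hf, Function.update_of_ne (by omega), h.zero _ (by omega) (by omega)]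
      omega
  · intro t ht s2 hs2
    refine ⟨?_, ?_⟩
    · obtain ⟨-, -, -, l, u, A, B, -, -, -, -, -, -, h9, -⟩ := hs2
      simp only [Cond.holds, NatExpr.eval, h9]
      omega
    · obtain ⟨r, hr⟩ : ∃ r, b + 1 - t = r + 1 := ⟨b - t, by omega⟩
      rw [hr] at hs2
      have hr' : b + 1 - (t + 1) = r := by omega
      rw [hr']
      exact exec_traceBody hpar (by omega) (fun x hx => h.filled x (hx.trans_le
        (offset_mono _ (by omega)))) hs2
  · intro s2 hs2
    rw [Nat.sub_self] at hs2
    obtain ⟨-, -, -, l, u, A, B, -, -, -, -, -, -, h9, -⟩ := hs2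
    simp [Cond.holds, NatExpr.eval, h9]
  · rintro s2 hs2
    rw [Nat.sub_self] at hs2
    obtain ⟨hC2, hreal, h15, l, u, A, B, hl, hu, hlu, hAB, hcomp, -, -, h10, h11, -, -, h23,
      h24, hbuf⟩ := hs2
    have hlen := hbuf.length
    have hseg : ∀ x, x < 2 * n → ∀ y, itemKey L d x ≠ itemKey L d y → y / 2 ≠ x / 2 :=
      fun x hx y hne h => hne ((itemKey_eq_iff hpar hx).2 h.symm)
    apply Exec.of_loopFree (by simp [traceEnd, emit, Prog.LoopFree])
    set f := Function.update (Function.update s2.nat (33 + 3 * n + A.length) (u / 2))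
      (33 + 2 * n + u / 2) (u % 2) with hf
    have hf32 : ∀ c, c < 32 → f c = s2.nat c := fun c hc => by
      rw [hf, Function.update_of_ne (by omega), Function.update_of_ne (by omega)]
    have hemit : (emit 23 11).run s2 = ⟨f, s2.real⟩ :=
      run_emit hC2 (by omega) h23 (by omega) h11 hu
    have hC3 : Common k L d ⟨f, s2.real⟩ := hC2.frame (fun c hc => by
      simp only [hf]
      simp (disch := omega) only [Function.update_of_ne]) fun _ _ => rfl
    set g := Function.update (Function.update f (33 + 3 * n + (A.length + 1)) (l / 2))
      (33 + 2 * n + l / 2) (l % 2) with hg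
    have hg32 : ∀ c, c < 32 → g c = s2.nat c := fun c hc => by
      rw [hg, Function.update_of_ne (by omega), Function.update_of_ne (by omega), hf32 c hc]
    have hemit' : (emit 24 10).run ⟨f, s2.real⟩ = ⟨g, s2.real⟩ :=
      run_emit hC3 (by omega) ((hf32 24 (by omega)).trans h24) (by omega)
        ((hf32 10 (by omega)).trans h10) hl
    have hrun : traceEnd.run s2 = ⟨g, Function.update s2.real 0 (V / 2)⟩ := by
      rw [traceEnd, Prog.run_seq, hemit, Prog.run_seq, hemit']
      have : s2.real (g 15) = V := by
        rw [hg32 15 (by omega), h15, b15, hreal, h.filled _ bx, entry_offset hbl hbu]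
      simp only [Prog.run, NatExpr.eval, RealExpr.eval, this]
      norm_num [div_eq_mul_inv]
    rw [hrun]
    have hb1 : Buffer n (A ++ [u]) B 1 (b + 3) ⟨f, s2.real⟩ := hbuf.push_front hu
      (fun y hy => hseg u hu y (hAB y hy).2.2.ne) (fun y hy => (hAB y hy).1) rfl
    have hb2 : Buffer n (A ++ [u]) (l :: B) 0 (b + 3)
        ⟨g, Function.update s2.real 0 (V / 2)⟩ := by
      refine hb1.push_back hl ?_ ?_ (by simp [hg])
      · intro y hy
        by_cases hyu : y = u
        · subst hyu; exact hseg l hl y hlu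
        · simp only [List.mem_append, List.mem_singleton] at hy
          exact hseg l hl y (hAB y (by tauto)).2.1.ne
      · intro y hy
        by_cases hyu : y = u
        · subst hyu; exact hu
        · simp only [List.mem_append, List.mem_singleton] at hy
          exact (hAB y (by tauto)).1
    -- At layer 0 the gap is filled by the two remaining ends, whose sum is zero; this discharges
    -- the continuation `hcomp`.
    have hQ2 : Valley (itemKey L d) [u, l] := by
      simp [Valley, hlu.symm]
    have hQ := hcomp [u, l] hQ2 (by simp [hl, hu]) rfl rfl rfl (by simp [table])
    have hQeq : A ++ [u, l] ++ B = A ++ [u] ++ (l :: B) := by simp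
    rw [hQeq] at hQ
    obtain ⟨hQv, hQN, hQs⟩ := hQ
    have hQlen : (A ++ [u] ++ (l :: B)).length = b + 3 := by simp; omega
    refine hb2.hasResult (by omega) (by rw [← hC2.n2]; exact hg32 2 (by omega))
      (by rw [← hC2.n19]; exact hg32 19 (by omega)) hQN fun e σ hσ => ?_
    have hfin := isOptimalSolution_of_valley hd hpar (k := k) hQv hQN (by omega) (by omega) ?_ ?_ hσ
    · refine ⟨hfin.1, ?_⟩
      rw [hfin.2, hQs]
      simp
    · intro Q' h1 h2 h3
      rw [hQs]
      refine h1.shoelace_le (r := k - 2) hV0.le (fun l u hl hu => ?_) h2 (by omega)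
      rw [← entry_offset hl hu]
      exact bmax _ (offset_lt_layer hl hu)
    -- Fewer than `b + 3` entries means a bound by layer `b`, or by zero for lists that are too
    -- short for the table; both are below `V`.
    · intro Q' h1 h2 h3
      rw [hQs]
      rcases Nat.lt_or_ge Q'.length 2 with h | h
      · exact (h1.shoelace_le (r := 0) le_rfl (fun _ _ _ _ => le_rfl) h2 (by omega)).trans_lt hV0
      · have hne : Q' ≠ [] := by rintro rfl; simp at h
        refine (h1.shoelace_le_table (r := b) h2 (List.head?_eq_some_head hne)
          (List.getLast?_eq_some_getLast hne) h (by omega)).trans_lt ?_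
        have hl' := h2 _ (List.getLast_mem hne)
        have hu' := h2 _ (List.head_mem hne)
        rw [← entry_offset hl' hu']
        exact bprev _ (offset_lt_layer hl' hu')

end

end Imprecise

namespace Imprecise

open RealRAM

/-! ### Preprocessing, copying the output, and the whole program -/

section

variable {n k : ℕ} {L : Fin n → Seg} {d : Pt} {s s' : State}

/-- The state after the preprocessing of `i` segments. -/
structure SegInv (k : ℕ) (L : Fin n → Seg) (i : ℕ) (s : State) : Prop where
  n0 : s.nat 0 = n
  n1 : s.nat 1 = k
  n2 : s.nat 2 = 2 * n
  n3 : s.nat 3 = i * (2 * (2 * n))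
  n4 : s.nat 4 = 33 + 4 * n
  n5 : s.nat 5 = 4 * n
  n6 : s.nat 6 = i
  n19 : s.nat 19 = 32 + 2 * n
  n16 : s.nat 16 = 0
  n17 : s.nat 17 = 0
  n18 : s.nat 18 = 0
  seg : ∀ x, x < 2 * i → s.nat (33 + 4 * n + x) = x / 2
  buffer : ∀ c, 32 + 2 * n ≤ c → c < 33 + 4 * n → s.nat c = 0
  input : ∀ c, c < 4 * n → s.real c = (inputState L k).real c
  zero : ∀ c, 4 * n + 2 ≤ c → s.real c = 0
  dir : ∃ d : Pt, d ≠ 0 ∧ s.real (4 * n) = d.1 ∧ s.real (4 * n + 1) = d.2 ∧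
    ((∀ j : Fin n, (j : ℕ) < i → (L j).a = (L j).b) ∨ ∃ j : Fin n, d = (L j).b - (L j).a)

theorem inputState_real (L : Fin n → Seg) (k : ℕ) (i : Fin n) {r : ℕ} (hr : r < 4) :
    (inputState L k).real (4 * i + r) = (L i).coord r := by
  have h1 : (4 * (i : ℕ) + r) / 4 = i := by omega
  have h2 : (4 * (i : ℕ) + r) % 4 = r := by omega
  simp [inputState, h1, h2]

theorem segInv_setup (L : Fin n → Seg) (k : ℕ) :
    SegInv k L 0 (setup.run (inputState L k)) := by
  have hrun : setup.run (inputState L k) =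
      ⟨Function.update (Function.update (Function.update (Function.update (inputState L k).nat 2
        (2 * n)) 5 (4 * n)) 19 (32 + 2 * n)) 4 (33 + 4 * n),
        Function.update (inputState L k).real (4 * n + 1) 1⟩ := by
    have h0 : (inputState L k).nat 0 = n := rfl
    simp [setup, Prog.run, NatExpr.eval, RealExpr.eval, h0, ← two_mul, ← mul_assoc]
  have hz : ∀ c, 4 * n ≤ c → (inputState L k).real c = 0 := fun c hc => by
    simp only [inputState]
    rw [dif_neg (by omega)]
  have hz' : ∀ c, 2 ≤ c → (inputState L k).nat c = 0 := fun c hc => by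
    simp only [inputState]
    rw [if_neg (by omega), if_neg (by omega)]
  rw [hrun]
  constructor
  case dir =>
    -- A default direction, kept only if all segments are points, in which case any nonzero
    -- direction works.
    refine ⟨(0, 1), by simp, ?_, by simp, Or.inl fun j hj => absurd hj (by omega)⟩
    simp (disch := omega) [hz]
  case input =>
    intro c hc
    simp (disch := omega) only [Function.update_of_ne]
  case zero =>
    intro c hc
    simp (disch := omega) only [Function.update_of_ne]
    exact hz c (by omega)
  case buffer =>
    intro c hc hc'
    simp (disch := omega) only [Function.update_of_ne]
    exact hz' c (by omega)
  case seg => intro x hx; omega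
  all_goals simp [inputState]

theorem SegInv.eval_coord {i : ℕ} (h : SegInv k L i s) (hi : i < n) {r : ℕ} (hr : r < 4) :
    (coordE r).eval s = (L ⟨i, hi⟩).coord r := by
  rw [← inputState_real L k ⟨i, hi⟩ hr, ← h.input _ (by simp only; omega)]
  simp only [RealExpr.eval, NatExpr.eval, h.n6]
  congr 1
  omega

theorem SegInv.holds_degenerate {i : ℕ} (h : SegInv k L i s) (hi : i < n) :
    degenerateC.holds s ↔ (L ⟨i, hi⟩).a = (L ⟨i, hi⟩).b := by
  have h1 : degenerateC.holds s ↔ ((coordE 0).eval s ≤ (coordE 2).eval s ∧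
    (coordE 2).eval s ≤ (coordE 0).eval s) ∧ ((coordE 1).eval s ≤ (coordE 3).eval s ∧
    (coordE 3).eval s ≤ (coordE 1).eval s) := Iff.rfl
  rw [h1, h.eval_coord hi (by norm_num), h.eval_coord hi (by norm_num),
    h.eval_coord hi (by norm_num), h.eval_coord hi (by norm_num), ← le_antisymm_iff,
    ← le_antisymm_iff, Prod.ext_iff]
  rfl

theorem segInv_segBody {i : ℕ} (h : SegInv k L i s) (hi : i < n) :
    SegInv k L (i + 1) (segBody.run s) := by
  set f : ℕ → ℕ := Function.update (Function.update (Function.update s.nat 3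
    ((i + 1) * (2 * (2 * n)))) (33 + 4 * n + 2 * i) i) (33 + 4 * n + (2 * i + 1)) i with hf
  have hlow : ∀ c, c ≠ 3 → c < 33 + 4 * n → f c = s.nat c := fun c h3 hc => by
    rw [hf]
    simp (disch := omega) only [Function.update_of_ne]
  have hrun : segBody.run s = (Prog.seq
      (.branch degenerateC .skip
        (.seq (.setReal (cell 5) (.sub (coordE 2) (coordE 0)))
          (.setReal (.add (cell 5) (.const 1)) (.sub (coordE 3) (coordE 1)))))
      (incr 6)).run ⟨f, s.real⟩ := by
    have e1 : (⟨f, s.real⟩ : State) = (Prog.setNat (.add (cell 4) (.add (.add (cell 6) (cell 6))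
        (.const 1))) (cell 6)).run ((Prog.setNat (.add (cell 4) (.add (cell 6) (cell 6)))
        (cell 6)).run ((Prog.setNat (.const 3) (.add (.add (cell 3) (cell 2)) (cell 2))).run
        s)) := by
      simp (disch := omega) only [Prog.run, NatExpr.eval, Function.update_of_ne, h.n4, h.n6, h.n3,
        h.n2, ← two_mul]
      rw [hf]
      congr 4
      ring
    rw [e1]
    rfl
  have hbase : ∀ g : ℕ → ℝ, (∀ c, c < 4 * n ∨ 4 * n + 2 ≤ c → g c = s.real c) →
      (∃ d : Pt, d ≠ 0 ∧ g (4 * n) = d.1 ∧ g (4 * n + 1) = d.2 ∧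
        ((∀ j : Fin n, (j : ℕ) < i + 1 → (L j).a = (L j).b) ∨
          ∃ j : Fin n, d = (L j).b - (L j).a)) →
      SegInv k L (i + 1) ((incr 6).run ⟨f, g⟩) := by
    intro g hg hdir
    have hrun' : (incr 6).run ⟨f, g⟩ = ⟨Function.update f 6 (i + 1), g⟩ := by
      simp only [Prog.run, NatExpr.eval, hlow 6 (by omega) (by omega), h.n6]
    have hlow' : ∀ c, c ≠ 3 → c ≠ 6 → c < 33 + 4 * n →
        Function.update f 6 (i + 1) c = s.nat c := fun c h3 h6 hc => by
      rw [Function.update_of_ne h6, hlow c h3 hc]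
    rw [hrun']
    constructor
    case n3 => simp (disch := omega) [hf]
    case n6 => simp
    case dir => exact hdir
    case input => exact fun c hc => (hg c (.inl hc)).trans (h.input c hc)
    case zero => exact fun c hc => (hg c (.inr hc)).trans (h.zero c hc)
    case buffer =>
      intro c hc hc'
      simp only
      rw [hlow' c (by omega) (by omega) hc', h.buffer c hc hc']
    case seg =>
      intro x hx
      simp only
      rw [Function.update_of_ne (by omega), hf]
      rcases lt_trichotomy x (2 * i) with h1 | h1 | h1
      · simp (disch := omega) only [Function.update_of_ne]
        exact h.seg x h1
      · subst h1
        rw [Function.update_of_ne (by omega), Function.update_self]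
        omega
      · obtain rfl : x = 2 * i + 1 := by omega
        rw [Function.update_self]
        omega
    case n0 => exact (hlow' _ (by omega) (by omega) (by omega)).trans h.n0
    case n1 => exact (hlow' _ (by omega) (by omega) (by omega)).trans h.n1
    case n2 => exact (hlow' _ (by omega) (by omega) (by omega)).trans h.n2
    case n4 => exact (hlow' _ (by omega) (by omega) (by omega)).trans h.n4
    case n5 => exact (hlow' _ (by omega) (by omega) (by omega)).trans h.n5
    case n19 => exact (hlow' _ (by omega) (by omega) (by omega)).trans h.n19
    case n16 => exact (hlow' _ (by omega) (by omega) (by omega)).trans h.n16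
    case n17 => exact (hlow' _ (by omega) (by omega) (by omega)).trans h.n17
    case n18 => exact (hlow' _ (by omega) (by omega) (by omega)).trans h.n18
  have h6 : f 6 = s.nat 6 := hlow 6 (by omega) (by omega)
  have h5 : f 5 = 4 * n := (hlow 5 (by omega) (by omega)).trans h.n5
  have hc : ∀ r, r < 4 → ∀ v : ℝ, (coordE r).eval ⟨f, s.real⟩ = (L ⟨i, hi⟩).coord r ∧
      (coordE r).eval ⟨f, Function.update s.real (4 * n) v⟩ = (L ⟨i, hi⟩).coord r := by
    intro r hr v
    rw [← h.eval_coord hi hr]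
    simp only [RealExpr.eval, NatExpr.eval, h6, h.n6, true_and]
    rw [Function.update_of_ne (by omega)]
  rw [hrun, Prog.run_seq, Prog.run_branch]
  have hdeg : degenerateC.holds ⟨f, s.real⟩ ↔ (L ⟨i, hi⟩).a = (L ⟨i, hi⟩).b := by
    rw [← h.holds_degenerate hi]
    simp only [degenerateC, Cond.holds, RealExpr.eval, NatExpr.eval, h6]
  split_ifs with hd
  · rw [hdeg] at hd
    refine hbase _ (fun _ _ => rfl) ?_
    obtain ⟨d, hd0, h1, h2, h3⟩ := h.dir
    refine ⟨d, hd0, h1, h2, h3.imp_left fun h4 j hj => ?_⟩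
    rcases Nat.lt_succ_iff_lt_or_eq.1 hj with h5 | h5
    · exact h4 j h5
    · obtain rfl : j = ⟨i, hi⟩ := Fin.ext h5
      exact hd
  · rw [hdeg] at hd
    have hrun2 : (Prog.seq (.setReal (cell 5) (.sub (coordE 2) (coordE 0)))
        (.setReal (.add (cell 5) (.const 1)) (.sub (coordE 3) (coordE 1)))).run ⟨f, s.real⟩ =
        ⟨f, Function.update (Function.update s.real (4 * n) ((L ⟨i, hi⟩).b - (L ⟨i, hi⟩).a).1)
          (4 * n + 1) ((L ⟨i, hi⟩).b - (L ⟨i, hi⟩).a).2⟩ := by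
      have e1 : (Prog.setReal (cell 5) (.sub (coordE 2) (coordE 0))).run ⟨f, s.real⟩ =
          ⟨f, Function.update s.real (4 * n) ((L ⟨i, hi⟩).b - (L ⟨i, hi⟩).a).1⟩ := by
        rw [Prog.run, RealExpr.eval, (hc 2 (by omega) 0).1, (hc 0 (by omega) 0).1]
        simp only [NatExpr.eval, h5]
        rfl
      rw [Prog.run_seq, e1, Prog.run, RealExpr.eval, (hc 3 (by omega) _).2,
        (hc 1 (by omega) _).2]
      simp only [NatExpr.eval, h5]
      rfl
    rw [hrun2]
    refine hbase _ ?_ ⟨_, sub_ne_zero.2 (Ne.symm hd), ?_, by simp, Or.inr ⟨_, rfl⟩⟩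
    · intro c hc
      simp (disch := omega) only [Function.update_of_ne]
    · simp

/-- The direction used from here on is the one found in memory: either every segment is a point, or
it is the difference of the endpoints of some segment, to which all others are parallel. -/
theorem SegInv.common (h : SegInv k L n s) (hL : AllParallel L) :
    ∃ d : Pt, d ≠ 0 ∧ (∀ i, det2 d (L i).a = det2 d (L i).b) ∧ Common k L d s := by
  obtain ⟨d, hd, h1, h2, h3⟩ := h.dir
  refine ⟨d, hd, ?_, h.n0, h.n1, h.n2, by rw [h.n3]; ring, h.n4, h.n5, h.n19, h.seg, h.input,
    h1, h2⟩
  intro i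
  rcases h3 with h3 | ⟨j, rfl⟩
  · rw [h3 i i.2]
  · obtain ⟨d, -, hpar⟩ := hL
    obtain ⟨t, ht⟩ := hpar i
    obtain ⟨u, hu⟩ := hpar j
    rw [hu, ← sub_eq_zero]
    have h4 : (L i).b = (L i).a + t • d := by rw [← ht]; abel
    rw [h4]
    simp only [det2, Prod.fst_add, Prod.snd_add, Prod.smul_fst, Prod.smul_snd, smul_eq_mul]
    ring

theorem exec_segProg (L : Fin n → Seg) (k : ℕ) :
    Exec segProg (inputState L k) (setup.time + (n * ((cellLt 6 0).cost + 1 + segBody.time) +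
      ((cellLt 6 0).cost + 1))) (SegInv k L n) := by
  refine Exec.seq (Exec.of_loopFree (by simp [setup, Prog.LoopFree])
    (Q := SegInv k L 0) (segInv_setup L k)) fun s hs => Exec.loop (SegInv k L) ?_ ?_ hs
  · intro i hi s h
    refine ⟨?_, Exec.of_loopFree (by simp [segBody, Prog.LoopFree]) (segInv_segBody h hi)⟩
    simp only [cellLt, Cond.holds, NatExpr.eval, h.n6, h.n0]
    omega
  · intro s h
    simp only [cellLt, Cond.holds, NatExpr.eval, h.n6, h.n0]
    omega

theorem exec_copyProg (hn : 1 ≤ n) (h : HasResult k L s) :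
    Exec copyProg s (copyInit.time + (((2 * n - 1) *
      ((Cond.neg (.natLe (cell 1) (.const 1))).cost + 1 + copyBody.time) +
      ((Cond.neg (.natLe (cell 1) (.const 1))).cost + 1)) + copyEnd.time))
      fun s' => ∃ (e : Fin n → Bool) (m : ℕ) (σ : Fin m → Fin n),
        IsOutput s' e σ (area (endpointPlacement L e ∘ σ)) ∧
        IsOptimalSolution L k (endpointPlacement L e) σ := by
  obtain ⟨h2, h19, e, m, σ, hm, hsize, he, hσ, harea, hopt⟩ := h
  let I : ℕ → State → Prop := fun i s' => s'.nat 0 = 32 + 2 * n ∧ s'.nat 1 = 2 * n - i ∧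
    (∀ c, 2 * n - i < c → c ≤ 2 * n → s'.nat c = s.nat (32 + 2 * n + c)) ∧
    (∀ c, 32 + 2 * n ≤ c → s'.nat c = s.nat c) ∧ s'.real = s.real
  have h0 : I 0 (copyInit.run s) := by
    have hrun : copyInit.run s = ⟨Function.update (Function.update s.nat 0 (32 + 2 * n)) 1
        (2 * n), s.real⟩ := by
      simp [copyInit, Prog.run, NatExpr.eval, h2, h19]
    rw [hrun]
    refine ⟨by simp, by simp, fun c hc hc' => by omega, fun c hc => ?_, rfl⟩
    simp (disch := omega) only [Function.update_of_ne]
  refine Exec.seq (Exec.of_loopFree (by simp [copyInit, Prog.LoopFree]) (Q := I 0) h0)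
    fun s1 hs1 => Exec.seq (Exec.loop (M := 2 * n - 1) I ?_ ?_ hs1) ?_
  · rintro i hi s' ⟨i0, i1, i2, i3, i4⟩
    refine ⟨?_, Exec.of_loopFree (by simp [copyBody, Prog.LoopFree]) ?_⟩
    · simp only [Cond.holds, NatExpr.eval, i1]
      omega
    · have hrun : copyBody.run s' = ⟨Function.update (Function.update s'.nat (2 * n - i)
          (s.nat (32 + 2 * n + (2 * n - i)))) 1 (2 * n - (i + 1)), s.real⟩ := by
        simp (disch := omega) only [copyBody, Prog.run, NatExpr.eval, i0, i1, i4,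
          Function.update_of_ne, i3, Nat.sub_sub]
      rw [hrun]
      refine ⟨?_, by simp, fun c hc hc' => ?_, fun c hc => ?_, rfl⟩
      · simp (disch := omega) only [Function.update_of_ne, i0]
      · simp only
        rw [Function.update_of_ne (by omega)]
        rcases eq_or_ne c (2 * n - i) with rfl | hne
        · simp
        · rw [Function.update_of_ne hne, i2 c (by omega) hc']
      · simp (disch := omega) only [Function.update_of_ne, i3]
  · rintro s' ⟨i0, i1, i2, i3, i4⟩
    simp only [Cond.holds, NatExpr.eval, i1]
    omega
  · rintro s' ⟨i0, i1, i2, i3, i4⟩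
    refine Exec.of_loopFree (by simp [copyEnd, Prog.LoopFree]) ?_
    have hrun : copyEnd.run s' = ⟨Function.update (Function.update s'.nat 1
        (s.nat (32 + 2 * n + 1))) 0 (s.nat (32 + 2 * n)), s.real⟩ := by
      simp (disch := omega) only [copyEnd, Prog.run, NatExpr.eval, i0, i3, i4,
        Function.update_of_ne]
    have hcell : ∀ c, c ≤ 2 * n → (copyEnd.run s').nat c = s.nat (32 + 2 * n + c) := by
      intro c hc
      rw [hrun]
      rcases eq_or_ne c 0 with rfl | hc0
      · simp
      · rcases eq_or_ne c 1 with rfl | hc1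
        · simp
        · simp only
          rw [Function.update_of_ne hc0, Function.update_of_ne hc1, i2 c (by omega) hc]
    refine ⟨e, m, σ, ⟨?_, fun i => ?_, fun j => ?_, ?_⟩, hopt⟩
    · rw [hcell 0 (by omega), add_zero, hsize]
    · rw [hcell _ (by omega), ← he i]
      congr 1
      omega
    · rw [hcell _ (by omega), ← hσ j]
      congr 1
      omega
    · rw [hrun]
      exact harea

/-- A bound for the number of steps of the algorithm. -/
def totalTime (n k : ℕ) : ℕ :=
  (setup.time + (n * ((cellLt 6 0).cost + 1 + segBody.time) + ((cellLt 6 0).cost + 1))) +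
  ((tableInit.time + ((k - 2) *
    ((Cond.natLe (.add (cell 9) (.const 2)) (cell 1)).cost + 1 + layerTime (2 * n)) +
      ((Cond.natLe (.add (cell 9) (.const 2)) (cell 1)).cost + 1))) +
  (((Cond.natEq (cell 16) (.const 0)).cost + 1 + (pointProg.time +
    (traceInit.time + ((k * ((Cond.neg (.natLe (cell 9) (.const 0))).cost + 1 +
      (firstP.time + ((2 * n * ((cellLt 12 2).cost + 1 + searchBody.time) +
        ((cellLt 12 2).cost + 1)) + traceStep.time))) +
      ((Cond.neg (.natLe (cell 9) (.const 0))).cost + 1)) + traceEnd.time)))) +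
  (copyInit.time + (((2 * n - 1) *
    ((Cond.neg (.natLe (cell 1) (.const 1))).cost + 1 + copyBody.time) +
      ((Cond.neg (.natLe (cell 1) (.const 1))).cost + 1)) + copyEnd.time))))

theorem exec_maxMaxArea (hk : 1 ≤ k) (hkn : k ≤ n) (hL : AllParallel L) :
    Exec maxMaxArea (inputState L k) (totalTime n k) fun s' =>
      ∃ (e : Fin n → Bool) (m : ℕ) (σ : Fin m → Fin n),
        IsOutput s' e σ (area (endpointPlacement L e ∘ σ)) ∧
        IsOptimalSolution L k (endpointPlacement L e) σ := by
  refine Exec.seq (exec_segProg L k) fun s1 h1 => ?_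
  obtain ⟨d, hd, hpar, hC⟩ := h1.common hL
  refine Exec.seq (exec_tableProg hpar (hk.trans hkn) hC h1.buffer h1.n16 h1.n17 h1.n18 h1.zero)
    fun s2 h2 => Exec.seq (Exec.branch (fun h3 => exec_pointProg hd hpar hk hkn h2 h3)
      fun h3 => exec_traceProg hd hpar hkn h2 h3) fun s3 h3 => exec_copyProg (hk.trans hkn) h3

/-- A loop of `2 * n` rounds raises the exponent by one. The constant is explicit so that nested
uses determine it: loops over `p`, `u` and `l` make a layer cubic. -/
theorem loop_time_le (hn : 1 ≤ n) {T C j : ℕ} (hT : T ≤ C * n ^ j) (a b c e : ℕ) :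
    a + ((2 * n * (b + T) + c) + e) ≤ (a + 2 * b + 2 * C + c + e) * n ^ (j + 1) := by
  have h1 : 1 ≤ n ^ (j + 1) := Nat.one_le_pow _ _ hn
  have h2 : n ≤ n ^ (j + 1) := Nat.le_self_pow (by omega) n
  have h3 : n * T ≤ C * n ^ (j + 1) := by
    calc n * T ≤ n * (C * n ^ j) := by gcongr
      _ = C * n ^ (j + 1) := by ring
  nlinarith [Nat.mul_le_mul_left a h1, Nat.mul_le_mul_left b h2, Nat.mul_le_mul_left c h1,
    Nat.mul_le_mul_left e h1]

theorem exists_layerTime_le : ∃ C : ℕ, ∀ n : ℕ, 1 ≤ n → layerTime (2 * n) ≤ C * n ^ 3 :=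
  ⟨_, fun _ hn => loop_time_le hn (loop_time_le hn (loop_time_le (j := 0) hn
    (T := relaxBody.time) (by rw [pow_zero, mul_one]) _ _ _ _) _ _ _ _) _ _ _ _⟩

theorem exists_totalTime_le :
    ∃ C : ℕ, ∀ n k : ℕ, 1 ≤ n → 1 ≤ k → totalTime n k ≤ C * (k * n ^ 3) := by
  obtain ⟨C₁, hC₁⟩ := exists_layerTime_le
  obtain ⟨C₂, hC₂⟩ : ∃ C : ℕ, ∀ n : ℕ, 1 ≤ n →
      firstP.time + ((2 * n * ((cellLt 12 2).cost + 1 + searchBody.time) +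
        ((cellLt 12 2).cost + 1)) + traceStep.time) ≤ C * n ^ 1 :=
    ⟨_, fun n hn => loop_time_le (j := 0) hn (T := searchBody.time) (by rw [pow_zero, mul_one])
      _ _ _ _⟩
  have key : ∀ a b c T C n k M : ℕ, 1 ≤ n → 1 ≤ k → T ≤ C * n ^ 3 → M ≤ k →
      a + (M * (b + T) + c) ≤ (a + b + C + c) * (k * n ^ 3) := by
    intro a b c T C n k M hn hk hT hM
    have h1 : 1 ≤ n ^ 3 := Nat.one_le_pow _ _ hn
    have h2 : 1 ≤ k * n ^ 3 := Nat.mul_pos hk h1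
    have h3 : M * (b + T) ≤ k * (b * n ^ 3 + C * n ^ 3) := by
      gcongr
      exact Nat.le_mul_of_pos_right _ h1
    nlinarith [Nat.mul_le_mul_left a h2, Nat.mul_le_mul_left c h2]
  have key' : ∀ a b c n k M : ℕ, 1 ≤ n → 1 ≤ k → M ≤ 2 * n →
      a + (M * b + c) ≤ (a + 2 * b + c) * (k * n ^ 3) := by
    intro a b c n k M hn hk hM
    have h1 : n ≤ k * n ^ 3 := (Nat.le_self_pow (by omega) n).trans (Nat.le_mul_of_pos_left _ hk)
    have h2 : 1 ≤ k * n ^ 3 := hn.trans h1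
    have h3 : M * b ≤ 2 * (k * n ^ 3) * b := by
      gcongr
      exact hM.trans (by omega)
    nlinarith [Nat.mul_le_mul_left a h2, Nat.mul_le_mul_left c h2]
  have key'' : ∀ a n k : ℕ, 1 ≤ n → 1 ≤ k → a ≤ a * (k * n ^ 3) := fun a n k hn hk =>
    Nat.le_mul_of_pos_right _ (Nat.mul_pos hk (Nat.one_le_pow _ _ hn))
  -- The constant is left open and read off from the sum of the bounds `t1` to `t5`; the factor `k`
  -- comes from the layers alone, and every other stage is of lower or equal order.
  apply Exists.intro
  intro n k hn hk
  have t1 := key' setup.time ((cellLt 6 0).cost + 1 + segBody.time) ((cellLt 6 0).cost + 1) n k n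
    hn hk (by omega)
  have t2 := key tableInit.time ((Cond.natLe (.add (cell 9) (.const 2)) (cell 1)).cost + 1)
    ((Cond.natLe (.add (cell 9) (.const 2)) (cell 1)).cost + 1) _ C₁ n k (k - 2) hn hk
    (hC₁ n hn) (by omega)
  have t3 := key traceInit.time ((Cond.neg (.natLe (cell 9) (.const 0))).cost + 1)
    ((Cond.neg (.natLe (cell 9) (.const 0))).cost + 1) _ C₂ n k k hn hk
    ((hC₂ n hn).trans (by gcongr; omega)) le_rfl
  have t4 := key' copyInit.time ((Cond.neg (.natLe (cell 1) (.const 1))).cost + 1 +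
    copyBody.time) ((Cond.neg (.natLe (cell 1) (.const 1))).cost + 1) n k (2 * n - 1) hn hk
    (by omega)
  have t5 := key'' ((Cond.natEq (cell 16) (.const 0)).cost + 1 + pointProg.time + traceEnd.time +
    copyEnd.time) n k hn hk
  have h := add_le_add (add_le_add (add_le_add (add_le_add t1 t2) t3) t4) t5
  rw [← add_mul, ← add_mul, ← add_mul, ← add_mul] at h
  refine le_trans (le_of_eq ?_) h
  rw [totalTime]
  ring

end

end Imprecise

theorem mainTheorem7 :
    (∀ (n k : ℕ) (L : Fin n → Imprecise.Seg), 1 ≤ k → k ≤ n → Imprecise.AllParallel L →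
      ∃ (e : Fin n → Bool) (m : ℕ) (σ : Fin m → Fin n),
        Imprecise.IsOptimalSolution L k (Imprecise.endpointPlacement L e) σ) ∧
    ∃ (prog : RealRAM.Prog) (C : ℕ),
      ∀ (n k : ℕ) (L : Fin n → Imprecise.Seg), 1 ≤ k → k ≤ n → Imprecise.AllParallel L →
        ∃ (s : RealRAM.State) (t : ℕ),
          RealRAM.Runs prog (Imprecise.inputState L k) s t ∧ t ≤ C * (k * n ^ 3) ∧
          ∃ (e : Fin n → Bool) (m : ℕ) (σ : Fin m → Fin n),
            Imprecise.IsOutput s e σ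
              (Imprecise.area (Imprecise.endpointPlacement L e ∘ σ)) ∧
            Imprecise.IsOptimalSolution L k (Imprecise.endpointPlacement L e) σ := by
  refine ⟨fun n k L hk hkn hL => ?_, Imprecise.maxMaxArea, ?_⟩
  -- Existence of an optimal solution at endpoints follows by forgetting the run that outputs one.
  · obtain ⟨s, t, -, -, e, m, σ, -, h⟩ := Imprecise.exec_maxMaxArea hk hkn hL
    exact ⟨e, m, σ, h⟩
  · obtain ⟨C, hC⟩ := Imprecise.exists_totalTime_le
    refine ⟨C, fun n k L hk hkn hL => ?_⟩
    obtain ⟨s, t, hrun, ht, h⟩ := Imprecise.exec_maxMaxArea hk hkn hL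
    exact ⟨s, t, hrun, ht.trans (hC n k (hk.trans hkn) hk), h⟩
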